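/- Let $\mathcal B$ be a strict 2-category and $n\ge 0$. Write $g\cdot f$ for horizontal composition (first $f$, then $g$) and $\circ$ for vertical composition. Let $\mathbb B\Delta_+$ be the one-object strict 2-category whose 1-cells are the finite ordinals $[k]$, $k\ge -1$ (with $[k]$ having $k+1$ elements), composed by ordinal sum, and whose 2-cells are monotone maps; let $\eta:[-1]\to[0]$ and $\mu:[0]\cdot[0]=[1]\to[0]$ be the unique maps. For strict 2-categories $\mathcal X,\mathcal Y$, the lax Gray tensor product $\mathcal X\otimes_l\mathcal Y$ is the strict 2-category with 0-cells the pairs $(x,y)$; with 1-cells generated under composition by $(f,\mathrm{Id})$ and $(\mathrm{Id},g)$, subject to compatibility of each of the two families with composites and identities; and with 2-cells generated under vertical and horizontal composition by $(\varphi,\mathrm{Id})$, $(\mathrm{Id},\psi)$ and $\gamma_{f,g}:(f,\mathrm{Id})\cdot(\mathrm{Id},g)\to(\mathrm{Id},g)\cdot(f,\mathrm{Id})$, subject to: each of the first two families is compatible with identities, vertical and horizontal composition; $\gamma_{f,\mathrm{Id}}$ and $\gamma_{\mathrm{Id},g}$ are identities; $\gamma_{f_1\cdot f_2,g}=(\gamma_{f_1,g}\cdot(f_2,\mathrm{Id}))\circ((f_1,\mathrm{Id})\cdot\gamma_{f_2,g})$;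 $\gamma_{f,g_1\cdot g_2}=((\mathrm{Id},g_1)\cdot\gamma_{f,g_2})\circ(\gamma_{f,g_1}\cdot(\mathrm{Id},g_2))$; and, for 2-cells $\varphi:f_1\to f_2$ and $\psi:g_1\to g_2$, $\gamma_{f_2,g_2}\circ((\varphi,\mathrm{Id})\cdot(\mathrm{Id},\psi))=((\mathrm{Id},\psi)\cdot(\varphi,\mathrm{Id}))\circ\gamma_{f_1,g_1}$. Put $\mathbf{mnd}(\mathcal X)=\mathcal X\otimes_l\mathbb B\Delta_+$, let $\mathbf{mnd}^n(\mathbb 1)$ be its $n$-fold iterate on the terminal 2-category $\mathbb 1$, and let $(\mathbb B\Delta_+)^{\otimes_l n}$ be the left-bracketed $n$-fold tensor power (equal to $\mathbb 1$ for $n=0$ and to $\mathbb B\Delta_+$ for $n=1$). Let $\mathcal X_n$ be either of these two 2-categories, and for $1\le i\le n$ write $\{-\}_i$ for cells of the $i$-th factor $\mathbb B\Delta_+$ and $\gamma^{i,j}$ ($i<j$) for the interchange cells $\{[0]\}_i\cdot\{[0]\}_j\to\{[0]\}_j\cdot\{[0]\}_i$. Sending a strict 2-functor $D:\mathcal X_n\to\mathcal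 B$ (a $\mathbb 1$-parametric $n$-fold distributive law in $\mathcal B$) to the image $a$ of the 0-cell of $\mathcal X_n$, the images $t_i,\eta^i,\mu^i$ of $\{[0]\}_i,\{\eta\}_i,\{\mu\}_i$ and the images $\sigma_{i,j}$ of $\gamma^{i,j}$ is a bijection from the set of such 2-functors onto the set of all data consisting of 1. a 0-cell $a$ of $\mathcal B$; 2. 1-cells $t_1,\dots,t_n:a\to a$ and 2-cells $\eta^i:\mathrm{Id}_a\to t_i$, $\mu^i:t_i\cdot t_i\to t_i$ making each $t_i$ a monad on $a$; 3. for $1\le i<j\le n$, a 2-cell $\sigma_{i,j}:t_i\cdot t_j\to t_j\cdot t_i$ that is a distributive law in the sense of Beck, i.e. $\sigma_{i,j}\circ(\eta^i\cdot t_j)=t_j\cdot\eta^i$, $\sigma_{i,j}\circ(t_i\cdot\eta^j)=\eta^j\cdot t_i$, $\sigma_{i,j}\circ(\mu^i\cdot t_j)=(t_j\cdot\mu^i)\circ(\sigma_{i,j}\cdot t_i)\circ(t_i\cdot\sigma_{i,j})$ and $\sigma_{i,j}\circ(t_i\cdot\mu^j)=(\mu^j\cdot t_i)\circ(t_j\cdot\sigma_{i,j})\circ(\sigma_{i,j}\cdot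 t_j)$; such that for all $1\le i<j<k\le n$ the Yang–Baxter equation holds: $$(t_k\cdot\sigma_{i,j})\circ(\sigma_{i,k}\cdot t_j)\circ(t_i\cdot\sigma_{j,k})=(\sigma_{j,k}\cdot t_i)\circ(t_j\cdot\sigma_{i,k})\circ(\sigma_{i,j}\cdot t_k).$$ These data are iterated distributive laws in the sense of Cheng; the cases $n=2,3$ describe $\mathbb 1$-parametric distributive laws and $\mathbb 1$-parametric 3-fold distributive laws. -/

import Mathlib

open CategoryTheory Bicategory

universe w v u w₁ v₁ u₁ w₂ v₂ u₂

/-! Mathlib composes 1-cells in diagrammatic order: the composite usually written `g · f`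
(first `f`, then `g`) is `f ≫ g`.  Accordingly the whiskering `g · φ` is `φ ▷ g`, and `φ · f` is
`f ◁ φ`. -/

/-! ## The lax Gray tensor product of two strict 2-categories -/

namespace GrayTensor

section Cells

variable (B : Type u₁) [Bicategory.{w₁, v₁} B] (C : Type u₂) [Bicategory.{w₂, v₂} C]

/-- The 0-cells: pairs of 0-cells. -/
def Pair : Type max u₁ u₂ := B × C

/-- The generating 1-cells: pairs of 1-cells one of which is an identity.
`left f c` is `(f, Id)` and `right b g` is `(Id, g)`. -/
inductive Gen : Pair B C → Pair B C → Type max u₁ u₂ v₁ v₂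
  | left {b b' : B} (f : b ⟶ b') (c : C) : Gen (b, c) (b', c)
  | right (b : B) {c c' : C} (g : c ⟶ c') : Gen (b, c) (b, c')

instance : Quiver.{max u₁ u₂ v₁ v₂} (Pair B C) where
  Hom := Gen B C

/-- Composable sequences consisting of one generating 1-cell. -/
def single {x y : Pair B C} (h : Gen B C x y) :
    (show Paths (Pair B C) from x) ⟶ (show Paths (Pair B C) from y) :=
  (Paths.of (Pair B C)).map h

/-- The relations between composable sequences of generating 1-cells: each of the two
families is compatible with composition and with identities. -/
inductive OneRel : HomRel (Paths (Pair B C))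
  | left_id (b : B) (c : C) : OneRel (single B C (.left (𝟙 b) c)) (𝟙 _)
  | left_comp {b b' b'' : B} (f : b ⟶ b') (f' : b' ⟶ b'') (c : C) :
      OneRel (single B C (.left f c) ≫ single B C (.left f' c)) (single B C (.left (f ≫ f') c))
  | right_id (b : B) (c : C) : OneRel (single B C (.right b (𝟙 c))) (𝟙 _)
  | right_comp (b : B) {c c' c'' : C} (g : c ⟶ c') (g' : c' ⟶ c'') :
      OneRel (single B C (.right b g) ≫ single B C (.right b g')) (single B C (.right b (g ≫ g')))

end Cells

end GrayTensor

/-- The lax Gray tensor product `B ⊗ₗ C`.  The 0-cells and 1-cells are those of the category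
generated by the 1-cells `(f, Id)` and `(Id, g)` subject to `GrayTensor.OneRel`. -/
def GrayTensor (B : Type u₁) [Bicategory.{w₁, v₁} B] (C : Type u₂) [Bicategory.{w₂, v₂} C] :
    Type max u₁ u₂ :=
  CategoryTheory.Quotient (GrayTensor.OneRel B C)

namespace GrayTensor

variable {B : Type u₁} [Bicategory.{w₁, v₁} B] {C : Type u₂} [Bicategory.{w₂, v₂} C]

/-- The category of 0-cells and 1-cells of `B ⊗ₗ C`. -/
@[reducible]
def oneCategory : Category.{max u₁ u₂ v₁ v₂} (GrayTensor B C) :=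
  CategoryTheory.Quotient.category (OneRel B C)

instance : CategoryStruct.{max u₁ u₂ v₁ v₂} (GrayTensor B C) :=
  oneCategory.toCategoryStruct

/-- The 0-cell `(b, c)`. -/
def pt (b : B) (c : C) : GrayTensor B C := ⟨(b, c)⟩

/-- The 1-cell `(f, Id)`. -/
def left {b b' : B} (f : b ⟶ b') (c : C) : pt b c ⟶ pt b' c :=
  (CategoryTheory.Quotient.functor (OneRel B C)).map (single B C (.left f c))

/-- The 1-cell `(Id, g)`. -/
def right (b : B) {c c' : C} (g : c ⟶ c') : pt b c ⟶ pt b c' :=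
  (CategoryTheory.Quotient.functor (OneRel B C)).map (single B C (.right b g))

theorem one_id_comp {x y : GrayTensor B C} (f : x ⟶ y) : 𝟙 x ≫ f = f :=
  oneCategory.id_comp f

theorem one_comp_id {x y : GrayTensor B C} (f : x ⟶ y) : f ≫ 𝟙 y = f :=
  oneCategory.comp_id f

theorem one_assoc {x y z t : GrayTensor B C} (f : x ⟶ y) (g : y ⟶ z) (h : z ⟶ t) :
    (f ≫ g) ≫ h = f ≫ g ≫ h :=
  oneCategory.assoc f g h

theorem left_id (b : B) (c : C) : left (𝟙 b) c = 𝟙 (pt b c) :=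
  CategoryTheory.Quotient.sound (OneRel B C) (OneRel.left_id b c)

theorem left_comp {b b' b'' : B} (f : b ⟶ b') (f' : b' ⟶ b'') (c : C) :
    left (f ≫ f') c = left f c ≫ left f' c :=
  (CategoryTheory.Quotient.sound (OneRel B C) (OneRel.left_comp f f' c)).symm

theorem right_id (b : B) (c : C) : right b (𝟙 c) = 𝟙 (pt b c) :=
  CategoryTheory.Quotient.sound (OneRel B C) (OneRel.right_id b c)

theorem right_comp (b : B) {c c' c'' : C} (g : c ⟶ c') (g' : c' ⟶ c'') :
    right b (g ≫ g') = right b g ≫ right b g' :=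
  (CategoryTheory.Quotient.sound (OneRel B C) (OneRel.right_comp b g g')).symm

/-- Formal expressions for 2-cells: structural identities (one for each equality of 1-cells),
closed under vertical composition and whiskering, and the three generating families
`(φ, Id)`, `(Id, ψ)` and `γ_{f, g} : (f, Id) · (Id, g) → (Id, g) · (f, Id)`. -/
inductive Expr : ∀ {x y : GrayTensor B C}, (x ⟶ y) → (x ⟶ y) →
    Type max u₁ u₂ v₁ v₂ w₁ w₂
  | eq {x y : GrayTensor B C} {f g : x ⟶ y} (h : f = g) : Expr f g
  | vcomp {x y : GrayTensor B C} {f g h : x ⟶ y} (η : Expr f g) (θ : Expr g h) : Expr f h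
  | whiskerLeft {x y z : GrayTensor B C} (f : x ⟶ y) {g h : y ⟶ z} (η : Expr g h) :
      Expr (f ≫ g) (f ≫ h)
  | whiskerRight {x y z : GrayTensor B C} {f g : x ⟶ y} (η : Expr f g) (h : y ⟶ z) :
      Expr (f ≫ h) (g ≫ h)
  | left {b b' : B} {f f' : b ⟶ b'} (φ : f ⟶ f') (c : C) :
      Expr (GrayTensor.left f c) (GrayTensor.left f' c)
  | right (b : B) {c c' : C} {g g' : c ⟶ c'} (ψ : g ⟶ g') :
      Expr (GrayTensor.right b g) (GrayTensor.right b g')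
  | swap {b b' : B} {c c' : C} (f : b ⟶ b') (g : c ⟶ c') :
      Expr (GrayTensor.right b g ≫ GrayTensor.left f c')
        (GrayTensor.left f c ≫ GrayTensor.right b' g)

section

local infixr:80 " ⬝ " => Expr.vcomp

/-- The relations between 2-cells. -/
inductive TwoRel : ∀ {x y : GrayTensor B C} {f g : x ⟶ y}, Expr f g → Expr f g → Prop
  -- congruence
  | vcomp_left {x y : GrayTensor B C} {f g h : x ⟶ y} {η η' : Expr f g} (θ : Expr g h) :
      TwoRel η η' → TwoRel (η ⬝ θ) (η' ⬝ θ)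
  | vcomp_right {x y : GrayTensor B C} {f g h : x ⟶ y} (η : Expr f g) {θ θ' : Expr g h} :
      TwoRel θ θ' → TwoRel (η ⬝ θ) (η ⬝ θ')
  | whiskerLeft {x y z : GrayTensor B C} (f : x ⟶ y) {g h : y ⟶ z} {η η' : Expr g h} :
      TwoRel η η' → TwoRel (.whiskerLeft f η) (.whiskerLeft f η')
  | whiskerRight {x y z : GrayTensor B C} {f g : x ⟶ y} {η η' : Expr f g} (h : y ⟶ z) :
      TwoRel η η' → TwoRel (.whiskerRight η h) (.whiskerRight η' h)
  -- the axioms of a strict 2-category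
  | eq_eq {x y : GrayTensor B C} {f g h : x ⟶ y} (p : f = g) (q : g = h) :
      TwoRel (.eq p ⬝ .eq q) (.eq (p.trans q))
  | id_vcomp {x y : GrayTensor B C} {f g : x ⟶ y} (η : Expr f g) : TwoRel (.eq rfl ⬝ η) η
  | vcomp_id {x y : GrayTensor B C} {f g : x ⟶ y} (η : Expr f g) : TwoRel (η ⬝ .eq rfl) η
  | assoc {x y : GrayTensor B C} {f g h k : x ⟶ y} (η : Expr f g) (θ : Expr g h)
      (ι : Expr h k) : TwoRel ((η ⬝ θ) ⬝ ι) (η ⬝ (θ ⬝ ι))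
  | whiskerLeft_eq {x y z : GrayTensor B C} (f : x ⟶ y) {g h : y ⟶ z} (p : g = h) :
      TwoRel (.whiskerLeft f (.eq p)) (.eq (congrArg (fun k => f ≫ k) p))
  | whiskerLeft_vcomp {x y z : GrayTensor B C} (f : x ⟶ y) {g h k : y ⟶ z}
      (η : Expr g h) (θ : Expr h k) :
      TwoRel (.whiskerLeft f (η ⬝ θ)) (.whiskerLeft f η ⬝ .whiskerLeft f θ)
  | whiskerRight_eq {x y z : GrayTensor B C} {f g : x ⟶ y} (p : f = g) (h : y ⟶ z) :
      TwoRel (.whiskerRight (.eq p) h) (.eq (congrArg (fun k => k ≫ h) p))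
  | whiskerRight_vcomp {x y z : GrayTensor B C} {f g h : x ⟶ y} (η : Expr f g)
      (θ : Expr g h) (k : y ⟶ z) :
      TwoRel (.whiskerRight (η ⬝ θ) k) (.whiskerRight η k ⬝ .whiskerRight θ k)
  | id_whiskerLeft {x y : GrayTensor B C} {f g : x ⟶ y} (η : Expr f g) :
      TwoRel (.whiskerLeft (𝟙 x) η)
        (.eq (one_id_comp f) ⬝ (η ⬝ .eq (one_id_comp g).symm))
  | comp_whiskerLeft {x y z t : GrayTensor B C} (f : x ⟶ y) (g : y ⟶ z) {h h' : z ⟶ t}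
      (η : Expr h h') :
      TwoRel (.whiskerLeft (f ≫ g) η)
        (.eq (one_assoc f g h) ⬝ (.whiskerLeft f (.whiskerLeft g η) ⬝
          .eq (one_assoc f g h').symm))
  | whiskerRight_id {x y : GrayTensor B C} {f g : x ⟶ y} (η : Expr f g) :
      TwoRel (.whiskerRight η (𝟙 y))
        (.eq (one_comp_id f) ⬝ (η ⬝ .eq (one_comp_id g).symm))
  | whiskerRight_comp {x y z t : GrayTensor B C} {f f' : x ⟶ y} (η : Expr f f') (g : y ⟶ z)
      (h : z ⟶ t) :
      TwoRel (.whiskerRight η (g ≫ h))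
        (.eq (one_assoc f g h).symm ⬝ (.whiskerRight (.whiskerRight η g) h ⬝
          .eq (one_assoc f' g h)))
  | whisker_assoc {x y z t : GrayTensor B C} (f : x ⟶ y) {g g' : y ⟶ z} (η : Expr g g')
      (h : z ⟶ t) :
      TwoRel (.whiskerRight (.whiskerLeft f η) h)
        (.eq (one_assoc f g h) ⬝ (.whiskerLeft f (.whiskerRight η h) ⬝
          .eq (one_assoc f g' h).symm))
  | whisker_exchange {x y z : GrayTensor B C} {f g : x ⟶ y} {h k : y ⟶ z} (η : Expr f g)
      (θ : Expr h k) :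
      TwoRel (.whiskerLeft f θ ⬝ .whiskerRight η k) (.whiskerRight η h ⬝ .whiskerLeft g θ)
  -- the family `(φ, Id)` is compatible with identities, vertical and horizontal composition
  | left_id {b b' : B} (f : b ⟶ b') (c : C) : TwoRel (.left (𝟙 f) c) (.eq rfl)
  | left_vcomp {b b' : B} {f g h : b ⟶ b'} (φ : f ⟶ g) (φ' : g ⟶ h) (c : C) :
      TwoRel (.left (φ ≫ φ') c) (.left φ c ⬝ .left φ' c)
  | left_whiskerLeft {b b' b'' : B} (f : b ⟶ b') {g h : b' ⟶ b''} (φ : g ⟶ h) (c : C) :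
      TwoRel (.left (f ◁ φ) c)
        (.eq (left_comp f g c) ⬝ (.whiskerLeft (GrayTensor.left f c) (.left φ c) ⬝
          .eq (left_comp f h c).symm))
  | left_whiskerRight {b b' b'' : B} {f g : b ⟶ b'} (φ : f ⟶ g) (h : b' ⟶ b'') (c : C) :
      TwoRel (.left (φ ▷ h) c)
        (.eq (left_comp f h c) ⬝ (.whiskerRight (.left φ c) (GrayTensor.left h c) ⬝
          .eq (left_comp g h c).symm))
  -- the family `(Id, ψ)` is compatible with identities, vertical and horizontal composition
  | right_id (b : B) {c c' : C} (g : c ⟶ c') : TwoRel (.right b (𝟙 g)) (.eq rfl)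
  | right_vcomp (b : B) {c c' : C} {f g h : c ⟶ c'} (ψ : f ⟶ g) (ψ' : g ⟶ h) :
      TwoRel (.right b (ψ ≫ ψ')) (.right b ψ ⬝ .right b ψ')
  | right_whiskerLeft (b : B) {c c' c'' : C} (f : c ⟶ c') {g h : c' ⟶ c''} (ψ : g ⟶ h) :
      TwoRel (.right b (f ◁ ψ))
        (.eq (right_comp b f g) ⬝ (.whiskerLeft (GrayTensor.right b f) (.right b ψ) ⬝
          .eq (right_comp b f h).symm))
  | right_whiskerRight (b : B) {c c' c'' : C} {f g : c ⟶ c'} (ψ : f ⟶ g) (h : c' ⟶ c'') :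
      TwoRel (.right b (ψ ▷ h))
        (.eq (right_comp b f h) ⬝ (.whiskerRight (.right b ψ) (GrayTensor.right b h) ⬝
          .eq (right_comp b g h).symm))
  -- `γ_{Id, g}` and `γ_{f, Id}` are identities
  | swap_id_left (b : B) {c c' : C} (g : c ⟶ c') :
      TwoRel (.swap (𝟙 b) g)
        (.eq (by rw [GrayTensor.left_id, GrayTensor.left_id, one_comp_id, one_id_comp]))
  | swap_id_right {b b' : B} (f : b ⟶ b') (c : C) :
      TwoRel (.swap f (𝟙 c))
        (.eq (by rw [GrayTensor.right_id, GrayTensor.right_id, one_comp_id, one_id_comp]))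
  -- `γ_{f' · f, g} = (γ_{f', g} · (f, Id)) ∘ ((f', Id) · γ_{f, g})`
  | swap_comp_left {b b' b'' : B} {c c' : C} (f : b ⟶ b') (f' : b' ⟶ b'') (g : c ⟶ c') :
      TwoRel (.swap (f ≫ f') g)
        (.eq (by rw [left_comp, one_assoc]) ⬝
          (.whiskerRight (.swap f g) (GrayTensor.left f' c') ⬝
            (.eq (one_assoc _ _ _) ⬝
              (.whiskerLeft (GrayTensor.left f c) (.swap f' g) ⬝
                .eq (by rw [left_comp, one_assoc])))))
  -- `γ_{f, g' · g} = ((Id, g') · γ_{f, g}) ∘ (γ_{f, g'} · (Id, g))`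
  | swap_comp_right {b b' : B} {c c' c'' : C} (f : b ⟶ b') (g : c ⟶ c') (g' : c' ⟶ c'') :
      TwoRel (.swap f (g ≫ g'))
        (.eq (by rw [right_comp, one_assoc]) ⬝
          (.whiskerLeft (GrayTensor.right b g) (.swap f g') ⬝
            (.eq (one_assoc _ _ _).symm ⬝
              (.whiskerRight (.swap f g) (GrayTensor.right b' g') ⬝
                .eq (by rw [right_comp, one_assoc])))))
  -- naturality: `γ_{f', g'} ∘ ((φ, Id) · (Id, ψ)) = ((Id, ψ) · (φ, Id)) ∘ γ_{f, g}`
  | swap_naturality {b b' : B} {c c' : C} {f f' : b ⟶ b'} (φ : f ⟶ f') {g g' : c ⟶ c'}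
      (ψ : g ⟶ g') :
      TwoRel
        ((.whiskerRight (.right b ψ) (GrayTensor.left f c') ⬝
          .whiskerLeft (GrayTensor.right b g') (.left φ c')) ⬝ .swap f' g')
        (.swap f g ⬝ (.whiskerRight (.left φ c) (GrayTensor.right b' g) ⬝
          .whiskerLeft (GrayTensor.left f' c) (.right b' ψ)))

end

/-- The category of 1-cells between two 0-cells and 2-cells between them. -/
instance homCategory (x y : GrayTensor B C) :
    Category.{max u₁ u₂ v₁ v₂ w₁ w₂} (x ⟶ y) where
  Hom f g := Quot (TwoRel (f := f) (g := g))
  id f := Quot.mk _ (.eq rfl)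
  comp := Quot.map₂ Expr.vcomp (fun η _ _ h => TwoRel.vcomp_right η h)
    (fun _ _ θ h => TwoRel.vcomp_left θ h)
  id_comp := by
    rintro f g ⟨η⟩
    exact Quot.sound (TwoRel.id_vcomp η)
  comp_id := by
    rintro f g ⟨η⟩
    exact Quot.sound (TwoRel.vcomp_id η)
  assoc := by
    rintro f g h k ⟨η⟩ ⟨θ⟩ ⟨ι⟩
    exact Quot.sound (TwoRel.assoc η θ ι)

/-- The 2-cell represented by an expression. -/
def cell {x y : GrayTensor B C} {f g : x ⟶ y} (η : Expr f g) : f ⟶ g :=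
  Quot.mk _ η

theorem cell_eq {x y : GrayTensor B C} {f g : x ⟶ y} (p : f = g) :
    cell (.eq p) = eqToHom p := by
  subst p
  rfl

theorem cell_vcomp {x y : GrayTensor B C} {f g h : x ⟶ y} (η : Expr f g) (θ : Expr g h) :
    cell (.vcomp η θ) = cell η ≫ cell θ :=
  rfl

theorem cell_sound {x y : GrayTensor B C} {f g : x ⟶ y} {η θ : Expr f g} (h : TwoRel η θ) :
    cell η = cell θ :=
  Quot.sound h

/-- The lax Gray tensor product is a 2-category. -/
instance bicategory :
    Bicategory.{max u₁ u₂ v₁ v₂ w₁ w₂, max u₁ u₂ v₁ v₂} (GrayTensor B C) where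
  homCategory x y := homCategory x y
  whiskerLeft f _ _ := Quot.map (Expr.whiskerLeft f) (fun _ _ h => TwoRel.whiskerLeft f h)
  whiskerRight η h :=
    Quot.map (fun η => Expr.whiskerRight η h) (fun _ _ r => TwoRel.whiskerRight h r) η
  associator f g h := eqToIso (one_assoc f g h)
  leftUnitor f := eqToIso (one_id_comp f)
  rightUnitor f := eqToIso (one_comp_id f)
  whiskerLeft_id f g := Quot.sound (TwoRel.whiskerLeft_eq f rfl)
  whiskerLeft_comp := by
    rintro _ _ _ f _ _ _ ⟨η⟩ ⟨θ⟩
    exact Quot.sound (TwoRel.whiskerLeft_vcomp f η θ)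
  id_whiskerLeft := by
    rintro _ _ f g ⟨η⟩
    simp only [eqToIso.hom, eqToIso.inv, ← cell_eq]
    exact Quot.sound (TwoRel.id_whiskerLeft η)
  comp_whiskerLeft := by
    rintro _ _ _ _ f g _ _ ⟨η⟩
    simp only [eqToIso.hom, eqToIso.inv, ← cell_eq]
    exact Quot.sound (TwoRel.comp_whiskerLeft f g η)
  id_whiskerRight f g := Quot.sound (TwoRel.whiskerRight_eq rfl g)
  comp_whiskerRight := by
    rintro _ _ _ _ _ _ ⟨η⟩ ⟨θ⟩ k
    exact Quot.sound (TwoRel.whiskerRight_vcomp η θ k)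
  whiskerRight_id := by
    rintro _ _ f g ⟨η⟩
    simp only [eqToIso.hom, eqToIso.inv, ← cell_eq]
    exact Quot.sound (TwoRel.whiskerRight_id η)
  whiskerRight_comp := by
    rintro _ _ _ _ _ _ ⟨η⟩ g h
    simp only [eqToIso.hom, eqToIso.inv, ← cell_eq]
    exact Quot.sound (TwoRel.whiskerRight_comp η g h)
  whisker_assoc := by
    rintro _ _ _ _ f _ _ ⟨η⟩ h
    simp only [eqToIso.hom, eqToIso.inv, ← cell_eq]
    exact Quot.sound (TwoRel.whisker_assoc f η h)
  whisker_exchange := by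
    rintro _ _ _ _ _ _ _ ⟨η⟩ ⟨θ⟩
    exact Quot.sound (TwoRel.whisker_exchange η θ)
  pentagon f g h i := by
    simp only [eqToIso.hom, ← cell_eq]
    refine ((congrArg₂ (fun a b => a ≫ (cell _ ≫ b))
      (Quot.sound (TwoRel.whiskerRight_eq _ i)) (Quot.sound (TwoRel.whiskerLeft_eq f _))).trans
        ?_)
    change cell (.eq _) ≫ cell (.eq _) ≫ cell (.eq _) = cell (.eq _) ≫ cell (.eq _)
    simp only [cell_eq, eqToHom_trans]
  triangle f g := by
    simp only [eqToIso.hom, ← cell_eq]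
    refine (congrArg (fun b => cell _ ≫ b) (Quot.sound (TwoRel.whiskerLeft_eq f _))).trans
      (Eq.trans ?_ (Quot.sound (TwoRel.whiskerRight_eq _ g)).symm)
    change cell (.eq _) ≫ cell (.eq _) = cell (.eq _)
    simp only [cell_eq, eqToHom_trans]

instance strict : Bicategory.Strict (GrayTensor B C) where
  id_comp := one_id_comp
  comp_id := one_comp_id
  assoc := one_assoc
  leftUnitor_eqToIso _ := rfl
  rightUnitor_eqToIso _ := rfl
  associator_eqToIso _ _ _ := rfl

/-- The strict 2-functor `(-, c) : B → B ⊗ₗ C`. -/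
def inl [Bicategory.Strict B] (c : C) : StrictPseudofunctor B (GrayTensor B C) :=
  StrictPseudofunctor.mk''
    { obj := fun b => pt b c
      map := fun f => left f c
      map₂ := fun φ => cell (.left φ c)
      map₂_id := fun f => cell_sound (TwoRel.left_id f c)
      map₂_comp := fun φ φ' => cell_sound (TwoRel.left_vcomp φ φ' c)
      map_id := fun b => left_id b c
      map_comp := fun f g => left_comp f g c
      map₂_whisker_left := fun f _ _ φ => by
        simp only [← cell_eq]
        exact cell_sound (TwoRel.left_whiskerLeft f φ c)
      map₂_whisker_right := fun φ h => by
        simp only [← cell_eq]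
        exact cell_sound (TwoRel.left_whiskerRight φ h c) }

/-- The strict 2-functor `(b, -) : C → B ⊗ₗ C`. -/
def inr [Bicategory.Strict C] (b : B) : StrictPseudofunctor C (GrayTensor B C) :=
  StrictPseudofunctor.mk''
    { obj := fun c => pt b c
      map := fun g => right b g
      map₂ := fun ψ => cell (.right b ψ)
      map₂_id := fun g => cell_sound (TwoRel.right_id b g)
      map₂_comp := fun ψ ψ' => cell_sound (TwoRel.right_vcomp b ψ ψ')
      map_id := fun c => right_id b c
      map_comp := fun f g => right_comp b f g
      map₂_whisker_left := fun f _ _ ψ => by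
        simp only [← cell_eq]
        exact cell_sound (TwoRel.right_whiskerLeft b f ψ)
      map₂_whisker_right := fun ψ h => by
        simp only [← cell_eq]
        exact cell_sound (TwoRel.right_whiskerRight b ψ h) }

/-- The 2-cell `γ_{f, g} : (f, Id) · (Id, g) → (Id, g) · (f, Id)`. -/
def swap {b b' : B} {c c' : C} (f : b ⟶ b') (g : c ⟶ c') :
    right b g ≫ left f c' ⟶ left f c ≫ right b' g :=
  cell (.swap f g)

end GrayTensor

/-! ## The delooping of the augmented simplex category -/

/-- The one-object 2-category `𝔹Δ₊` whose 1-cells are finite ordinals, composed by ordinal sum,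
and whose 2-cells are monotone maps. -/
abbrev BDelta : Type := MonoidalSingleObj AugmentedSimplexCategory

namespace BDelta

theorem unit_tensor (x : AugmentedSimplexCategory) :
    AugmentedSimplexCategory.tensorObj .star x = x := by
  cases x <;> rfl

theorem tensor_unit (x : AugmentedSimplexCategory) :
    AugmentedSimplexCategory.tensorObj x .star = x := by
  cases x <;> rfl

theorem tensor_assoc (x y z : AugmentedSimplexCategory) :
    AugmentedSimplexCategory.tensorObj (AugmentedSimplexCategory.tensorObj x y) z =
      AugmentedSimplexCategory.tensorObj x (AugmentedSimplexCategory.tensorObj y z) := by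
  cases x <;> cases y <;> cases z <;> try rfl
  exact congrArg (fun j => WithInitial.of (SimplexCategory.mk j)) (by simp +arith)

theorem leftUnitor_eq (x : AugmentedSimplexCategory) :
    AugmentedSimplexCategory.leftUnitor x = eqToIso (unit_tensor x) := by
  cases x <;> rfl

theorem rightUnitor_eq (x : AugmentedSimplexCategory) :
    AugmentedSimplexCategory.rightUnitor x = eqToIso (tensor_unit x) := by
  cases x <;> rfl

theorem associator_eq (x y z : AugmentedSimplexCategory) :
    AugmentedSimplexCategory.associator x y z = eqToIso (tensor_assoc x y z) := by
  cases x <;> cases y <;> cases z <;> rfl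

instance strict : Bicategory.Strict BDelta where
  id_comp := unit_tensor
  comp_id := tensor_unit
  assoc := tensor_assoc
  leftUnitor_eqToIso := leftUnitor_eq
  rightUnitor_eqToIso := rightUnitor_eq
  associator_eqToIso := associator_eq

/-- The unique 0-cell. -/
def pt : BDelta := MonoidalSingleObj.star _

/-- The one-element ordinal `[0]`. -/
def t : pt ⟶ pt := (WithInitial.of (SimplexCategory.mk 0) : AugmentedSimplexCategory)

/-- The unique map from the empty ordinal to the one-element ordinal. -/
def unit : 𝟙 pt ⟶ t :=
  WithInitial.starInitial.to (WithInitial.of (SimplexCategory.mk 0) : AugmentedSimplexCategory)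

/-- The unique map from the two-element ordinal `[0] ⊕ [0] = [1]` to the one-element ordinal. -/
def mult : t ≫ t ⟶ t :=
  AugmentedSimplexCategory.inclusion.map
    (SimplexCategory.σ 0 : SimplexCategory.mk 1 ⟶ SimplexCategory.mk 0)

end BDelta

/-! ## Monads, distributive laws and the Yang–Baxter equation -/

section Monads

variable {B : Type u} [Bicategory.{w, v} B]

/-- A 1-cell `t : a → a` with 2-cells `η : Id → t` and `μ : t · t → t`. -/
structure MonadData (a : B) where
  t : a ⟶ a
  η : 𝟙 a ⟶ t
  μ : t ≫ t ⟶ t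

/-- The unit laws and the associative law. -/
structure MonadData.IsMonad {a : B} (M : MonadData a) : Prop where
  left_unit : M.t ◁ M.η ≫ M.μ = (ρ_ M.t).hom
  right_unit : M.η ▷ M.t ≫ M.μ = (λ_ M.t).hom
  assoc : M.μ ▷ M.t ≫ M.μ = (α_ M.t M.t M.t).hom ≫ M.t ◁ M.μ ≫ M.μ

/-- `σ : s · t → t · s` is a distributive law between the monads `S = (s, η, μ)` and
`T = (t, η, μ)` in the sense of Beck: it is compatible with both units and both
multiplications. -/
structure IsDistributiveLaw {a : B} (S T : MonadData a) (σ : T.t ≫ S.t ⟶ S.t ≫ T.t) :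
    Prop where
  unit_left : T.t ◁ S.η ≫ σ = (ρ_ T.t).hom ≫ (λ_ T.t).inv ≫ S.η ▷ T.t
  unit_right : T.η ▷ S.t ≫ σ = (λ_ S.t).hom ≫ (ρ_ S.t).inv ≫ S.t ◁ T.η
  mul_left : T.t ◁ S.μ ≫ σ =
    (α_ T.t S.t S.t).inv ≫ σ ▷ S.t ≫ (α_ S.t T.t S.t).hom ≫ S.t ◁ σ ≫
      (α_ S.t S.t T.t).inv ≫ S.μ ▷ T.t
  mul_right : T.μ ▷ S.t ≫ σ =
    (α_ T.t T.t S.t).hom ≫ T.t ◁ σ ≫ (α_ T.t S.t T.t).inv ≫ σ ▷ T.t ≫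
      (α_ S.t T.t T.t).hom ≫ S.t ◁ T.μ

/-- The Yang–Baxter equation
`(h · σ_{f,g}) ∘ (σ_{f,h} · g) ∘ (f · σ_{g,h}) = (σ_{g,h} · f) ∘ (g · σ_{f,h}) ∘ (σ_{f,g} · h)`
for 2-cells `σ_{f,g} : f · g → g · f`, `σ_{f,h} : f · h → h · f`, `σ_{g,h} : g · h → h · g`. -/
def YangBaxter {a : B} {f g h : a ⟶ a} (σfg : g ≫ f ⟶ f ≫ g) (σfh : h ≫ f ⟶ f ≫ h)
    (σgh : h ≫ g ⟶ g ≫ h) : Prop :=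
  σgh ▷ f ≫ (α_ g h f).hom ≫ g ◁ σfh ≫ (α_ g f h).inv ≫ σfg ▷ h ≫ (α_ f g h).hom =
    (α_ h g f).hom ≫ h ◁ σfg ≫ (α_ h f g).inv ≫ σfh ▷ g ≫ (α_ f h g).hom ≫ f ◁ σgh

end Monads

/-- The data underlying an `n`-fold distributive law: a 0-cell `a`, 1-cells `t_i` with 2-cells
`η_i`, `μ_i`, and 2-cells `σ_{i,j} : t_i · t_j → t_j · t_i` for `i < j`. -/
structure LawData (B : Type u) [Bicategory.{w, v} B] (n : ℕ) where
  a : B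
  T : Fin n → MonadData a
  σ : ∀ i j : Fin n, i < j → ((T j).t ≫ (T i).t ⟶ (T i).t ≫ (T j).t)

/-- The axioms of an `n`-fold (iterated) distributive law. -/
structure LawData.IsIteratedDistributiveLaw {B : Type u} [Bicategory.{w, v} B] {n : ℕ}
    (L : LawData B n) : Prop where
  monad : ∀ i, (L.T i).IsMonad
  distributive : ∀ (i j : Fin n) (h : i < j), IsDistributiveLaw (L.T i) (L.T j) (L.σ i j h)
  yangBaxter : ∀ (i j k : Fin n) (hij : i < j) (hjk : j < k),
    YangBaxter (L.σ i j hij) (L.σ i k (hij.trans hjk)) (L.σ j k hjk)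

/-! ## Images of such data under strict 2-functors -/

section Images

variable {B : Type u₁} [Bicategory.{w₁, v₁} B] {C : Type u₂} [Bicategory.{w₂, v₂} C]

/-- The image of `(t, η, μ)`; the 2-cells `F.mapId` and `F.mapComp` are identities. -/
def MonadData.map (F : StrictPseudofunctor B C) {a : B} (M : MonadData a) :
    MonadData (F.obj a) where
  t := F.map M.t
  η := (F.mapId a).inv ≫ F.map₂ M.η
  μ := (F.mapComp M.t M.t).inv ≫ F.map₂ M.μ

/-- The image of a 2-cell `σ : f ≫ g ⟶ g ≫ f`; the 2-cells `F.mapComp` are identities. -/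
def swapMap (F : StrictPseudofunctor B C) {a : B} {f g : a ⟶ a} (σ : f ≫ g ⟶ g ≫ f) :
    F.map f ≫ F.map g ⟶ F.map g ≫ F.map f :=
  (F.mapComp f g).inv ≫ F.map₂ σ ≫ (F.mapComp g f).hom

end Images

/-! ## Iterated tensor products with `𝔹Δ₊` and their generating cells -/

/-- A (small) strict 2-category. -/
structure StrictTwoCat where
  carrier : Type
  [bicategory : Bicategory.{0, 0} carrier]
  [strict : Bicategory.Strict carrier]

attribute [instance] StrictTwoCat.bicategory StrictTwoCat.strict

namespace StrictTwoCat

/-- The terminal 2-category `𝟙`. -/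
def one : StrictTwoCat where
  carrier := LocallyDiscrete (Discrete PUnit)

/-- The 2-category `𝔹Δ₊`. -/
def bDelta : StrictTwoCat where
  carrier := BDelta

/-- The operation `mnd(X) = X ⊗ₗ 𝔹Δ₊`. -/
def mnd (X : StrictTwoCat) : StrictTwoCat where
  carrier := GrayTensor X.carrier BDelta

/-- The iterates `mndⁿ(X)`. -/
def mndIter (X : StrictTwoCat) : ℕ → StrictTwoCat
  | 0 => X
  | n + 1 => mnd (mndIter X n)

/-- The left-bracketed tensor powers `(𝔹Δ₊)^{⊗ₗ n}`; the empty one is the tensor unit `𝟙`. -/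
def bDeltaPow : ℕ → StrictTwoCat
  | 0 => one
  | 1 => bDelta
  | n + 2 => mnd (bDeltaPow (n + 1))

end StrictTwoCat

/-- A 0-cell with 1-cells and 2-cells as in `LawData`, with the 1-cells numbered in the
opposite order: the 1-cell belonging to the last tensor factor is number `0`. -/
structure RevLawData (X : StrictTwoCat) (n : ℕ) where
  a : X.carrier
  T : Fin n → MonadData a
  σ : ∀ i j : Fin n, i < j → ((T i).t ≫ (T j).t ⟶ (T j).t ≫ (T i).t)

namespace RevLawData

/-- A 0-cell alone. -/
def nil {X : StrictTwoCat} (a : X.carrier) : RevLawData X 0 where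
  a := a
  T := Fin.elim0
  σ := fun i => i.elim0

/-- The generating cells of `𝔹Δ₊`. -/
def bDelta : RevLawData StrictTwoCat.bDelta 1 where
  a := BDelta.pt
  T := fun _ => { t := BDelta.t, η := BDelta.unit, μ := BDelta.mult }
  σ := fun i j h => absurd h (by rw [Subsingleton.elim i j]; exact lt_irrefl j)

variable {X : StrictTwoCat} {n : ℕ}

/-- The monad data `{[0]}, {η}, {μ}` of the old tensor factors, preceded by those of the new
tensor factor `𝔹Δ₊`. -/
def consT (U : RevLawData X n) :
    Fin (n + 1) → MonadData (GrayTensor.pt U.a BDelta.pt : GrayTensor X.carrier BDelta) :=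
  Fin.cases
    (MonadData.map (GrayTensor.inr U.a) { t := BDelta.t, η := BDelta.unit, μ := BDelta.mult })
    (fun i => MonadData.map (GrayTensor.inl BDelta.pt) (U.T i))

/-- The 2-cells `γ^{i,j}_{[0],[0]}`: those of the old tensor factors, and the interchange cells
`γ_{f,[0]}` between an old 1-cell `f` and the 1-cell `[0]` of the new tensor factor. -/
def consσ (U : RevLawData X n) : ∀ i j : Fin (n + 1), i < j →
    ((U.consT i).t ≫ (U.consT j).t ⟶ (U.consT j).t ≫ (U.consT i).t) :=
  Fin.cases
    (Fin.cases (fun h => absurd h (lt_irrefl 0))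
      (fun j _ => GrayTensor.swap (U.T j).t BDelta.t))
    (fun i => Fin.cases (fun h => absurd h (Fin.not_lt_zero _))
      (fun j h => swapMap (GrayTensor.inl BDelta.pt) (U.σ i j (Fin.succ_lt_succ_iff.mp h))))

/-- The generating cells of `X ⊗ₗ 𝔹Δ₊` obtained from those of `X`. -/
def cons (U : RevLawData X n) : RevLawData X.mnd (n + 1) where
  a := (GrayTensor.pt U.a BDelta.pt : GrayTensor X.carrier BDelta)
  T := U.consT
  σ := U.consσ

/-- The generating cells of `mndⁿ(𝟙)`: the 1-cells `{[0]}_i`, the 2-cells `{η}_i`, `{μ}_i` and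
the interchange cells `γ^{i,j}_{[0],[0]}`. -/
def mndIter : ∀ n : ℕ, RevLawData (StrictTwoCat.one.mndIter n) n
  | 0 => nil (X := StrictTwoCat.one) ⟨⟨PUnit.unit⟩⟩
  | n + 1 => cons (mndIter n)

/-- The generating cells of `(𝔹Δ₊)^{⊗ₗ n}`. -/
def bDeltaPow : ∀ n : ℕ, RevLawData (StrictTwoCat.bDeltaPow n) n
  | 0 => nil (X := StrictTwoCat.one) ⟨⟨PUnit.unit⟩⟩
  | 1 => bDelta
  | n + 2 => cons (bDeltaPow (n + 1))

/-- The images of the given cells under a strict 2-functor `D`, numbered so that the `i`-th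
monad comes from the `i`-th tensor factor, counted from the left. -/
def image {B : Type u} [Bicategory.{w, v} B] (U : RevLawData X n)
    (D : StrictPseudofunctor X.carrier B) : LawData B n where
  a := D.obj U.a
  T := fun i => (U.T i.rev).map D
  σ := fun i j h => swapMap D (U.σ j.rev i.rev (Fin.rev_lt_rev.mpr h))

end RevLawData

/-! Everything rests on one bijection: strict 2-functors `X ⊗ₗ 𝔹Δ₊ → B` are the same as strict
2-functors `X → Mnd B`, where `Mnd B` is the 2-category of monads in `B`, lax monad morphisms and
their 2-cells (`GrayTensor.toMnd` and `GrayTensor.ofMnd`, mutually inverse by `toMnd_ofMnd` and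
`ofMnd_toMnd`). Fixing a 0-cell of `X` leaves a 2-functor on `𝔹Δ₊`, which is a monad because `𝔹Δ₊`
is the free strict 2-category on a monad. The cell `γ_{f,[0]}` becomes the structure cell of a monad
morphism: its naturality at `η` and `μ`, with the formulas for `γ_{f,Id}` and `γ_{f,g'·g}`, is
exactly the unit and multiplication law. Naturality in `φ` is the condition on 2-cells of `Mnd B`.
Conversely `γ_{f,[0]}` forces every `γ_{f,[k]}` (`Mnd.powSwap`).

The theorem follows by induction on the number of factors, for all target 2-categories at once: a
2-functor from `n + 1` factors to `B` is a 2-functor from `n` factors to `Mnd B`, hence an `n`-fold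
law in `Mnd B`. Such a law lives on a monad `t₀` of `B`. A further monad in `Mnd B` on it is a monad
`s` in `B` with a Beck law relating it to `t₀`: two of Beck's axioms say that `s` underlies a monad
morphism, the other two that its unit and multiplication are 2-cells of `Mnd B`. A 2-cell
interchanging two such monads lies in `Mnd B` exactly when Yang–Baxter holds with `t₀`
(`Mnd.yangBaxter_iff`). So `RevLaw.push` and `RevLaw.pull` identify `n`-fold laws in `Mnd B` with
`(n + 1)`-fold laws in `B`. As the monad of the last tensor factor is split off, the induction
numbers monads from the right.

Freeness of `𝔹Δ₊` comes from a normal form: a monotone map is a unique `OrdPath`, each `skip` being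
read as a unit and each `hit` as a multiplication (`MonadData.powMap`). Composing normal forms uses
precisely the monad laws. -/

/-! ### Normal forms of monotone maps -/

/-- Monotone maps between the ordinals with `m` and `k` elements, generated from the empty map:
`skip` adds a new last element to the codomain, `hit` adds a new last element to the domain and
maps it to the last element of the codomain. -/
inductive OrdPath : ℕ → ℕ → Type
  | nil : OrdPath 0 0
  | skip {m k : ℕ} (p : OrdPath m k) : OrdPath m (k + 1)
  | hit {m k : ℕ} (p : OrdPath m (k + 1)) : OrdPath (m + 1) (k + 1)

namespace OrdPath

/-- The identity map. -/
def id : ∀ n : ℕ, OrdPath n n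
  | 0 => nil
  | n + 1 => hit (skip (id n))

/-- The composite of monotone maps. -/
def comp : ∀ {m k l : ℕ}, OrdPath m k → OrdPath k l → OrdPath m l
  | _, _, _, p, nil => p
  | _, _, _, p, skip q => skip (comp p q)
  -- The top of the middle ordinal is not a value of the first map, so what the second map does
  -- there is lost.
  | _, _, _, skip p, hit q => comp p q
  | _, _, _, hit p, hit q => hit (comp p (hit q))

/-- The ordinal sum of monotone maps. -/
def sum {m k : ℕ} (p : OrdPath m k) : ∀ {m' k' : ℕ}, OrdPath m' k' → OrdPath (m + m') (k + k')
  | _, _, nil => p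
  | _, _, skip q => skip (sum p q)
  | _, _, hit q => hit (sum p q)

theorem sum_skip {m k m' k' : ℕ} (p : OrdPath m k) (q : OrdPath m' k') :
    p.sum (skip q) = skip (p.sum q) :=
  rfl

theorem sum_hit {m k m' k' : ℕ} (p : OrdPath m k) (q : OrdPath m' (k' + 1)) :
    p.sum (hit q) = hit (k := k + k') (p.sum q) :=
  rfl

/-- The values of a monotone map; meaningful on elements of the domain only. -/
def ev : ∀ {m k : ℕ}, OrdPath m k → ℕ → ℕ
  | _, _, nil, _ => 0
  | _, _, skip p, i => ev p i
  | _, _, hit (m := m) (k := k) p, i => if i = m then k else ev p i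

theorem ev_lt {m k : ℕ} (p : OrdPath m k) : ∀ i < m, p.ev i < k := by
  induction p with
  | nil => intro i hi; omega
  | skip p ih => intro i hi; exact (ih i hi).trans (Nat.lt_succ_self _)
  | @hit m k p ih =>
    intro i hi
    rw [ev]
    split_ifs with h
    · exact Nat.lt_succ_self _
    · exact ih i (by omega)

/-- The outermost constructor can be read off from the values: `hit` sends the last element to the
top of the codomain, and a path of the form `skip` never reaches the top. So normal forms are
unique. -/
theorem ext {m k : ℕ} {p q : OrdPath m k} (h : ∀ i < m, p.ev i = q.ev i) : p = q := by
  induction p with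
  | nil => cases q; rfl
  | @skip m k p ih =>
    cases q with
    | skip q => exact congrArg skip (ih h)
    | @hit m' _ q =>
      have h₁ := h m' (Nat.lt_succ_self _)
      have h₂ := p.ev_lt m' (Nat.lt_succ_self _)
      simp only [ev, if_true] at h₁
      omega
  | @hit m k p ih =>
    cases q with
    | skip q =>
      have h₁ := h m (Nat.lt_succ_self _)
      have h₂ := q.ev_lt m (Nat.lt_succ_self _)
      simp only [ev, if_true] at h₁
      omega
    | hit q =>
      refine congrArg hit (ih fun i hi => ?_)
      have h₁ := h i (by omega)
      simpa only [ev, if_neg hi.ne] using h₁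

/-- Existence of normal forms: if the last element of the domain goes to the top of the codomain,
remove it from the domain (`hit`); otherwise remove the top of the codomain (`skip`). -/
theorem exists_ev_eq (k : ℕ) : ∀ (m : ℕ) (φ : ℕ → ℕ) (_ : ∀ i < m, φ i < k)
    (_ : ∀ i j, i ≤ j → j < m → φ i ≤ φ j), ∃ p : OrdPath m k, ∀ i < m, p.ev i = φ i := by
  induction k with
  | zero =>
    intro m φ h _
    cases m with
    | zero => exact ⟨nil, fun i hi => by omega⟩
    | succ m => exact absurd (h 0 (by omega)) (by omega)
  | succ k ihk =>
    intro m
    induction m with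
    | zero =>
      intro φ _ _
      obtain ⟨p, -⟩ := ihk 0 φ (fun i hi => by omega) (fun i j _ hj => by omega)
      exact ⟨skip p, fun i hi => by omega⟩
    | succ m ihm =>
      intro φ h mono
      by_cases hm : φ m = k
      · obtain ⟨p, hp⟩ := ihm φ (fun i hi => h i (by omega))
          (fun i j hij hj => mono i j hij (by omega))
        refine ⟨hit p, fun i hi => ?_⟩
        rw [ev]
        split_ifs with hi'
        · rw [hi', hm]
        · exact hp i (by omega)
      -- If the largest argument misses the top, monotonicity makes all arguments miss it.
      · obtain ⟨p, hp⟩ := ihk (m + 1) φ (fun i hi => by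
          have h₁ := h m (by omega)
          have h₂ := mono i m (by omega) (by omega)
          omega) mono
        exact ⟨skip p, hp⟩

theorem ev_id (n : ℕ) : ∀ i < n, (id n).ev i = i := by
  induction n with
  | zero => intro i hi; omega
  | succ n ih =>
    intro i hi
    simp only [id, ev]
    split_ifs with h
    · exact h.symm
    · exact ih i (by omega)

theorem ev_comp {m k l : ℕ} (p : OrdPath m k) (q : OrdPath k l) :
    ∀ i < m, (comp p q).ev i = q.ev (p.ev i) := by
  fun_induction comp p q with
  | case1 m p =>
    intro i hi
    exact absurd (p.ev_lt i hi) (by omega)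
  | case2 m k p l q ih => exact ih
  | case3 m k l q p ih =>
    intro i hi
    rw [ih i hi, ev, ev, if_neg (p.ev_lt i hi).ne]
  | case4 m k p l q ih =>
    intro i hi
    by_cases h : i = m
    · simp [ev, h]
    · have := ih i (Nat.lt_of_le_of_ne (Nat.le_of_lt_succ hi) h)
      simpa only [ev, if_neg h] using this

theorem ev_sum {m k m' k' : ℕ} (p : OrdPath m k) (q : OrdPath m' k') :
    ∀ i < m + m', (sum p q).ev i = if i < m then p.ev i else k + q.ev (i - m) := by
  induction q with
  | nil => intro i hi; exact (if_pos hi).symm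
  | skip q ih => exact ih
  | @hit m' k' q ih =>
    intro i hi
    change (if i = m + m' then k + k' else (sum p q).ev i) =
      if i < m then p.ev i else k + if i - m = m' then k' else q.ev (i - m)
    by_cases h : i = m + m'
    · simp [h]
    · have h' : i - m ≠ m' ∨ i < m := by omega
      rw [if_neg h, ih i (by omega)]
      split_ifs with h₁ h₂
      · rfl
      · omega
      · rfl

end OrdPath

/-! ### Powers of a monad and the action of monotone maps on them -/

namespace MonadData

variable {B : Type u} [Bicategory.{w, v} B] {a b c : B}

/-- The powers of the 1-cell underlying a monad. -/
@[reducible]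
def pow (M : MonadData a) : ℕ → (a ⟶ a)
  | 0 => 𝟙 a
  | n + 1 => pow M n ≫ M.t

/-- The 2-cell between powers induced by a monotone map. -/
def powMap (M : MonadData a) : ∀ {m k : ℕ}, OrdPath m k → (M.pow m ⟶ M.pow k)
  | _, _, .nil => 𝟙 _
  | _, _, .skip (k := k) p => powMap M p ≫ (ρ_ (M.pow k)).inv ≫ M.pow k ◁ M.η
  | _, _, .hit (k := k) p =>
    powMap M p ▷ M.t ≫ (α_ (M.pow k) M.t M.t).hom ≫ M.pow k ◁ M.μ

/-- This is `right_unit` behind an arbitrary 1-cell. It removes a `skip` followed by a `hit`, the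
pattern from which `OrdPath.id` is built. -/
theorem unit_whiskerRight_mul {M : MonadData a} (hM : M.IsMonad) (f : b ⟶ a) :
    ((ρ_ f).inv ≫ f ◁ M.η) ▷ M.t ≫ (α_ f M.t M.t).hom ≫ f ◁ M.μ = 𝟙 _ := by
  have h : (α_ f (𝟙 a) M.t).hom ≫ f ◁ (M.η ▷ M.t ≫ M.μ) = (ρ_ f).hom ▷ M.t := by
    rw [hM.right_unit, triangle]
  simp only [comp_whiskerRight, Category.assoc, whisker_assoc, whiskerLeft_comp,
    Iso.inv_hom_id_assoc] at h ⊢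
  rw [h, ← comp_whiskerRight, Iso.inv_hom_id, id_whiskerRight]

theorem powMap_id {M : MonadData a} (hM : M.IsMonad) (n : ℕ) :
    M.powMap (OrdPath.id n) = 𝟙 _ := by
  induction n with
  | zero => rfl
  | succ n ih =>
    simp only [OrdPath.id, powMap, ih, Category.id_comp]
    exact unit_whiskerRight_mul hM _

/-- Associativity of `μ`, in the form needed for composing a `hit` with a `hit`. -/
theorem powMap_hit_comp {M : MonadData a} (hM : M.IsMonad) {f g : b ⟶ a}
    (φ : f ⟶ g ≫ M.t) :
    ((α_ f M.t M.t).hom ≫ f ◁ M.μ) ≫ φ ▷ M.t ≫ (α_ g M.t M.t).hom ≫ g ◁ M.μ =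
      (φ ▷ M.t ≫ (α_ g M.t M.t).hom ≫ g ◁ M.μ) ▷ M.t ≫ (α_ g M.t M.t).hom ≫ g ◁ M.μ := by
  have h := congrArg (fun x => g ◁ x) hM.assoc
  simp only [whiskerLeft_comp] at h
  simp only [comp_whiskerRight, Category.assoc, whisker_exchange_assoc,
    whisker_assoc, Iso.inv_hom_id_assoc, h]
  simp

/-- The law `left_unit`, in the form needed for composing a `skip` with a `hit`. -/
theorem unit_comp_hit {M : MonadData a} (hM : M.IsMonad) {f g : b ⟶ a} (φ : f ⟶ g ≫ M.t) :
    ((ρ_ f).inv ≫ f ◁ M.η) ≫ φ ▷ M.t ≫ (α_ g M.t M.t).hom ≫ g ◁ M.μ = φ := by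
  have h := congrArg (fun x => g ◁ x) hM.left_unit
  simp only [whiskerLeft_comp] at h
  simp only [Category.assoc, whisker_exchange_assoc, comp_whiskerLeft, Iso.inv_hom_id_assoc, h]
  simp

/-- The clauses of `OrdPath.comp` match the monad laws: `skip` against `hit` cancels by a unit law,
`hit` against `hit` is associativity, and the other two clauses are formal. -/
theorem powMap_comp {M : MonadData a} (hM : M.IsMonad) {m k l : ℕ} (p : OrdPath m k)
    (q : OrdPath k l) : M.powMap (p.comp q) = M.powMap p ≫ M.powMap q := by
  fun_induction OrdPath.comp p q with
  | case1 m p => exact (Category.comp_id _).symm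
  | case2 m k p l q ih => simp only [powMap, ih, Category.assoc]
  | case3 m k l q p ih =>
    rw [ih]
    simp only [powMap, Category.assoc]
    have := unit_comp_hit hM (M.powMap q)
    rw [Category.assoc] at this
    erw [this]
  | case4 m k p l q ih =>
    have := powMap_hit_comp hM (M.powMap q)
    simp only [powMap, ih, Category.assoc, comp_whiskerRight] at this ⊢
    erw [this]

/-- Powers are compatible with sums of exponents. -/
def powAdd (M : MonadData a) (m : ℕ) : ∀ n : ℕ, M.pow (m + n) ≅ M.pow m ≫ M.pow n
  | 0 => (ρ_ _).symm
  | n + 1 => whiskerRightIso (powAdd M m n) M.t ≪≫ α_ _ _ _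

theorem pow_add [Bicategory.Strict B] (M : MonadData a) (m n : ℕ) :
    M.pow (m + n) = M.pow m ≫ M.pow n := by
  induction n with
  | zero => exact (Bicategory.Strict.comp_id _).symm
  | succ n ih =>
    change M.pow (m + n) ≫ M.t = _
    rw [ih, Bicategory.Strict.assoc]

theorem powAdd_hom [Bicategory.Strict B] (M : MonadData a) (m n : ℕ) :
    (M.powAdd m n).hom = eqToHom (M.pow_add m n) := by
  induction n with
  | zero => simp [powAdd, Bicategory.Strict.rightUnitor_eqToIso]
  | succ n ih =>
    simp only [powAdd, Iso.trans_hom, whiskerRightIso_hom, ih, eqToHom_whiskerRight,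
      Bicategory.Strict.associator_eqToIso, eqToIso.hom, eqToHom_trans]

/-- Paths are built at their last element, so a summand on the left stays out of the recursion; only
interchange and, at the empty path, `powMap_id` are needed. -/
theorem powMap_id_sum (M : MonadData a) (hM : M.IsMonad) (n : ℕ) {m k : ℕ} (p : OrdPath m k) :
    M.powMap ((OrdPath.id n).sum p) ≫ (M.powAdd n k).hom =
      (M.powAdd n m).hom ≫ M.pow n ◁ M.powMap p := by
  induction p with
  | nil =>
    simp only [OrdPath.sum, powMap, whiskerLeft_id, Category.comp_id]
    erw [powMap_id hM, Category.id_comp]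
  | @skip m k p ih =>
    simp only [OrdPath.sum_skip, powMap, whiskerLeft_comp, ← reassoc_of% ih]
    simp only [powAdd, Iso.trans_hom, whiskerRightIso_hom, Category.assoc,
      whisker_exchange_assoc]
    simp
  | @hit m k p ih =>
    have ih' := congrArg (fun x => x ▷ M.t) ih
    simp only [comp_whiskerRight, powAdd, Iso.trans_hom, whiskerRightIso_hom] at ih'
    simp only [OrdPath.sum_hit, powMap, whiskerLeft_comp, powAdd, Iso.trans_hom,
      whiskerRightIso_hom, Category.assoc, whisker_exchange_assoc]
    rw [← associator_naturality_middle_assoc, ← reassoc_of% ih']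
    simp

/-- Each new element of the identity on the right adds a `skip` and a `hit`, which cancel by
`unit_whiskerRight_mul`. -/
theorem powMap_sum_id (M : MonadData a) (hM : M.IsMonad) (n : ℕ) {m k : ℕ} (p : OrdPath m k) :
    M.powMap (p.sum (OrdPath.id n)) ≫ (M.powAdd k n).hom =
      (M.powAdd m n).hom ≫ M.powMap p ▷ M.pow n := by
  induction n with
  | zero =>
    simp [OrdPath.sum, OrdPath.id, powAdd, pow]
  | succ n ih =>
    have ih' := congrArg (fun x => x ▷ M.t) ih
    simp only [comp_whiskerRight] at ih'
    have h := unit_whiskerRight_mul hM (M.pow (k + n))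
    simp only [OrdPath.id, OrdPath.sum, powMap, powAdd, Iso.trans_hom, whiskerRightIso_hom,
      Category.assoc, comp_whiskerRight, pow] at ih' h ⊢
    erw [reassoc_of% h, reassoc_of% ih']
    simp

end MonadData

/-! ### The 2-category of monads and lax morphisms -/

/-- A monad in a 2-category. -/
structure Mnd (B : Type u) [Bicategory.{w, v} B] where
  a : B
  M : MonadData a
  isMonad : M.IsMonad

namespace Mnd

variable {B : Type u} [Bicategory.{w, v} B]

/-- A lax morphism of monads: a 1-cell `f` with a 2-cell `t · f → f · t'` that is compatible with
units and multiplications. -/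
structure Hom (S T : Mnd B) where
  f : S.a ⟶ T.a
  σ : S.M.t ≫ f ⟶ f ≫ T.M.t
  unit : S.M.η ▷ f ≫ σ = (λ_ f).hom ≫ (ρ_ f).inv ≫ f ◁ T.M.η
  mul : S.M.μ ▷ f ≫ σ = (α_ S.M.t S.M.t f).hom ≫ S.M.t ◁ σ ≫ (α_ S.M.t f T.M.t).inv ≫
    σ ▷ T.M.t ≫ (α_ f T.M.t T.M.t).hom ≫ f ◁ T.M.μ

/-- A 2-cell between morphisms of monads. -/
@[ext]
structure Hom₂ {S T : Mnd B} (F G : Hom S T) where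
  val : F.f ⟶ G.f
  comm : F.σ ≫ val ▷ T.M.t = S.M.t ◁ val ≫ G.σ

/-- The identity morphism. -/
def idHom (S : Mnd B) : Hom S S where
  f := 𝟙 S.a
  σ := (ρ_ S.M.t).hom ≫ (λ_ S.M.t).inv
  unit := by simp
  mul := by simp

/-- The composite of morphisms of monads. -/
def compHom {S T U : Mnd B} (F : Hom S T) (G : Hom T U) : Hom S U where
  f := F.f ≫ G.f
  σ := (α_ S.M.t F.f G.f).inv ≫ F.σ ▷ G.f ≫ (α_ F.f T.M.t G.f).hom ≫ F.f ◁ G.σ ≫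
    (α_ F.f G.f U.M.t).inv
  unit := by
    have h₁ := congrArg (fun x => x ▷ G.f) F.unit
    have h₂ := congrArg (fun x => F.f ◁ x) G.unit
    simp only [comp_whiskerRight, whiskerLeft_comp] at h₁ h₂
    rw [whiskerRight_comp]
    simp only [Category.assoc, Iso.hom_inv_id_assoc]
    rw [reassoc_of% h₁]
    simp only [whisker_assoc, Category.assoc, Iso.inv_hom_id_assoc]
    rw [reassoc_of% h₂]
    simp
  mul := by
    have h₁ := congrArg (fun x => x ▷ G.f) F.mul
    have h₂ := congrArg (fun x => F.f ◁ x) G.mul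
    simp only [comp_whiskerRight, whiskerLeft_comp] at h₁ h₂
    rw [whiskerRight_comp]
    simp only [Category.assoc, Iso.hom_inv_id_assoc]
    rw [reassoc_of% h₁]
    simp only [whisker_assoc, Category.assoc, Iso.inv_hom_id_assoc]
    rw [reassoc_of% h₂]
    -- The cells `F.σ` and `G.σ` in the middle act at disjoint places, so the interchange law moves
    -- them past each other.
    calc
      _ = 𝟙 _ ⊗≫ S.M.t ◁ F.σ ▷ G.f ⊗≫ (F.σ ▷ (T.M.t ≫ G.f) ≫ (F.f ≫ T.M.t) ◁ G.σ) ⊗≫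
          F.f ◁ G.σ ▷ U.M.t ⊗≫ F.f ◁ G.f ◁ U.M.μ ⊗≫ 𝟙 _ := by bicategory
      _ = _ := by rw [← whisker_exchange]; bicategory

instance : CategoryStruct (Mnd B) where
  Hom := Hom
  id := idHom
  comp := compHom

instance (S T : Mnd B) : Category (S ⟶ T) where
  Hom F G := Hom₂ F G
  id F := ⟨𝟙 F.f, by simp⟩
  comp φ ψ := ⟨φ.val ≫ ψ.val, by simp [reassoc_of% φ.comm, ψ.comm]⟩
  id_comp _ := Hom₂.ext (Category.id_comp _)
  comp_id _ := Hom₂.ext (Category.comp_id _)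
  assoc _ _ _ := Hom₂.ext (Category.assoc _ _ _)

theorem comp_val {S T : Mnd B} {F G H : S ⟶ T} (φ : F ⟶ G) (ψ : G ⟶ H) :
    Hom₂.val (φ ≫ ψ) = φ.val ≫ ψ.val :=
  rfl

theorem hom₂_ext {S T : Mnd B} {F G : S ⟶ T} {φ ψ : F ⟶ G} (h : φ.val = ψ.val) : φ = ψ :=
  Hom₂.ext h

/-- An invertible 2-cell of `B` that is compatible with monad morphisms. -/
def isoMk {S T : Mnd B} {F G : S ⟶ T} (e : F.f ≅ G.f)
    (h : F.σ ≫ e.hom ▷ T.M.t = S.M.t ◁ e.hom ≫ G.σ) : F ≅ G where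
  hom := ⟨e.hom, h⟩
  inv := ⟨e.inv, by
    rw [← cancel_epi (S.M.t ◁ e.hom), ← reassoc_of% h]
    simp⟩
  hom_inv_id := Hom₂.ext e.hom_inv_id
  inv_hom_id := Hom₂.ext e.inv_hom_id

/-- Left whiskering. -/
def whiskerLeftHom {S T U : Mnd B} (F : Hom S T) {G H : Hom T U} (φ : Hom₂ G H) :
    Hom₂ (compHom F G) (compHom F H) where
  val := F.f ◁ φ.val
  comm := by
    have h := congrArg (fun x => F.f ◁ x) φ.comm
    simp only [whiskerLeft_comp] at h
    dsimp only [compHom]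
    calc
      _ = (α_ _ _ _).inv ≫ F.σ ▷ G.f ≫ (α_ _ _ _).hom ≫ (F.f ◁ G.σ ≫ F.f ◁ φ.val ▷ U.M.t) ≫
          (α_ _ _ _).inv := by bicategory
      _ = (α_ _ _ _).inv ≫ (F.σ ▷ G.f ≫ (F.f ≫ T.M.t) ◁ φ.val) ≫ (α_ _ _ _).hom ≫
          F.f ◁ H.σ ≫ (α_ _ _ _).inv := by rw [h]; bicategory
      _ = _ := by rw [← whisker_exchange]; bicategory

/-- Right whiskering. -/
def whiskerRightHom {S T U : Mnd B} {F G : Hom S T} (φ : Hom₂ F G) (H : Hom T U) :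
    Hom₂ (compHom F H) (compHom G H) where
  val := φ.val ▷ H.f
  comm := by
    have h := congrArg (fun x => x ▷ H.f) φ.comm
    simp only [comp_whiskerRight] at h
    dsimp only [compHom]
    calc
      _ = (α_ _ _ _).inv ≫ F.σ ▷ H.f ≫ (α_ _ _ _).hom ≫ (F.f ◁ H.σ ≫ φ.val ▷ (H.f ≫ U.M.t)) ≫
          (α_ _ _ _).inv := by bicategory
      _ = (α_ _ _ _).inv ≫ (F.σ ▷ H.f ≫ φ.val ▷ T.M.t ▷ H.f) ≫ (α_ _ _ _).hom ≫
          G.f ◁ H.σ ≫ (α_ _ _ _).inv := by rw [whisker_exchange]; bicategory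
      _ = _ := by rw [h]; bicategory

theorem associator_comm {S T U V : Mnd B} (F : Hom S T) (G : Hom T U) (H : Hom U V) :
    (compHom (compHom F G) H).σ ≫ (α_ F.f G.f H.f).hom ▷ V.M.t =
      S.M.t ◁ (α_ F.f G.f H.f).hom ≫ (compHom F (compHom G H)).σ := by
  dsimp only [compHom]
  bicategory

theorem leftUnitor_comm {S T : Mnd B} (F : Hom S T) :
    (compHom (idHom S) F).σ ≫ (λ_ F.f).hom ▷ T.M.t = S.M.t ◁ (λ_ F.f).hom ≫ F.σ := by
  dsimp only [compHom, idHom]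
  bicategory

theorem rightUnitor_comm {S T : Mnd B} (F : Hom S T) :
    (compHom F (idHom T)).σ ≫ (ρ_ F.f).hom ▷ T.M.t = S.M.t ◁ (ρ_ F.f).hom ≫ F.σ := by
  dsimp only [compHom, idHom]
  bicategory

/-- Monads in `B`, lax morphisms of monads and their 2-cells form a 2-category. -/
instance bicategory : Bicategory (Mnd B) where
  whiskerLeft F _ _ φ := whiskerLeftHom F φ
  whiskerRight φ H := whiskerRightHom φ H
  associator F G H := isoMk (α_ (Hom.f F) (Hom.f G) (Hom.f H)) (associator_comm F G H)
  leftUnitor F := isoMk (λ_ (Hom.f F)) (leftUnitor_comm F)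
  rightUnitor F := isoMk (ρ_ (Hom.f F)) (rightUnitor_comm F)
  whiskerLeft_id _ _ := Hom₂.ext (whiskerLeft_id _ _)
  whiskerLeft_comp _ _ _ _ _ _ := Hom₂.ext (whiskerLeft_comp _ _ _)
  id_whiskerLeft _ := Hom₂.ext (id_whiskerLeft _)
  comp_whiskerLeft _ _ _ _ _ := Hom₂.ext (comp_whiskerLeft _ _ _)
  id_whiskerRight _ _ := Hom₂.ext (id_whiskerRight _ _)
  comp_whiskerRight _ _ _ := Hom₂.ext (comp_whiskerRight _ _ _)
  whiskerRight_id _ := Hom₂.ext (whiskerRight_id _)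
  whiskerRight_comp _ _ _ := Hom₂.ext (whiskerRight_comp _ _ _)
  whisker_assoc _ _ _ _ _ := Hom₂.ext (whisker_assoc _ _ _)
  whisker_exchange _ _ := Hom₂.ext (whisker_exchange _ _)
  pentagon _ _ _ _ := Hom₂.ext (pentagon _ _ _ _)
  triangle _ _ := Hom₂.ext (triangle _ _)

theorem eqToHom_val {S T : Mnd B} {F G : S ⟶ T} (h : F = G) :
    Hom₂.val (eqToHom h) = eqToHom (congrArg Hom.f h) := by
  subst h
  rfl

theorem eqToIso_hom_val {S T : Mnd B} {F G : S ⟶ T} (h : F = G) :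
    Hom₂.val (eqToIso h).hom = (eqToIso (congrArg Hom.f h)).hom := by
  subst h
  rfl

/-- In strict `B` the unitors and associators are of the form `eqToHom`, so their compatibility with
the structure cells becomes an equality of monad morphisms. This is how `Mnd B` inherits strictness.
-/
theorem Hom.ext_of_comm {S T : Mnd B} {F G : Hom S T} (h : F.f = G.f)
    (hσ : F.σ ≫ eqToHom h ▷ T.M.t = S.M.t ◁ eqToHom h ≫ G.σ) : F = G := by
  obtain ⟨f, σ, _, _⟩ := F
  obtain ⟨g, τ, _, _⟩ := G
  dsimp only at h
  subst h
  simp only [eqToHom_refl, id_whiskerRight, whiskerLeft_id, Category.id_comp,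
    Category.comp_id] at hσ
  subst hσ
  rfl

theorem iso_ext {S T : Mnd B} {F G : S ⟶ T} {φ ψ : F ≅ G}
    (h : Hom₂.val φ.hom = Hom₂.val ψ.hom) : φ = ψ :=
  Iso.ext (hom₂_ext h)

instance strict [Bicategory.Strict B] : Bicategory.Strict (Mnd B) where
  id_comp F := Hom.ext_of_comm (Bicategory.Strict.id_comp (Hom.f F)) (by
    have := leftUnitor_comm F
    rwa [Bicategory.Strict.leftUnitor_eqToIso] at this)
  comp_id F := Hom.ext_of_comm (Bicategory.Strict.comp_id (Hom.f F)) (by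
    have := rightUnitor_comm F
    rwa [Bicategory.Strict.rightUnitor_eqToIso] at this)
  assoc F G H := Hom.ext_of_comm (Bicategory.Strict.assoc (Hom.f F) (Hom.f G) (Hom.f H)) (by
    have := associator_comm F G H
    rwa [Bicategory.Strict.associator_eqToIso] at this)
  leftUnitor_eqToIso F := iso_ext ((congrArg Iso.hom
    (Bicategory.Strict.leftUnitor_eqToIso (Hom.f F))).trans
      (eqToIso_hom_val (F := 𝟙 _ ≫ F) (G := F) _).symm)
  rightUnitor_eqToIso F := iso_ext ((congrArg Iso.hom
    (Bicategory.Strict.rightUnitor_eqToIso (Hom.f F))).trans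
      (eqToIso_hom_val (F := F ≫ 𝟙 _) (G := F) _).symm)
  associator_eqToIso F G H := iso_ext ((congrArg Iso.hom
    (Bicategory.Strict.associator_eqToIso (Hom.f F) (Hom.f G) (Hom.f H))).trans
      (eqToIso_hom_val (F := (F ≫ G) ≫ H) (G := F ≫ G ≫ H) _).symm)

end Mnd

/-! ### Moving a monad morphism past powers of the monads -/

namespace Mnd

variable {B : Type u} [Bicategory.{w, v} B] {S T U : Mnd B}

/-- The 2-cell `tⁿ · f → f · t'ⁿ` of a morphism of monads. -/
def powSwap (F : Hom S T) : ∀ n : ℕ, S.M.pow n ≫ F.f ⟶ F.f ≫ T.M.pow n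
  | 0 => (λ_ F.f).hom ≫ (ρ_ F.f).inv
  | n + 1 => (α_ (S.M.pow n) S.M.t F.f).hom ≫ S.M.pow n ◁ F.σ ≫ (α_ (S.M.pow n) F.f T.M.t).inv ≫
      powSwap F n ▷ T.M.t ≫ (α_ F.f (T.M.pow n) T.M.t).hom

/-- A `skip` uses `Hom.unit` and a `hit` uses `Hom.mul`. The result will become the naturality of
`γ` in the 2-cells of `𝔹Δ₊`. -/
theorem powSwap_naturality (F : Hom S T) {m k : ℕ} (p : OrdPath m k) :
    S.M.powMap p ▷ F.f ≫ powSwap F k = powSwap F m ≫ F.f ◁ T.M.powMap p := by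
  induction p with
  | nil => simp [MonadData.powMap]
  | @skip m k p ih =>
    have h := congrArg (fun x => S.M.pow k ◁ x) F.unit
    simp only [whiskerLeft_comp] at h
    simp only [MonadData.powMap, comp_whiskerRight, Category.assoc, whiskerLeft_comp,
      ← reassoc_of% ih, powSwap]
    congr 1
    calc
      _ = (ρ_ _).inv ▷ F.f ⊗≫ (S.M.pow k ◁ S.M.η ▷ F.f ≫ S.M.pow k ◁ F.σ) ⊗≫
          powSwap F k ▷ T.M.t ⊗≫ 𝟙 _ := by bicategory
      _ = (ρ_ _).inv ≫ ((S.M.pow k ≫ F.f) ◁ T.M.η ≫ powSwap F k ▷ T.M.t) ⊗≫ 𝟙 _ := by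
        rw [h]; bicategory
      _ = _ := by rw [whisker_exchange]; bicategory
  | @hit m k p ih =>
    have h := congrArg (fun x => S.M.pow k ◁ x) F.mul
    simp only [whiskerLeft_comp] at h
    have ih' := congrArg (fun x => x ▷ T.M.t) ih
    simp only [comp_whiskerRight] at ih'
    simp only [MonadData.powMap, comp_whiskerRight, whiskerLeft_comp, powSwap] at ih' ⊢
    calc
      _ = S.M.powMap p ▷ S.M.t ▷ F.f ⊗≫ (S.M.pow k ◁ S.M.μ ▷ F.f ≫ S.M.pow k ◁ F.σ) ⊗≫
          powSwap F k ▷ T.M.t ⊗≫ 𝟙 _ := by bicategory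
      _ = 𝟙 _ ⊗≫ (S.M.powMap p ▷ (S.M.t ≫ F.f) ≫ (S.M.pow k ≫ S.M.t) ◁ F.σ) ⊗≫
          S.M.pow k ◁ F.σ ▷ T.M.t ⊗≫
          ((S.M.pow k ≫ F.f) ◁ T.M.μ ≫ powSwap F k ▷ T.M.t) ⊗≫ 𝟙 _ := by
        rw [h]; bicategory
      _ = 𝟙 _ ⊗≫ S.M.pow m ◁ F.σ ⊗≫ (S.M.powMap p ▷ F.f ▷ T.M.t ≫
          (α_ (S.M.pow k) S.M.t F.f).hom ▷ T.M.t ≫ (S.M.pow k ◁ F.σ) ▷ T.M.t ≫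
            (α_ (S.M.pow k) F.f T.M.t).inv ▷ T.M.t ≫ powSwap F k ▷ T.M.t ▷ T.M.t ≫
              (α_ F.f (T.M.pow k) T.M.t).hom ▷ T.M.t) ⊗≫ F.f ◁ T.M.pow k ◁ T.M.μ := by
        rw [whisker_exchange, ← whisker_exchange]; bicategory
      _ = _ := by rw [ih']; bicategory

/-- The source of the relation that `γ_{Id,g}` is an identity. -/
theorem powSwap_idHom (S : Mnd B) (n : ℕ) :
    powSwap (idHom S) n = (ρ_ (S.M.pow n)).hom ≫ (λ_ (S.M.pow n)).inv := by
  induction n with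
  | zero => simp [powSwap, idHom, unitors_equal, unitors_inv_equal]
  | succ n ih =>
    simp only [powSwap, ih]
    dsimp only [idHom]
    bicategory

/-- The source of the relation for `γ_{f'·f,g}`. -/
theorem powSwap_compHom (F : Hom S T) (G : Hom T U) (n : ℕ) :
    powSwap (compHom F G) n = (α_ _ _ _).inv ≫ powSwap F n ▷ G.f ≫ (α_ _ _ _).hom ≫
      F.f ◁ powSwap G n ≫ (α_ _ _ _).inv := by
  induction n with
  | zero =>
    simp only [powSwap, compHom]
    bicategory
  | succ n ih =>
    simp only [powSwap, ih]
    dsimp only [compHom]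
    calc
      _ = 𝟙 _ ⊗≫ S.M.pow n ◁ F.σ ▷ G.f ⊗≫ ((S.M.pow n ≫ F.f) ◁ G.σ ≫
          powSwap F n ▷ (G.f ≫ U.M.t)) ⊗≫ F.f ◁ powSwap G n ▷ U.M.t ⊗≫ 𝟙 _ := by bicategory
      _ = _ := by rw [whisker_exchange]; bicategory

/-- The source of the relation for `γ_{f,g'·g}`, since ordinal sum adds exponents. -/
theorem powSwap_add (F : Hom S T) (m n : ℕ) :
    powSwap F (m + n) ≫ F.f ◁ (T.M.powAdd m n).hom = (S.M.powAdd m n).hom ▷ F.f ≫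
      (α_ _ _ _).hom ≫ S.M.pow m ◁ powSwap F n ≫ (α_ _ _ _).inv ≫ powSwap F m ▷ T.M.pow n ≫
        (α_ _ _ _).hom := by
  induction n with
  | zero =>
    simp only [powSwap, MonadData.powAdd]
    dsimp only [Nat.add_zero, Iso.symm_hom]
    bicategory
  | succ n ih =>
    have ih' := congrArg (fun x => x ▷ T.M.t) ih
    simp only [comp_whiskerRight] at ih'
    simp only [powSwap, MonadData.powAdd, Iso.trans_hom, whiskerRightIso_hom]
    calc
      _ = 𝟙 _ ⊗≫ S.M.pow (m + n) ◁ F.σ ⊗≫ (powSwap F (m + n) ▷ T.M.t ≫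
          (F.f ◁ (T.M.powAdd m n).hom) ▷ T.M.t) ⊗≫ 𝟙 _ := by
        change ((α_ (S.M.pow (m + n)) S.M.t F.f).hom ≫ _) ≫ _ = _
        bicategory
      _ = 𝟙 _ ⊗≫ (S.M.pow (m + n) ◁ F.σ ≫ (S.M.powAdd m n).hom ▷ (F.f ≫ T.M.t)) ⊗≫
           S.M.pow m ◁ powSwap F n ▷ T.M.t ⊗≫ powSwap F m ▷ T.M.pow n ▷ T.M.t ⊗≫ 𝟙 _ := by
        rw [ih']; bicategory
      _ = _ := by rw [whisker_exchange]; bicategory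

/-- The source of the naturality of `γ` in its first argument. -/
theorem powSwap_comm {F G : Hom S T} (φ : Hom₂ F G) (n : ℕ) :
    powSwap F n ≫ φ.val ▷ T.M.pow n = S.M.pow n ◁ φ.val ≫ powSwap G n := by
  induction n with
  | zero =>
    simp only [powSwap]
    bicategory
  | succ n ih =>
    have ih' := congrArg (fun x => x ▷ T.M.t) ih
    have h := congrArg (fun x => S.M.pow n ◁ x) φ.comm
    simp only [comp_whiskerRight, whiskerLeft_comp] at ih' h
    simp only [powSwap]
    calc
      _ = 𝟙 _ ⊗≫ S.M.pow n ◁ F.σ ⊗≫ (powSwap F n ▷ T.M.t ≫ (φ.val ▷ T.M.pow n) ▷ T.M.t) ⊗≫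
          𝟙 _ := by bicategory
      _ = 𝟙 _ ⊗≫ (S.M.pow n ◁ F.σ ≫ S.M.pow n ◁ φ.val ▷ T.M.t) ⊗≫ powSwap G n ▷ T.M.t ⊗≫ 𝟙 _ := by
        rw [ih']; bicategory
      _ = _ := by rw [h]; bicategory

end Mnd

/-! ### Heterogeneous equality of cells and extensionality of strict 2-functors -/

namespace CategoryTheory

namespace Bicategory

variable {B : Type u} [Bicategory.{w, v} B]

theorem one_comp_heq {a a' b b' c c' : B} (ha : a = a') (hb : b = b') (hc : c = c')
    {f : a ⟶ b} {f' : a' ⟶ b'} {g : b ⟶ c} {g' : b' ⟶ c'} (hf : f ≍ f') (hg : g ≍ g') :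
    f ≫ g ≍ f' ≫ g' := by
  subst ha hb hc
  cases hf
  cases hg
  rfl

theorem eqToHom_heq_eqToHom {a a' b b' : B} (ha : a = a') (hb : b = b')
    {f g : a ⟶ b} {f' g' : a' ⟶ b'} (hf : f ≍ f') (h : f = g) (h' : f' = g') :
    eqToHom h ≍ eqToHom h' := by
  subst ha hb h h'
  cases hf
  rfl

theorem comp_heq {a a' b b' : B} (ha : a = a') (hb : b = b')
    {f g h : a ⟶ b} {f' g' h' : a' ⟶ b'} (hf : f ≍ f') (hg : g ≍ g') (hh : h ≍ h')
    {η : f ⟶ g} {η' : f' ⟶ g'} {θ : g ⟶ h} {θ' : g' ⟶ h'} (hη : η ≍ η') (hθ : θ ≍ θ') :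
    η ≫ θ ≍ η' ≫ θ' := by
  subst ha hb
  cases hf
  cases hg
  cases hh
  cases hη
  cases hθ
  rfl

theorem whiskerLeft_heq {a a' b b' c c' : B} (ha : a = a') (hb : b = b') (hc : c = c')
    {f : a ⟶ b} {f' : a' ⟶ b'} {g h : b ⟶ c} {g' h' : b' ⟶ c'} (hf : f ≍ f') (hg : g ≍ g')
    (hh : h ≍ h') {η : g ⟶ h} {η' : g' ⟶ h'} (hη : η ≍ η') :
    f ◁ η ≍ f' ◁ η' := by
  subst ha hb hc
  cases hf
  cases hg
  cases hh
  cases hη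
  rfl

theorem whiskerRight_heq {a a' b b' c c' : B} (ha : a = a') (hb : b = b') (hc : c = c')
    {f g : a ⟶ b} {f' g' : a' ⟶ b'} {h : b ⟶ c} {h' : b' ⟶ c'} (hf : f ≍ f') (hg : g ≍ g')
    (hh : h ≍ h') {η : f ⟶ g} {η' : f' ⟶ g'} (hη : η ≍ η') :
    η ▷ h ≍ η' ▷ h' := by
  subst ha hb hc
  cases hf
  cases hg
  cases hh
  cases hη
  rfl

/-- Heterogeneous equality does not see transports of the boundary, so identities between 2-cells
with propositionally equal boundaries can be proved without moving `eqToHom`s around. -/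
theorem conj_heq {a b : B} {f f' g g' : a ⟶ b} (p : f = f') (η : f' ⟶ g') (q : g' = g) :
    eqToHom p ≫ η ≫ eqToHom q ≍ η := by
  subst p q
  simp

theorem eq_conj_of_heq {a b : B} {f f' g g' : a ⟶ b} (p : f = f') (q : g' = g) {η : f' ⟶ g'}
    {θ : f ⟶ g} (h : θ ≍ η) : θ = eqToHom p ≫ η ≫ eqToHom q :=
  eq_of_heq (h.trans (conj_heq p η q).symm)

end Bicategory

namespace StrictPseudofunctor

variable {B : Type u₁} [Bicategory.{w₁, v₁} B] {C : Type u₂} [Bicategory.{w₂, v₂} C]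

/-- The fields `mapId` and `mapComp` are data, but strictness forces them to be `eqToIso`; all
remaining fields are proofs. -/
theorem ext_of_toPrelaxFunctorStruct {F G : StrictPseudofunctor B C}
    (h : F.toPrelaxFunctorStruct = G.toPrelaxFunctorStruct) : F = G := by
  obtain ⟨⟨⟨⟨S, _, _⟩, mapId, mapComp, _, _, _, _, _⟩, _, hId⟩, _, hComp⟩ := F
  obtain ⟨⟨⟨⟨S', _, _⟩, mapId', mapComp', _, _, _, _, _⟩, _, hId'⟩, _, hComp'⟩ := G
  dsimp only at h hId hId' hComp hComp'
  subst h
  have h₁ : mapId = mapId' := funext fun x => (hId x).trans (hId' x).symm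
  have h₂ : @mapComp = @mapComp' := by
    funext _ _ _ f g
    exact (hComp f g).trans (hComp' f g).symm
  subst h₁
  subst h₂
  rfl

theorem prelaxFunctorStruct_ext {F G : PrelaxFunctorStruct B C} (hobj : ∀ x, F.obj x = G.obj x)
    (hmap : ∀ {x y : B} (f : x ⟶ y), F.map f ≍ G.map f)
    (hmap₂ : ∀ {x y : B} {f g : x ⟶ y} (η : f ⟶ g), F.map₂ η ≍ G.map₂ η) : F = G := by
  obtain ⟨⟨Fo, Fm⟩, F2⟩ := F
  obtain ⟨⟨Go, Gm⟩, G2⟩ := G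
  dsimp only at hobj hmap hmap₂
  obtain rfl : Fo = Go := funext hobj
  obtain rfl : @Fm = @Gm := by
    funext x y f
    exact eq_of_heq (hmap f)
  obtain rfl : @F2 = @G2 := by
    funext x y f g η
    exact eq_of_heq (hmap₂ η)
  rfl

theorem ext_of_heq {F G : StrictPseudofunctor B C} (hobj : ∀ x, F.obj x = G.obj x)
    (hmap : ∀ {x y : B} (f : x ⟶ y), F.map f ≍ G.map f)
    (hmap₂ : ∀ {x y : B} {f g : x ⟶ y} (η : f ⟶ g), F.map₂ η ≍ G.map₂ η) : F = G :=
  ext_of_toPrelaxFunctorStruct (prelaxFunctorStruct_ext hobj hmap hmap₂)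

theorem map₂_eqToHom (F : StrictPseudofunctor B C) {a b : B} {f g : a ⟶ b} (h : f = g) :
    F.map₂ (eqToHom h) = eqToHom (congrArg F.map h) := by
  subst h
  simp

theorem map₂_whiskerLeft (F : StrictPseudofunctor B C) {a b c : B} (f : a ⟶ b) {g h : b ⟶ c}
    (η : g ⟶ h) : F.map₂ (f ◁ η) =
      eqToHom (F.map_comp f g) ≫ F.map f ◁ F.map₂ η ≫ eqToHom (F.map_comp f h).symm := by
  simp [F.mapComp_eq_eqToIso]

theorem map₂_whiskerRight (F : StrictPseudofunctor B C) {a b c : B} {f g : a ⟶ b} (η : f ⟶ g)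
    (h : b ⟶ c) : F.map₂ (η ▷ h) =
      eqToHom (F.map_comp f h) ≫ F.map₂ η ▷ F.map h ≫ eqToHom (F.map_comp g h).symm := by
  simp [F.mapComp_eq_eqToIso]

end StrictPseudofunctor

end CategoryTheory

/-! ### Cells of the augmented simplex category as functions on numbers -/

namespace AugmentedSimplexCategory

open MonoidalCategory

/-- The number of elements of a finite ordinal. -/
def card : AugmentedSimplexCategory → ℕ
  | .of x => x.len + 1
  | .star => 0

/-- The values of a monotone map; meaningful on elements of the domain only. -/
def val : ∀ {x y : AugmentedSimplexCategory} (_ : x ⟶ y), ℕ → ℕ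
  | .of x, .of _, h => fun i =>
      if hi : i < x.len + 1 then ((WithInitial.down h).toOrderHom ⟨i, hi⟩ : ℕ) else 0
  | .star, _, _ => fun _ => 0
  | .of _, .star, _ => fun _ => 0

theorem val_of {x y : SimplexCategory} (h : WithInitial.of x ⟶ WithInitial.of y)
    (i : Fin (x.len + 1)) :
    val h i = ((WithInitial.down h).toOrderHom i : ℕ) := by
  simp [val, i.2]

theorem val_lt {x y : AugmentedSimplexCategory} (h : x ⟶ y) : ∀ i < card x, val h i < card y := by
  intro i hi
  match x, y, h with
  | .of x, .of y, h =>
    rw [val_of h ⟨i, hi⟩]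
    exact Fin.is_lt _
  | .star, _, _ => exact absurd hi (Nat.not_lt_zero _)
  | .of _, .star, h => exact (WithInitial.false_of_to_star h).elim

theorem val_mono {x y : AugmentedSimplexCategory} (h : x ⟶ y) :
    ∀ i j, i ≤ j → j < card x → val h i ≤ val h j := by
  intro i j hij hj
  match x, y, h with
  | .of x, .of y, h =>
    rw [val_of h ⟨i, hij.trans_lt hj⟩, val_of h ⟨j, hj⟩]
    exact (WithInitial.down h).toOrderHom.monotone hij
  | .star, _, _ => exact absurd hj (Nat.not_lt_zero _)
  | .of _, .star, h => exact (WithInitial.false_of_to_star h).elim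

theorem val_ext {x y : AugmentedSimplexCategory} {h h' : x ⟶ y}
    (H : ∀ i < card x, val h i = val h' i) : h = h' := by
  match x, y, h, h' with
  | .of x, .of y, h, h' =>
    change WithInitial.down h = WithInitial.down h'
    ext i : 3
    apply Fin.ext
    rw [← val_of h i, ← val_of h' i]
    exact H i i.2
  | .star, _, _, _ => exact Subsingleton.elim _ _
  | .of _, .star, h, _ => exact (WithInitial.false_of_to_star h).elim

theorem val_id (x : AugmentedSimplexCategory) : ∀ i < card x, val (𝟙 x) i = i := by
  intro i hi
  match x with
  | .of x =>
    rw [val_of (𝟙 (WithInitial.of x)) ⟨i, hi⟩]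
    rfl
  | .star => exact absurd hi (Nat.not_lt_zero _)

theorem val_comp {x y z : AugmentedSimplexCategory} (f : x ⟶ y) (g : y ⟶ z) :
    ∀ i < card x, val (f ≫ g) i = val g (val f i) := by
  intro i hi
  match x, y, z, f, g with
  | .of x, .of y, .of z, f, g =>
    rw [val_of (f ≫ g) ⟨i, hi⟩, val_of f ⟨i, hi⟩, val_of g]
    rfl
  | .star, _, _, _, _ => exact absurd hi (Nat.not_lt_zero _)
  | .of _, .star, _, h, _ => exact (WithInitial.false_of_to_star h).elim
  | _, .of _, .star, _, h => exact (WithInitial.false_of_to_star h).elim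

theorem val_eqToHom {x y : AugmentedSimplexCategory} (h : x = y) :
    ∀ i < card x, val (eqToHom h) i = i := by
  subst h
  exact val_id x

theorem card_tensorObj (x y : AugmentedSimplexCategory) : card (x ⊗ y) = card x + card y := by
  match x, y with
  | .of x, .of y =>
    change x.len + y.len + 1 + 1 = x.len + 1 + (y.len + 1)
    omega
  | .star, .of y => exact (Nat.zero_add _).symm
  | .star, .star => rfl
  | .of _, .star => rfl

theorem val_inl (x y : AugmentedSimplexCategory) : ∀ i < card x, val (inl x y) i = i := by
  intro i hi
  match x, y with
  | .of x, .of y =>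
    refine (val_of (y := tensorObjOf x y) (inl (.of x) (.of y)) ⟨i, hi⟩).trans ?_
    exact congrArg Fin.val (inl'_eval x y ⟨i, hi⟩)
  | .star, _ => exact absurd hi (Nat.not_lt_zero _)
  | .of x, .star => exact val_id (.of x) i hi

theorem val_inr (x y : AugmentedSimplexCategory) :
    ∀ i < card y, val (inr x y) i = card x + i := by
  intro i hi
  match x, y with
  | .of x, .of y =>
    refine (val_of (y := tensorObjOf x y) (inr (.of x) (.of y)) ⟨i, hi⟩).trans ?_
    exact congrArg Fin.val (inr'_eval x y ⟨i, hi⟩)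
  | _, .star => exact absurd hi (Nat.not_lt_zero _)
  | .star, .of x => exact (val_id (.of x) i hi).trans (Nat.zero_add i).symm

/-- The inclusions `inl` and `inr` jointly cover the ordinal sum, and the tensor product of maps
commutes with them. -/
theorem val_tensorHom {x y x' y' : AugmentedSimplexCategory} (f : x ⟶ y) (g : x' ⟶ y') :
    ∀ i < card x + card x', val (f ⊗ₘ g) i =
      if i < card x then val f i else card y + val g (i - card x) := by
  intro i hi
  split_ifs with h
  · have := congrArg (fun k => val k i) (inl_comp_tensorHom f g)
    simpa only [val_comp _ _ i h, val_inl _ _ i h, val_inl _ _ _ (val_lt f i h)] using this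
  · obtain ⟨j, rfl⟩ := Nat.exists_eq_add_of_le (not_lt.mp h)
    have hj : j < card x' := by omega
    have := congrArg (fun k => val k j) (inr_comp_tensorHom f g)
    simpa only [val_comp _ _ j hj, val_inr _ _ j hj, val_inr _ _ _ (val_lt g j hj),
      Nat.add_sub_cancel_left] using this

theorem val_whiskerLeft (x : AugmentedSimplexCategory) {y z : AugmentedSimplexCategory}
    (g : y ⟶ z) : ∀ i < card x + card y, val (x ◁ g) i =
      if i < card x then i else card x + val g (i - card x) := by
  intro i hi
  refine (val_tensorHom (𝟙 x) g i hi).trans ?_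
  split_ifs with h
  · exact val_id x i h
  · rfl

theorem val_whiskerRight {x y : AugmentedSimplexCategory} (f : x ⟶ y)
    (z : AugmentedSimplexCategory) : ∀ i < card x + card z, val (f ▷ z) i =
      if i < card x then val f i else card y + (i - card x) := by
  intro i hi
  refine (val_tensorHom f (𝟙 z) i hi).trans ?_
  split_ifs with h
  · rfl
  · rw [val_id z _ (by omega)]

/-- The description of a monotone map as a path. -/
noncomputable def toPath {x y : AugmentedSimplexCategory} (h : x ⟶ y) : OrdPath (card x) (card y) :=
  (OrdPath.exists_ev_eq _ _ (val h) (val_lt h) (val_mono h)).choose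

theorem ev_toPath {x y : AugmentedSimplexCategory} (h : x ⟶ y) :
    ∀ i < card x, (toPath h).ev i = val h i :=
  (OrdPath.exists_ev_eq _ _ (val h) (val_lt h) (val_mono h)).choose_spec

theorem toPath_id (x : AugmentedSimplexCategory) : toPath (𝟙 x) = OrdPath.id (card x) :=
  OrdPath.ext fun i hi => by rw [ev_toPath _ i hi, OrdPath.ev_id _ i hi, val_id x i hi]

theorem toPath_comp {x y z : AugmentedSimplexCategory} (f : x ⟶ y) (g : y ⟶ z) :
    toPath (f ≫ g) = (toPath f).comp (toPath g) :=
  OrdPath.ext fun i hi => by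
    rw [ev_toPath _ i hi, OrdPath.ev_comp _ _ i hi, ev_toPath _ i hi,
      ev_toPath _ _ (val_lt f i hi), val_comp f g i hi]

end AugmentedSimplexCategory

/-! ### The strict 2-functor out of `𝔹Δ₊` given by a monad -/

namespace MonadData

variable {B : Type u} [Bicategory.{w, v} B] {a : B}

/-- Paths of different types, such as those indexed by `card (f ≫ g)` and by `card f + card g`, are
compared through their values. -/
theorem powMap_heq (M : MonadData a) {m k m' k' : ℕ} (hm : m = m') (hk : k = k')
    {p : OrdPath m k} {p' : OrdPath m' k'} (h : ∀ i < m, p.ev i = p'.ev i) :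
    M.powMap p ≍ M.powMap p' := by
  subst hm hk
  rw [OrdPath.ext h]

theorem powMap_id_sum_heq [Bicategory.Strict B] {M : MonadData a} (hM : M.IsMonad) (n : ℕ)
    {m k : ℕ} (p : OrdPath m k) :
    M.powMap ((OrdPath.id n).sum p) ≍ M.pow n ◁ M.powMap p := by
  have h := M.powMap_id_sum hM n p
  rw [powAdd_hom, powAdd_hom] at h
  exact (comp_eqToHom_heq _ _).symm.trans ((heq_of_eq h).trans (eqToHom_comp_heq _ _))

theorem powMap_sum_id_heq [Bicategory.Strict B] {M : MonadData a} (hM : M.IsMonad) (n : ℕ)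
    {m k : ℕ} (p : OrdPath m k) :
    M.powMap (p.sum (OrdPath.id n)) ≍ M.powMap p ▷ M.pow n := by
  have h := M.powMap_sum_id hM n p
  rw [powAdd_hom, powAdd_hom] at h
  exact (comp_eqToHom_heq _ _).symm.trans ((heq_of_eq h).trans (eqToHom_comp_heq _ _))

end MonadData

namespace BDelta

open AugmentedSimplexCategory

variable {B : Type u} [Bicategory.{w, v} B]

/-- The monad `([0], η, μ)` in `𝔹Δ₊`. -/
def univ : MonadData pt where
  t := t
  η := unit
  μ := mult

theorem card_comp {x y z : BDelta} (f : x ⟶ y) (g : y ⟶ z) :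
    card (f ≫ g) = card f + card g :=
  card_tensorObj f g

theorem powMap_whiskerLeft_heq [Bicategory.Strict B] {a : B} {M : MonadData a} (hM : M.IsMonad)
    {x y z : BDelta} (f : x ⟶ y) {g h : y ⟶ z} (η : g ⟶ h) :
    M.powMap (toPath (f ◁ η)) ≍ M.pow (card f) ◁ M.powMap (toPath η) := by
  refine (M.powMap_heq (card_comp f g) (card_comp f h) (p' := (OrdPath.id (card f)).sum (toPath η))
    (fun i hi => ?_)).trans (MonadData.powMap_id_sum_heq hM _ _)
  rw [ev_toPath _ i hi]
  have hi' := hi.trans_eq (card_comp f g)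
  refine (val_whiskerLeft f η i hi').trans ?_
  rw [OrdPath.ev_sum _ _ i hi']
  split_ifs with h
  · exact (OrdPath.ev_id _ i h).symm
  · rw [ev_toPath η _ (by omega)]

theorem powMap_whiskerRight_heq [Bicategory.Strict B] {a : B} {M : MonadData a} (hM : M.IsMonad)
    {x y z : BDelta} {f g : x ⟶ y} (η : f ⟶ g) (h : y ⟶ z) :
    M.powMap (toPath (η ▷ h)) ≍ M.powMap (toPath η) ▷ M.pow (card h) := by
  refine (M.powMap_heq (card_comp f h) (card_comp g h) (p' := (toPath η).sum (OrdPath.id (card h)))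
    (fun i hi => ?_)).trans (MonadData.powMap_sum_id_heq hM _ _)
  rw [ev_toPath _ i hi]
  have hi' := hi.trans_eq (card_comp f h)
  refine (val_whiskerRight η h i hi').trans ?_
  rw [OrdPath.ev_sum _ _ i hi']
  split_ifs with h
  · rw [ev_toPath η _ h]
  · rw [OrdPath.ev_id _ _ (by omega)]

/-- The strict 2-functor `𝔹Δ₊ → B` that corresponds to a monad. -/
noncomputable def lift [Bicategory.Strict B] (S : Mnd B) : StrictPseudofunctor BDelta B :=
  StrictPseudofunctor.mk''
    { obj := fun _ => S.a
      map := fun f => S.M.pow (card f)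
      map₂ := fun η => S.M.powMap (toPath η)
      map₂_id := fun f => by
        refine (congrArg _ (toPath_id f)).trans (MonadData.powMap_id S.isMonad _)
      map₂_comp := fun η θ => by
        refine (congrArg _ (toPath_comp η θ)).trans (MonadData.powMap_comp S.isMonad _ _)
      map_id := fun _ => rfl
      map_comp := fun f g => by rw [card_comp, MonadData.pow_add]
      map₂_whisker_left := fun f _ _ η =>
        eq_conj_of_heq _ _ (powMap_whiskerLeft_heq S.isMonad f η)
      map₂_whisker_right := fun η h =>
        eq_conj_of_heq _ _ (powMap_whiskerRight_heq S.isMonad η h) }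

/-- The 1-cell `[n - 1]` is the `n`-th power of `[0]`. -/
theorem univ_pow_succ (n : ℕ) :
    univ.pow (n + 1) = (WithInitial.of (SimplexCategory.mk n) : AugmentedSimplexCategory) := by
  induction n with
  | zero => rfl
  | succ n ih => exact congrArg (fun x => AugmentedSimplexCategory.tensorObj x t) ih

theorem univ_pow_card {x y : BDelta} (f : x ⟶ y) : univ.pow (card f) = f := by
  change AugmentedSimplexCategory at f
  match f with
  | .of x => exact univ_pow_succ x.len
  | .star => rfl

theorem card_univ_pow (n : ℕ) : card (univ.pow n) = n := by
  cases n with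
  | zero => rfl
  | succ n => rw [univ_pow_succ]; rfl

/-- Every finite ordinal is an iterated sum of copies of `[0]`. -/
theorem induction_one {P : ∀ (_ : pt ⟶ pt), Prop} (h₀ : P (𝟙 pt)) (h₁ : ∀ f, P f → P (f ≫ t))
    (f : pt ⟶ pt) : P f := by
  rw [← univ_pow_card f]
  generalize card f = n
  induction n with
  | zero => exact h₀
  | succ n ih => exact h₁ _ ih

theorem val_one_eq_zero {x : AugmentedSimplexCategory} (h : x ⟶ t) :
    ∀ i < card x, val h i = 0 := fun i hi =>
  Nat.lt_one_iff.mp (val_lt h i hi)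

theorem val_rightUnitor_inv (f : pt ⟶ pt) : ∀ i < card f, val (ρ_ f).inv i = i := by
  intro i hi
  rw [Bicategory.Strict.rightUnitor_eqToIso]
  exact val_eqToHom (Bicategory.Strict.comp_id f).symm i hi

theorem val_associator_hom (f g h : pt ⟶ pt) :
    ∀ i < card ((f ≫ g) ≫ h), val (α_ f g h).hom i = i := by
  intro i hi
  rw [Bicategory.Strict.associator_eqToIso]
  exact val_eqToHom (Bicategory.Strict.assoc f g h) i hi

/-- For the monad `[0]` in `𝔹Δ₊` itself, reading a path as a composite of units and multiplications
gives back the map it encodes. Hence `η` and `μ` generate all monotone maps. -/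
theorem val_univ_powMap {m k : ℕ} (p : OrdPath m k) :
    ∀ i < m, val (univ.powMap p) i = p.ev i := by
  induction p with
  | nil => exact fun i hi => absurd hi (Nat.not_lt_zero i)
  | @skip m k p ih =>
    intro i hi
    have hp : p.ev i < card (univ.pow k) := (p.ev_lt i hi).trans_eq (card_univ_pow k).symm
    refine (val_comp (univ.powMap p) ((ρ_ (univ.pow k)).inv ≫ univ.pow k ◁ univ.η) i
      (hi.trans_eq (card_univ_pow m).symm)).trans ?_
    rw [ih i hi]
    refine (val_comp (ρ_ (univ.pow k)).inv (univ.pow k ◁ univ.η) _ hp).trans ?_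
    rw [val_rightUnitor_inv _ _ hp]
    exact (val_whiskerLeft (univ.pow k) univ.η _ (hp.trans_le (Nat.le_add_right _ _))).trans
      (if_pos hp)
  | @hit m k p ih =>
    intro i hi
    -- Whiskered multiplication fixes the first `k` elements and merges the last two, `k` and `k +
    -- 1`.
    have key : ∀ j < k + 2, val ((α_ (univ.pow k) t t).hom ≫ univ.pow k ◁ univ.μ) j =
        if j < k then j else k := by
      intro j hj
      have hj' : j < card ((univ.pow k ≫ t) ≫ t) := by
        rw [card_comp, card_comp, card_univ_pow]
        exact hj
      refine (val_comp (α_ (univ.pow k) t t).hom (univ.pow k ◁ univ.μ) j hj').trans ?_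
      rw [val_associator_hom _ _ _ j hj']
      have ht : card (univ.t ≫ univ.t) = 2 := rfl
      have hk := card_univ_pow k
      refine (val_whiskerLeft (univ.pow k) univ.μ j (by omega)).trans ?_
      have h₂ : val univ.μ (j - card (univ.pow k)) = 0 :=
        val_one_eq_zero univ.μ _ (by omega)
      rw [hk] at h₂ ⊢
      split_ifs with h
      · rfl
      · exact congrArg (fun x => k + x) h₂
    have hm := card_univ_pow m
    have hk := card_univ_pow (k + 1)
    have hi' : i < card (univ.pow m) + card t := by
      rw [hm]
      exact hi
    refine (val_comp (univ.powMap p ▷ t) ((α_ (univ.pow k) t t).hom ≫ univ.pow k ◁ univ.μ) i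
      (hi'.trans_eq (card_comp (univ.pow m) t).symm)).trans ?_
    have h₁ : val (univ.powMap p ▷ t) i = if i < m then p.ev i else k + 1 := by
      refine (val_whiskerRight (univ.powMap p) t i hi').trans ?_
      rw [hm, hk]
      split_ifs with h
      · exact ih i h
      · omega
    rw [h₁, OrdPath.ev]
    rcases Nat.lt_succ_iff_lt_or_eq.mp hi with h | h
    · have := p.ev_lt i h
      rw [if_pos h, if_neg h.ne]
      refine (key _ (by omega)).trans ?_
      split_ifs <;> omega
    · rw [if_neg h.not_lt, if_pos h]
      refine (key _ (by omega)).trans ?_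
      split_ifs <;> omega

theorem heq_univ_powMap {f g : pt ⟶ pt} (η : f ⟶ g) : η ≍ univ.powMap (toPath η) := by
  have h : η = eqToHom (univ_pow_card f).symm ≫ univ.powMap (toPath η) ≫
      eqToHom (univ_pow_card g) := by
    refine val_ext fun i hi => ?_
    have hi' : i < card (univ.pow (card f)) := hi.trans_eq (card_univ_pow _).symm
    refine Eq.symm ((val_comp (eqToHom (univ_pow_card f).symm) _ i hi).trans ?_)
    rw [show val (eqToHom (univ_pow_card f).symm) i = i from val_eqToHom _ i hi]
    refine (val_comp (univ.powMap (toPath η)) (eqToHom (univ_pow_card g)) i hi').trans ?_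
    refine (val_eqToHom (univ_pow_card g) _ (val_lt (univ.powMap (toPath η)) i hi')).trans ?_
    rw [val_univ_powMap _ i hi, ev_toPath η i hi]
  exact (heq_of_eq h).trans (conj_heq _ _ _)

/-- Each law compares two maps into the terminal ordinal `[0]`. -/
theorem isMonad_univ : univ.IsMonad where
  left_unit := val_ext fun i hi =>
    (val_one_eq_zero _ i hi).trans (val_one_eq_zero _ i hi).symm
  right_unit := val_ext fun i hi =>
    (val_one_eq_zero _ i hi).trans (val_one_eq_zero _ i hi).symm
  assoc := val_ext fun i hi =>
    (val_one_eq_zero _ i hi).trans (val_one_eq_zero _ i hi).symm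

end BDelta

/-! ### Strict 2-functors preserve monads and their powers -/

namespace CategoryTheory.StrictPseudofunctor

variable {B : Type u₁} [Bicategory.{w₁, v₁} B] {C : Type u₂} [Bicategory.{w₂, v₂} C]
  (F : StrictPseudofunctor B C)

theorem map₂_whiskerLeft_heq {a b c : B} (f : a ⟶ b) {g h : b ⟶ c}
    (η : g ⟶ h) : F.map₂ (f ◁ η) ≍ F.map f ◁ F.map₂ η := by
  rw [map₂_whiskerLeft]
  exact conj_heq _ _ _

theorem map₂_whiskerRight_heq {a b c : B} {f g : a ⟶ b} (η : f ⟶ g) (h : b ⟶ c) :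
    F.map₂ (η ▷ h) ≍ F.map₂ η ▷ F.map h := by
  rw [map₂_whiskerRight]
  exact conj_heq _ _ _

variable [Bicategory.Strict B] [Bicategory.Strict C]

theorem map₂_rightUnitor_hom_heq {a b : B} (f : a ⟶ b) :
    F.map₂ (ρ_ f).hom ≍ (ρ_ (F.map f)).hom := by
  rw [Bicategory.Strict.rightUnitor_eqToIso, Bicategory.Strict.rightUnitor_eqToIso, eqToIso.hom,
    eqToIso.hom, map₂_eqToHom]
  exact eqToHom_heq_eqToHom rfl rfl
    (heq_of_eq ((F.map_comp _ _).trans (congrArg (fun x => F.map f ≫ x) (F.map_id _)))) _ _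

theorem map₂_leftUnitor_hom_heq {a b : B} (f : a ⟶ b) :
    F.map₂ (λ_ f).hom ≍ (λ_ (F.map f)).hom := by
  rw [Bicategory.Strict.leftUnitor_eqToIso, Bicategory.Strict.leftUnitor_eqToIso, eqToIso.hom,
    eqToIso.hom, map₂_eqToHom]
  exact eqToHom_heq_eqToHom rfl rfl
    (heq_of_eq ((F.map_comp _ _).trans (congrArg (fun x => x ≫ F.map f) (F.map_id _)))) _ _

theorem map₂_rightUnitor_inv_heq {a b : B} (f : a ⟶ b) :
    F.map₂ (ρ_ f).inv ≍ (ρ_ (F.map f)).inv := by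
  rw [Bicategory.Strict.rightUnitor_eqToIso, Bicategory.Strict.rightUnitor_eqToIso, eqToIso.inv,
    eqToIso.inv, map₂_eqToHom]
  exact eqToHom_heq_eqToHom rfl rfl HEq.rfl _ _

theorem map₂_associator_hom_heq {a b c d : B} (f : a ⟶ b) (g : b ⟶ c) (h : c ⟶ d) :
    F.map₂ (α_ f g h).hom ≍ (α_ (F.map f) (F.map g) (F.map h)).hom := by
  rw [Bicategory.Strict.associator_eqToIso, Bicategory.Strict.associator_eqToIso, eqToIso.hom,
    eqToIso.hom, map₂_eqToHom]
  exact eqToHom_heq_eqToHom rfl rfl (heq_of_eq (by rw [F.map_comp, F.map_comp])) _ _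

end CategoryTheory.StrictPseudofunctor

namespace MonadData

theorem ext_of_heq {B : Type u} [Bicategory.{w, v} B] {a : B} {M N : MonadData a}
    (ht : M.t = N.t) (hη : M.η ≍ N.η) (hμ : M.μ ≍ N.μ) : M = N := by
  obtain ⟨t, η, μ⟩ := M
  obtain ⟨t', η', μ'⟩ := N
  dsimp only at ht hη hμ
  subst ht
  rw [eq_of_heq hη, eq_of_heq hμ]

variable {B : Type u₁} [Bicategory.{w₁, v₁} B] {C : Type u₂} [Bicategory.{w₂, v₂} C]

theorem map_pow (F : StrictPseudofunctor B C) {a : B} (M : MonadData a) (n : ℕ) :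
    F.map (M.pow n) = (M.map F).pow n := by
  induction n with
  | zero => exact F.map_id a
  | succ n ih => exact (F.map_comp _ _).trans (congrArg (fun x => x ≫ F.map M.t) ih)

theorem map_η_heq (F : StrictPseudofunctor B C) {a : B} (M : MonadData a) :
    F.map₂ M.η ≍ (M.map F).η := by
  simp only [map, F.mapId_eq_eqToIso, eqToIso.inv]
  exact (eqToHom_comp_heq _ _).symm

theorem map_μ_heq (F : StrictPseudofunctor B C) {a : B} (M : MonadData a) :
    F.map₂ M.μ ≍ (M.map F).μ := by
  simp only [map, F.mapComp_eq_eqToIso, eqToIso.inv]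
  exact (eqToHom_comp_heq _ _).symm

variable [Bicategory.Strict B] [Bicategory.Strict C]

/-- Only units, multiplications, whiskerings and coherence cells enter `powMap`, and strict
2-functors preserve all of these. -/
theorem map₂_powMap_heq
    (F : StrictPseudofunctor B C) {a : B} (M : MonadData a) {m k : ℕ} (p : OrdPath m k) :
    F.map₂ (M.powMap p) ≍ (M.map F).powMap p := by
  have hp (n : ℕ) := heq_of_eq (M.map_pow F n)
  have hc {f g : a ⟶ a} := heq_of_eq (F.map_comp f g)
  induction p with
  | nil =>
    simp only [powMap, PrelaxFunctor.map₂_id]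
    rw [map_pow]
  | @skip m k p ih =>
    simp only [powMap, PrelaxFunctor.map₂_comp]
    refine comp_heq rfl rfl (hp _) (hp _) (hp _) ih (comp_heq rfl rfl (hp _) ?_ (hp _) ?_ ?_)
    · exact hc.trans (one_comp_heq rfl rfl rfl (hp _) (heq_of_eq (F.map_id _)))
    · exact (F.map₂_rightUnitor_inv_heq _).trans (by rw [map_pow])
    · exact (F.map₂_whiskerLeft_heq _ _).trans (whiskerLeft_heq rfl rfl rfl (hp _)
        (heq_of_eq (F.map_id _)) HEq.rfl (map_η_heq F M))
  | @hit m k p ih =>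
    simp only [powMap, PrelaxFunctor.map₂_comp]
    refine comp_heq rfl rfl (hp (m + 1)) ?_ (hp _) ?_ (comp_heq rfl rfl ?_ ?_ (hp _) ?_ ?_)
    · exact hc.trans (one_comp_heq rfl rfl rfl (hp (k + 1)) HEq.rfl)
    · exact (F.map₂_whiskerRight_heq _ _).trans (whiskerRight_heq rfl rfl rfl (hp _) (hp _)
        HEq.rfl ih)
    · exact hc.trans (one_comp_heq rfl rfl rfl (hp (k + 1)) HEq.rfl)
    · exact hc.trans (one_comp_heq rfl rfl rfl (hp k) hc)
    · refine (F.map₂_associator_hom_heq _ _ _).trans ?_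
      rw [map_pow]
      rfl
    · exact (F.map₂_whiskerLeft_heq _ _).trans (whiskerLeft_heq rfl rfl rfl (hp _)
        hc HEq.rfl (map_μ_heq F M))

theorem IsMonad.map (F : StrictPseudofunctor B C) {a : B} {M : MonadData a} (hM : M.IsMonad) :
    (M.map F).IsMonad where
  left_unit := by
    have h := congrArg F.map₂ hM.left_unit
    rw [PrelaxFunctor.map₂_comp] at h
    refine eq_of_heq (HEq.trans (comp_heq rfl rfl ?_ ?_ HEq.rfl ?_ (map_μ_heq F M).symm)
      ((heq_of_eq h).trans (F.map₂_rightUnitor_hom_heq _)))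
    · exact (heq_of_eq ((F.map_comp _ _).trans
        (congrArg (fun x => F.map M.t ≫ x) (F.map_id _)))).symm
    · exact (heq_of_eq (F.map_comp _ _)).symm
    · exact ((F.map₂_whiskerLeft_heq _ _).trans (whiskerLeft_heq rfl rfl rfl HEq.rfl
        (heq_of_eq (F.map_id _)) HEq.rfl (map_η_heq F M))).symm
  right_unit := by
    have h := congrArg F.map₂ hM.right_unit
    rw [PrelaxFunctor.map₂_comp] at h
    refine eq_of_heq (HEq.trans (comp_heq rfl rfl ?_ ?_ HEq.rfl ?_ (map_μ_heq F M).symm)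
      ((heq_of_eq h).trans (F.map₂_leftUnitor_hom_heq _)))
    · exact (heq_of_eq ((F.map_comp _ _).trans
        (congrArg (fun x => x ≫ F.map M.t) (F.map_id _)))).symm
    · exact (heq_of_eq (F.map_comp _ _)).symm
    · exact ((F.map₂_whiskerRight_heq _ _).trans (whiskerRight_heq rfl rfl rfl
        (heq_of_eq (F.map_id _)) HEq.rfl HEq.rfl (map_η_heq F M))).symm
  assoc := by
    have h := congrArg F.map₂ hM.assoc
    have hc {f g : a ⟶ a} := heq_of_eq (F.map_comp f g)
    simp only [PrelaxFunctor.map₂_comp] at h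
    refine eq_of_heq (HEq.trans (comp_heq rfl rfl ?_ ?_ HEq.rfl ?_ (map_μ_heq F M).symm)
      ((heq_of_eq h).trans (comp_heq rfl rfl ?_ ?_ HEq.rfl (F.map₂_associator_hom_heq _ _ _)
        (comp_heq rfl rfl ?_ ?_ HEq.rfl ?_ (map_μ_heq F M)))))
    · exact (hc.trans (one_comp_heq rfl rfl rfl hc HEq.rfl)).symm
    · exact hc.symm
    · exact ((F.map₂_whiskerRight_heq _ _).trans (whiskerRight_heq rfl rfl rfl hc HEq.rfl HEq.rfl
        (map_μ_heq F M))).symm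
    · exact hc.trans (one_comp_heq rfl rfl rfl hc HEq.rfl)
    · exact hc.trans (one_comp_heq rfl rfl rfl HEq.rfl hc)
    · exact hc.trans (one_comp_heq rfl rfl rfl HEq.rfl hc)
    · exact hc
    · exact (F.map₂_whiskerLeft_heq _ _).trans (whiskerLeft_heq rfl rfl rfl HEq.rfl hc HEq.rfl
        (map_μ_heq F M))

end MonadData

/-! ### `𝔹Δ₊` is the free strict 2-category on a monad -/

namespace BDelta

open AugmentedSimplexCategory

variable {B : Type u} [Bicategory.{w, v} B] [Bicategory.Strict B]

/-- The monad that corresponds to a strict 2-functor `𝔹Δ₊ → B`. -/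
def toMnd (F : StrictPseudofunctor BDelta B) : Mnd B where
  a := F.obj pt
  M := univ.map F
  isMonad := isMonad_univ.map F

/-- The uniqueness half of freeness: by `univ_pow_card` and `heq_univ_powMap` every cell is built
from `[0]`, `η` and `μ`. -/
theorem lift_toMnd (F : StrictPseudofunctor BDelta B) : lift (toMnd F) = F :=
  StrictPseudofunctor.ext_of_heq (fun _ => rfl)
    (fun {x y} f => by
      change (univ.map F).pow (card f) ≍ F.map f
      rw [← MonadData.map_pow]
      exact heq_of_eq (congrArg F.map (univ_pow_card f)))
    (fun {x y f g} η => by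
      change (univ.map F).powMap (toPath η) ≍ F.map₂ η
      refine (MonadData.map₂_powMap_heq F univ (toPath η)).symm.trans ?_
      -- With the boundary replaced by variables, the equalities `univ_pow_card` can be substituted.
      have h : ∀ {f' g' : pt ⟶ pt} (θ : f' ⟶ g') (hf : f' = f) (hg : g' = g), θ ≍ η →
          F.map₂ θ ≍ F.map₂ η := by
        intro f' g' θ hf hg h
        subst hf hg
        rw [eq_of_heq h]
        exact HEq.rfl
      exact h _ (univ_pow_card f) (univ_pow_card g) (heq_univ_powMap η).symm)

theorem toPath_unit : toPath univ.η = .skip .nil :=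
  OrdPath.ext fun _ hi => absurd hi (Nat.not_lt_zero _)

theorem toPath_mult : toPath univ.μ = .hit (.hit (.skip .nil)) :=
  OrdPath.ext fun i hi => by
    refine (ev_toPath _ i hi).trans ((val_one_eq_zero _ i hi).trans ?_)
    simp [OrdPath.ev]

/-- The existence half of freeness: the normal forms of the two generating 2-cells evaluate to the
given unit and multiplication, up to coherence. -/
theorem map_univ_lift (S : Mnd B) : univ.map (lift S) = S.M := by
  refine MonadData.ext_of_heq (Bicategory.Strict.id_comp _) ?_ ?_
  · refine (MonadData.map_η_heq _ _).symm.trans ?_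
    change S.M.powMap (toPath univ.η) ≍ _
    rw [toPath_unit]
    change 𝟙 (𝟙 S.a) ≫ (ρ_ (𝟙 S.a)).inv ≫ 𝟙 S.a ◁ S.M.η ≍ S.M.η
    simp only [id_whiskerLeft, Bicategory.Strict.leftUnitor_eqToIso,
      Bicategory.Strict.rightUnitor_eqToIso, eqToIso.hom, eqToIso.inv, Category.id_comp,
      eqToHom_trans_assoc]
    exact conj_heq _ _ _
  · refine (MonadData.map_μ_heq _ _).symm.trans ?_
    change S.M.powMap (toPath univ.μ) ≍ _
    rw [toPath_mult]
    -- The inner path is `OrdPath.id 1`, so only the outer `hit` contributes a multiplication.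
    have h : S.M.powMap (.hit (.skip .nil)) = 𝟙 (S.M.pow 1) := MonadData.powMap_id S.isMonad 1
    change S.M.powMap (.hit (.skip .nil)) ▷ S.M.t ≫ (α_ (𝟙 S.a) S.M.t S.M.t).hom ≫
      𝟙 S.a ◁ S.M.μ ≍ S.M.μ
    rw [h]
    simp only [id_whiskerRight, id_whiskerLeft, Bicategory.Strict.leftUnitor_eqToIso,
      Bicategory.Strict.associator_eqToIso, eqToIso.hom, eqToIso.inv, Category.id_comp,
      eqToHom_trans_assoc]
    exact conj_heq _ _ _

end BDelta

/-! ### From 2-functors into `Mnd B` to 2-functors on the tensor product -/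

namespace CategoryTheory.Bicategory

variable {B : Type u} [Bicategory.{w, v} B]

theorem whiskerLeft_of_eq {a b c : B} {f f' : a ⟶ b} (p : f = f') {g h : b ⟶ c} (η : g ⟶ h) :
    f ◁ η = eqToHom (congrArg (fun k => k ≫ g) p) ≫ f' ◁ η ≫
      eqToHom (congrArg (fun k => k ≫ h) p.symm) := by
  subst p
  simp

theorem whiskerRight_of_eq {a b c : B} {f g : a ⟶ b} (η : f ⟶ g) {h h' : b ⟶ c} (p : h = h') :
    η ▷ h = eqToHom (congrArg (fun k => f ≫ k) p) ≫ η ▷ h' ≫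
      eqToHom (congrArg (fun k => g ≫ k) p.symm) := by
  subst p
  simp

/-- The common shape of both formulas for `γ` on composites: two whiskered cells separated by
transports. -/
theorem chain_heq {a b : B} {f₀ f₁ f₂ f₃ f₄ f₅ g₀ g₁ g₂ g₃ g₄ g₅ : a ⟶ b}
    (p : f₀ = f₁) {η : f₁ ⟶ f₂} (q : f₂ = f₃) {θ : f₃ ⟶ f₄} (r : f₄ = f₅)
    (p' : g₀ = g₁) {η' : g₁ ⟶ g₂} (q' : g₂ = g₃) {θ' : g₃ ⟶ g₄} (r' : g₄ = g₅)
    (h₁ : f₁ = g₁) (h₂ : f₂ = g₂) (h₄ : f₄ = g₄) (hη : η ≍ η') (hθ : θ ≍ θ') :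
    eqToHom p ≫ η ≫ eqToHom q ≫ θ ≫ eqToHom r ≍
      eqToHom p' ≫ η' ≫ eqToHom q' ≫ θ' ≫ eqToHom r' := by
  subst p q r p' q' r' h₁ h₂ h₄
  cases hη
  cases hθ
  rfl

end CategoryTheory.Bicategory

namespace Mnd

variable {B : Type u} [Bicategory.{w, v} B]

theorem powSwap_heq {S T : Mnd B} {F G : Hom S T} (h : F = G) {m n : ℕ} (hn : m = n) :
    powSwap F m ≍ powSwap G n := by
  subst h hn
  rfl

/-- The strict 2-functor that sends a monad to its underlying 0-cell. -/
def forget (B : Type u) [Bicategory.{w, v} B] [Bicategory.Strict B] :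
    StrictPseudofunctor (Mnd B) B :=
  StrictPseudofunctor.mk''
    { obj := fun S => S.a
      map := fun F => Hom.f F
      map₂ := fun φ => Hom₂.val φ
      map₂_id := fun _ => rfl
      map₂_comp := fun _ _ => rfl
      map_id := fun _ => rfl
      map_comp := fun _ _ => rfl
      map₂_whisker_left := fun _ _ _ _ =>
        ((Category.id_comp _).trans (Category.comp_id _)).symm
      map₂_whisker_right := fun _ _ =>
        ((Category.id_comp _).trans (Category.comp_id _)).symm }

end Mnd

namespace GrayTensor

open AugmentedSimplexCategory

variable {X : Type u₁} [Bicategory.{w₁, v₁} X]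
  {B : Type u} [Bicategory.{w, v} B] [Bicategory.Strict B]
  (E : StrictPseudofunctor X (Mnd B))

/-- The strict 2-functor that is underlying `E`. -/
abbrev descLeft : StrictPseudofunctor X B :=
  E.comp (Mnd.forget B)

/-- The strict 2-functor `𝔹Δ₊ → B` that corresponds to the monad `E x`. -/
noncomputable abbrev descRight (x : X) : StrictPseudofunctor BDelta B :=
  BDelta.lift (E.obj x)

/-- The values on generating 1-cells of the strict 2-functor that corresponds to `E`. -/
noncomputable def descGen : ∀ {p q : Pair X BDelta}, Gen X BDelta p q →
    ((E.obj p.1).a ⟶ (E.obj q.1).a)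
  | _, _, .left f _ => (descLeft E).map f
  | _, _, .right b g => (descRight E b).map g

/-- The strict 2-functor that corresponds to `E`, on 0-cells and 1-cells. -/
noncomputable def descFunctor :
    @CategoryTheory.Functor (GrayTensor X BDelta) oneCategory B (StrictBicategory.category B) :=
  CategoryTheory.Quotient.lift (OneRel X BDelta)
    (Paths.lift { obj := fun p => (E.obj p.1).a, map := fun h => descGen E h })
    (fun _ _ _ _ h => by
      have hs {p q : Pair X BDelta} (h : Gen X BDelta p q) :
          (Paths.lift (V := Pair X BDelta) (C := B)
            { obj := fun p => (E.obj p.1).a, map := fun h => descGen E h }).map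
              (single X BDelta h) = descGen E h :=
        Paths.lift_toPath _ _
      cases h with
      | left_id b c =>
        exact (hs _).trans ((descLeft E).map_id b)
      | left_comp f f' c =>
        exact (Functor.map_comp _ _ _).trans ((congrArg₂ (fun a b => a ≫ b)
          (hs (.left f c)) (hs (.left f' c))).trans
          (((descLeft E).map_comp f f').symm.trans (hs (.left (f ≫ f') c)).symm))
      | right_id b c =>
        exact (hs _).trans ((descRight E b).map_id c)
      | right_comp b g g' =>
        exact (Functor.map_comp _ _ _).trans ((congrArg₂ (fun a b => a ≫ b)
          (hs (.right b g)) (hs (.right b g'))).trans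
          (((descRight E b).map_comp g g').symm.trans (hs (.right b (g ≫ g'))).symm)))

/-- The values on 1-cells. -/
noncomputable def descMap {x y : GrayTensor X BDelta} (f : x ⟶ y) :
    (E.obj x.as.1).a ⟶ (E.obj y.as.1).a :=
  (descFunctor E).map f

theorem descMap_id (x : GrayTensor X BDelta) : descMap E (𝟙 x) = 𝟙 _ :=
  (descFunctor E).map_id x

theorem descMap_comp {x y z : GrayTensor X BDelta} (f : x ⟶ y) (g : y ⟶ z) :
    descMap E (f ≫ g) = descMap E f ≫ descMap E g :=
  (descFunctor E).map_comp f g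

/-- A one-step path is evaluated as an identity followed by the generator, hence the appeal to
`id_comp`. -/
theorem descMap_left {b b' : X} (f : b ⟶ b') (c : BDelta) :
    descMap E (left f c) = (descLeft E).map f :=
  Bicategory.Strict.id_comp ((descLeft E).map f)

theorem descMap_right (b : X) {c c' : BDelta} (g : c ⟶ c') :
    descMap E (right b g) = (descRight E b).map g :=
  Bicategory.Strict.id_comp ((descRight E b).map g)

theorem descMap_right_left {b b' : X} {c c' : BDelta} (f : b ⟶ b') (g : c ⟶ c') :
    descMap E (right b g ≫ left f c') = (E.obj b).M.pow (card g) ≫ Mnd.Hom.f (E.map f) := by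
  rw [descMap_comp, descMap_left, descMap_right]
  rfl

theorem descMap_left_right {b b' : X} {c c' : BDelta} (f : b ⟶ b') (g : c ⟶ c') :
    descMap E (left f c ≫ right b' g) = Mnd.Hom.f (E.map f) ≫ (E.obj b').M.pow (card g) := by
  rw [descMap_comp, descMap_left, descMap_right]
  rfl

/-- The values on expressions for 2-cells. -/
noncomputable def descExpr : ∀ {x y : GrayTensor X BDelta} {f g : x ⟶ y}, Expr f g →
    (descMap E f ⟶ descMap E g)
  | _, _, _, _, .eq h => eqToHom (congrArg (descMap E) h)
  | _, _, _, _, .vcomp η θ => descExpr η ≫ descExpr θ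
  | _, _, _, _, .whiskerLeft (g := g) (h := h) f η =>
      eqToHom (descMap_comp E f g) ≫ descMap E f ◁ descExpr η ≫
      eqToHom (descMap_comp E f h).symm
  | _, _, _, _, .whiskerRight (f := f) (g := g) η h =>
      eqToHom (descMap_comp E f h) ≫ descExpr η ▷ descMap E h ≫
      eqToHom (descMap_comp E g h).symm
  | _, _, _, _, .left (f := f) (f' := f') φ c =>
      eqToHom (descMap_left E f c) ≫ (descLeft E).map₂ φ ≫
      eqToHom (descMap_left E f' c).symm
  | _, _, _, _, .right (g := g) (g' := g') b ψ =>
      eqToHom (descMap_right E b g) ≫ (descRight E b).map₂ ψ ≫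
      eqToHom (descMap_right E b g').symm
  -- The 2-functor `E` only supplies the interchange with `[0]`; a larger ordinal is passed one
  -- element at a time.
  | _, _, _, _, .swap f g => eqToHom (descMap_right_left E f g) ≫
      Mnd.powSwap (E.map f) (card g) ≫ eqToHom (descMap_left_right E f g).symm

theorem descExpr_whiskerLeft_heq {x y z : GrayTensor X BDelta} (f : x ⟶ y) {g h : y ⟶ z}
    (η : Expr g h) : descExpr E (.whiskerLeft f η) ≍ descMap E f ◁ descExpr E η :=
  conj_heq _ _ _

theorem descExpr_whiskerRight_heq {x y z : GrayTensor X BDelta} {f g : x ⟶ y} (η : Expr f g)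
    (h : y ⟶ z) : descExpr E (.whiskerRight η h) ≍ descExpr E η ▷ descMap E h :=
  conj_heq _ _ _

theorem descExpr_left_heq {b b' : X} {f f' : b ⟶ b'} (φ : f ⟶ f') (c : BDelta) :
    descExpr E (.left φ c) ≍ (descLeft E).map₂ φ :=
  conj_heq _ _ _

theorem descExpr_right_heq (b : X) {c c' : BDelta} {g g' : c ⟶ c'} (ψ : g ⟶ g') :
    descExpr E (.right b ψ) ≍ (descRight E b).map₂ ψ :=
  conj_heq _ _ _

theorem descExpr_swap_heq {b b' : X} {c c' : BDelta} (f : b ⟶ b') (g : c ⟶ c') :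
    descExpr E (.swap f g) ≍ Mnd.powSwap (E.map f) (card g) :=
  conj_heq _ _ _

theorem descExpr_conj_heq {x y : GrayTensor X BDelta} {f f' g g' : x ⟶ y} (p : f = f')
    (η : Expr f' g') (q : g' = g) :
    descExpr E (.vcomp (.eq p) (.vcomp η (.eq q))) ≍ descExpr E η :=
  conj_heq _ _ _

theorem descExpr_left_whiskerLeft {b b' b'' : X} (f : b ⟶ b') {g h : b' ⟶ b''} (φ : g ⟶ h)
    (c : BDelta) : descExpr E (.left (f ◁ φ) c) =
      descExpr E (.vcomp (.eq (left_comp f g c)) (.vcomp (.whiskerLeft (left f c) (.left φ c))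
        (.eq (left_comp f h c).symm))) :=
  eq_of_heq <| (descExpr_left_heq E (f ◁ φ) c).trans <|
    ((descLeft E).map₂_whiskerLeft_heq f φ).trans <| HEq.symm <|
    (descExpr_conj_heq E _ _ _).trans <| (descExpr_whiskerLeft_heq E _ _).trans <|
    whiskerLeft_heq rfl rfl rfl (heq_of_eq (descMap_left E f c)) (heq_of_eq (descMap_left E g c))
      (heq_of_eq (descMap_left E h c)) (descExpr_left_heq E φ c)

theorem descExpr_left_whiskerRight {b b' b'' : X} {f g : b ⟶ b'} (φ : f ⟶ g) (h : b' ⟶ b'')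
    (c : BDelta) : descExpr E (.left (φ ▷ h) c) =
      descExpr E (.vcomp (.eq (left_comp f h c)) (.vcomp (.whiskerRight (.left φ c) (left h c))
        (.eq (left_comp g h c).symm))) :=
  eq_of_heq <| (descExpr_left_heq E (φ ▷ h) c).trans <|
    ((descLeft E).map₂_whiskerRight_heq φ h).trans <| HEq.symm <|
    (descExpr_conj_heq E _ _ _).trans <| (descExpr_whiskerRight_heq E _ _).trans <|
    whiskerRight_heq rfl rfl rfl (heq_of_eq (descMap_left E f c)) (heq_of_eq (descMap_left E g c))
      (heq_of_eq (descMap_left E h c)) (descExpr_left_heq E φ c)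

theorem descExpr_right_whiskerLeft (b : X) {c c' c'' : BDelta} (f : c ⟶ c') {g h : c' ⟶ c''}
    (ψ : g ⟶ h) : descExpr E (.right b (f ◁ ψ)) =
      descExpr E (.vcomp (.eq (right_comp b f g)) (.vcomp (.whiskerLeft (right b f) (.right b ψ))
        (.eq (right_comp b f h).symm))) :=
  eq_of_heq <| (descExpr_right_heq E b (f ◁ ψ)).trans <|
    ((descRight E b).map₂_whiskerLeft_heq f ψ).trans <| HEq.symm <|
    (descExpr_conj_heq E _ _ _).trans <| (descExpr_whiskerLeft_heq E _ _).trans <|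
    whiskerLeft_heq rfl rfl rfl (heq_of_eq (descMap_right E b f))
      (heq_of_eq (descMap_right E b g)) (heq_of_eq (descMap_right E b h))
      (descExpr_right_heq E b ψ)

theorem descExpr_right_whiskerRight (b : X) {c c' c'' : BDelta} {f g : c ⟶ c'} (ψ : f ⟶ g)
    (h : c' ⟶ c'') : descExpr E (.right b (ψ ▷ h)) =
      descExpr E (.vcomp (.eq (right_comp b f h)) (.vcomp (.whiskerRight (.right b ψ) (right b h))
        (.eq (right_comp b g h).symm))) :=
  eq_of_heq <| (descExpr_right_heq E b (ψ ▷ h)).trans <|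
    ((descRight E b).map₂_whiskerRight_heq ψ h).trans <| HEq.symm <|
    (descExpr_conj_heq E _ _ _).trans <| (descExpr_whiskerRight_heq E _ _).trans <|
    whiskerRight_heq rfl rfl rfl (heq_of_eq (descMap_right E b f))
      (heq_of_eq (descMap_right E b g)) (heq_of_eq (descMap_right E b h))
      (descExpr_right_heq E b ψ)

theorem descExpr_swap_id_left (b : X) {c c' : BDelta} (g : c ⟶ c')
    (p : right b g ≫ left (𝟙 b) c' = left (𝟙 b) c ≫ right b g) :
    descExpr E (.swap (𝟙 b) g) = descExpr E (.eq p) := by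
  refine eq_of_heq <| (descExpr_swap_heq E (𝟙 b) g).trans <|
    (Mnd.powSwap_heq (E.map_id b) rfl).trans <|
    (heq_of_eq (Mnd.powSwap_idHom (E.obj b) (card g))).trans ?_
  rw [Bicategory.Strict.rightUnitor_eqToIso, Bicategory.Strict.leftUnitor_eqToIso, eqToIso.hom,
    eqToIso.inv, eqToHom_trans]
  refine eqToHom_heq_eqToHom rfl rfl (HEq.symm (heq_of_eq ?_)) _ _
  rw [descMap_right_left, E.map_id]
  rfl

theorem descExpr_swap_id_right {b b' : X} (f : b ⟶ b') (c : BDelta)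
    (p : right b (𝟙 c) ≫ left f c = left f c ≫ right b' (𝟙 c)) :
    descExpr E (.swap f (𝟙 c)) = descExpr E (.eq p) := by
  refine eq_of_heq <| (descExpr_swap_heq E f (𝟙 c)).trans ?_
  change (λ_ (Mnd.Hom.f (E.map f))).hom ≫ (ρ_ (Mnd.Hom.f (E.map f))).inv ≍ _
  rw [Bicategory.Strict.rightUnitor_eqToIso, Bicategory.Strict.leftUnitor_eqToIso, eqToIso.hom,
    eqToIso.inv, eqToHom_trans]
  refine eqToHom_heq_eqToHom rfl rfl (HEq.symm (heq_of_eq ?_)) _ _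
  rw [descMap_right_left]
  rfl

theorem descExpr_swap_comp_left {b b' b'' : X} {c c' : BDelta} (f : b ⟶ b') (f' : b' ⟶ b'')
    (g : c ⟶ c') {p p'} :
    descExpr E (.swap (f ≫ f') g) =
      descExpr E (.vcomp (.eq p)
          (.vcomp (.whiskerRight (.swap f g) (left f' c'))
            (.vcomp (.eq (one_assoc _ _ _))
              (.vcomp (.whiskerLeft (left f c) (.swap f' g)) (.eq p'))))) := by
  refine eq_of_heq <| (descExpr_swap_heq E (f ≫ f') g).trans <|
    (Mnd.powSwap_heq (E.map_comp f f') rfl).trans <|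
    (heq_of_eq (Mnd.powSwap_compHom _ _ _)).trans ?_
  simp only [Bicategory.Strict.associator_eqToIso, eqToIso.hom, eqToIso.inv]
  refine chain_heq _ _ _ _ _ _ ?_ ?_ ?_ (HEq.symm ?_) (HEq.symm ?_)
  · rw [descMap_comp, descMap_right_left, descMap_left]
    rfl
  · rw [descMap_comp, descMap_left_right, descMap_left]
    rfl
  · rw [descMap_comp, descMap_left_right, descMap_left]
    rfl
  · exact (descExpr_whiskerRight_heq E _ _).trans (whiskerRight_heq rfl rfl rfl
      (heq_of_eq (descMap_right_left E f g)) (heq_of_eq (descMap_left_right E f g))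
      (heq_of_eq (descMap_left E f' c')) (descExpr_swap_heq E f g))
  · exact (descExpr_whiskerLeft_heq E _ _).trans (whiskerLeft_heq rfl rfl rfl
      (heq_of_eq (descMap_left E f c)) (heq_of_eq (descMap_right_left E f' g))
      (heq_of_eq (descMap_left_right E f' g)) (descExpr_swap_heq E f' g))

theorem powSwap_add_eq {S T : Mnd B} (F : Mnd.Hom S T) (m n : ℕ) :
    Mnd.powSwap F (m + n) = eqToHom (by rw [S.M.pow_add, Bicategory.Strict.assoc]) ≫
      S.M.pow m ◁ Mnd.powSwap F n ≫ eqToHom (Bicategory.Strict.assoc _ _ _).symm ≫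
        Mnd.powSwap F m ▷ T.M.pow n ≫
          eqToHom (by rw [T.M.pow_add, Bicategory.Strict.assoc]) := by
  have h := Mnd.powSwap_add F m n
  rw [MonadData.powAdd_hom, MonadData.powAdd_hom, whiskerLeft_eqToHom, eqToHom_whiskerRight,
    comp_eqToHom_iff] at h
  rw [h]
  simp [Bicategory.Strict.associator_eqToIso]

theorem descExpr_swap_comp_right {b b' : X} {c c' c'' : BDelta} (f : b ⟶ b') (g : c ⟶ c')
    (g' : c' ⟶ c'') {p p'} :
    descExpr E (.swap f (g ≫ g')) =
      descExpr E (.vcomp (.eq p)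
          (.vcomp (.whiskerLeft (right b g) (.swap f g'))
            (.vcomp (.eq (one_assoc _ _ _).symm)
              (.vcomp (.whiskerRight (.swap f g) (right b' g')) (.eq p'))))) := by
  refine eq_of_heq <| (descExpr_swap_heq E f (g ≫ g')).trans <|
    (Mnd.powSwap_heq rfl (BDelta.card_comp g g')).trans <|
    (heq_of_eq (powSwap_add_eq _ _ _)).trans ?_
  refine chain_heq _ _ _ _ _ _ ?_ ?_ ?_ (HEq.symm ?_) (HEq.symm ?_)
  · rw [descMap_comp, descMap_right_left, descMap_right]
    rfl
  · rw [descMap_comp, descMap_left_right, descMap_right]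
    rfl
  · rw [descMap_comp, descMap_left_right, descMap_right]
    rfl
  · exact (descExpr_whiskerLeft_heq E _ _).trans (whiskerLeft_heq rfl rfl rfl
      (heq_of_eq (descMap_right E b g)) (heq_of_eq (descMap_right_left E f g'))
      (heq_of_eq (descMap_left_right E f g')) (descExpr_swap_heq E f g'))
  · exact (descExpr_whiskerRight_heq E _ _).trans (whiskerRight_heq rfl rfl rfl
      (heq_of_eq (descMap_right_left E f g)) (heq_of_eq (descMap_left_right E f g))
      (heq_of_eq (descMap_right E b' g')) (descExpr_swap_heq E f g))

theorem descExpr_swap_naturality {b b' : X} {c c' : BDelta} {f f' : b ⟶ b'} (φ : f ⟶ f')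
    {g g' : c ⟶ c'} (ψ : g ⟶ g') :
    descExpr E (.vcomp (.vcomp (.whiskerRight (.right b ψ) (left f c'))
          (.whiskerLeft (right b g') (.left φ c'))) (.swap f' g')) =
      descExpr E (.vcomp (.swap f g) (.vcomp (.whiskerRight (.left φ c) (right b' g))
          (.whiskerLeft (left f' c) (.right b' ψ)))) := by
  have hL {f : b ⟶ b'} {c : BDelta} := heq_of_eq (descMap_left E f c)
  have hR {b : X} {g : c ⟶ c'} := heq_of_eq (descMap_right E b g)
  have hRL {f : b ⟶ b'} {g : c ⟶ c'} := heq_of_eq (descMap_right_left E f g)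
  have hLR {f : b ⟶ b'} {g : c ⟶ c'} := heq_of_eq (descMap_left_right E f g)
  -- Free of transports, the relation combines `powSwap_comm` for `φ`, `powSwap_naturality` for `ψ`
  -- and interchange.
  have key : ((E.obj b).M.powMap (toPath ψ) ▷ Mnd.Hom.f (E.map f) ≫
      (E.obj b).M.pow (card g') ◁ Mnd.Hom₂.val (E.map₂ φ)) ≫ Mnd.powSwap (E.map f') (card g') =
      Mnd.powSwap (E.map f) (card g) ≫ Mnd.Hom₂.val (E.map₂ φ) ▷ (E.obj b').M.pow (card g) ≫
        Mnd.Hom.f (E.map f') ◁ (E.obj b').M.powMap (toPath ψ) := by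
    rw [Category.assoc, ← Mnd.powSwap_comm, reassoc_of% (Mnd.powSwap_naturality (E.map f)),
      whisker_exchange]
  refine eq_of_heq (HEq.trans ?_ ((heq_of_eq key).trans (HEq.symm ?_)))
  · refine comp_heq rfl rfl hRL hRL hLR (comp_heq rfl rfl hRL hRL hRL ?_ ?_)
      (descExpr_swap_heq E f' g')
    · exact (descExpr_whiskerRight_heq E _ _).trans (whiskerRight_heq rfl rfl rfl hR hR hL
        (descExpr_right_heq E b ψ))
    · exact (descExpr_whiskerLeft_heq E _ _).trans (whiskerLeft_heq rfl rfl rfl hR hL hL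
        (descExpr_left_heq E φ c'))
  · refine comp_heq rfl rfl hRL hLR hLR (descExpr_swap_heq E f g)
      (comp_heq rfl rfl hLR hLR hLR ?_ ?_)
    · exact (descExpr_whiskerRight_heq E _ _).trans (whiskerRight_heq rfl rfl rfl hL hL hR
        (descExpr_left_heq E φ c))
    · exact (descExpr_whiskerLeft_heq E _ _).trans (whiskerLeft_heq rfl rfl rfl hL hR hR
        (descExpr_right_heq E b' ψ))

/-- The relations of a strict 2-category hold because `B` is one, those on each of the two families
because `descLeft` and `descRight` are strict 2-functors, and those on `γ` by the properties of
`Mnd.powSwap`. -/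
theorem descExpr_sound {x y : GrayTensor X BDelta} {f g : x ⟶ y} {η θ : Expr f g}
    (h : TwoRel η θ) : descExpr E η = descExpr E θ := by
  induction h with
  | vcomp_left θ h ih => simp only [descExpr, ih]
  | vcomp_right η h ih => simp only [descExpr, ih]
  | whiskerLeft f h ih => simp only [descExpr, ih]
  | whiskerRight k h ih => simp only [descExpr, ih]
  | eq_eq p q => simp [descExpr]
  | id_vcomp η => simp [descExpr]
  | vcomp_id η => simp [descExpr]
  | assoc η θ ι => simp [descExpr]
  | whiskerLeft_eq f p => simp [descExpr]
  | whiskerLeft_vcomp f η θ => simp [descExpr]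
  | whiskerRight_eq p h => simp [descExpr]
  | whiskerRight_vcomp η θ k => simp [descExpr]
  | id_whiskerLeft η =>
    simp [descExpr, whiskerLeft_of_eq (descMap_id E _), Bicategory.Strict.leftUnitor_eqToIso]
  | comp_whiskerLeft f g η =>
    simp [descExpr, whiskerLeft_of_eq (descMap_comp E f g), Bicategory.Strict.associator_eqToIso]
  | whiskerRight_id η =>
    simp [descExpr, whiskerRight_of_eq _ (descMap_id E _), Bicategory.Strict.rightUnitor_eqToIso]
  | whiskerRight_comp η g h =>
    simp [descExpr, whiskerRight_of_eq _ (descMap_comp E g h), Bicategory.Strict.associator_eqToIso]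
  | whisker_assoc f η h => simp [descExpr, Bicategory.Strict.associator_eqToIso]
  | whisker_exchange η θ =>
    simp [descExpr, whisker_exchange_assoc]
  | left_id f c =>
    refine eq_of_heq ((descExpr_left_heq E (𝟙 f) c).trans ?_)
    rw [PrelaxFunctor.map₂_id]
    exact eqToHom_heq_eqToHom rfl rfl (heq_of_eq (descMap_left E f c).symm) rfl rfl
  | left_vcomp φ φ' c =>
    refine eq_of_heq ((descExpr_left_heq E (φ ≫ φ') c).trans ?_)
    rw [PrelaxFunctor.map₂_comp]
    exact (comp_heq rfl rfl (heq_of_eq (descMap_left E _ c)) (heq_of_eq (descMap_left E _ c))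
      (heq_of_eq (descMap_left E _ c)) (descExpr_left_heq E φ c) (descExpr_left_heq E φ' c)).symm
  | left_whiskerLeft f φ c => exact descExpr_left_whiskerLeft E f φ c
  | left_whiskerRight φ h c => exact descExpr_left_whiskerRight E φ h c
  | right_id b g =>
    refine eq_of_heq ((descExpr_right_heq E b (𝟙 g)).trans ?_)
    rw [PrelaxFunctor.map₂_id]
    exact eqToHom_heq_eqToHom rfl rfl (heq_of_eq (descMap_right E b g).symm) rfl rfl
  | right_vcomp b ψ ψ' =>
    refine eq_of_heq ((descExpr_right_heq E b (ψ ≫ ψ')).trans ?_)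
    rw [PrelaxFunctor.map₂_comp]
    exact (comp_heq rfl rfl (heq_of_eq (descMap_right E b _)) (heq_of_eq (descMap_right E b _))
      (heq_of_eq (descMap_right E b _)) (descExpr_right_heq E b ψ)
      (descExpr_right_heq E b ψ')).symm
  | right_whiskerLeft b f ψ => exact descExpr_right_whiskerLeft E b f ψ
  | right_whiskerRight b ψ h => exact descExpr_right_whiskerRight E b ψ h
  | swap_id_left b g => exact descExpr_swap_id_left E b g _
  | swap_id_right f c => exact descExpr_swap_id_right E f c _
  | swap_comp_left f f' g => exact descExpr_swap_comp_left E f f' g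
  | swap_comp_right f g g' => exact descExpr_swap_comp_right E f g g'
  | swap_naturality φ ψ => exact descExpr_swap_naturality E φ ψ

/-- The strict 2-functor `X ⊗ₗ 𝔹Δ₊ → B` that corresponds to a strict 2-functor from `X` to the
2-category of monads in `B`. -/
noncomputable def ofMnd : StrictPseudofunctor (GrayTensor X BDelta) B :=
  StrictPseudofunctor.mk''
    { obj := fun x => (E.obj x.as.1).a
      map := fun f => descMap E f
      map₂ := Quot.lift (descExpr E) (fun _ _ h => descExpr_sound E h)
      map₂_id := fun _ => rfl
      map₂_comp := by
        rintro _ _ _ _ _ ⟨η⟩ ⟨θ⟩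
        rfl
      map_id := fun x => descMap_id E x
      map_comp := fun f g => descMap_comp E f g
      map₂_whisker_left := by
        rintro _ _ _ f _ _ ⟨η⟩
        rfl
      map₂_whisker_right := by
        rintro _ _ _ _ _ ⟨η⟩ h
        rfl }

end GrayTensor

/-! ### From 2-functors on the tensor product to 2-functors into `Mnd B` -/

theorem MonadData.map_map {B : Type u₁} [Bicategory.{w₁, v₁} B] {C : Type u₂}
    [Bicategory.{w₂, v₂} C] {E : Type u} [Bicategory.{w, v} E] [Bicategory.Strict B]
    [Bicategory.Strict C] [Bicategory.Strict E]
    (F : StrictPseudofunctor B C) (G : StrictPseudofunctor C E) {a : B} (M : MonadData a) :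
    (M.map F).map G = M.map (F.comp G) := by
  refine MonadData.ext_of_heq rfl ?_ ?_
  · refine (MonadData.map_η_heq G (M.map F)).symm.trans (HEq.trans ?_ (MonadData.map_η_heq _ M))
    simp only [MonadData.map, F.mapId_eq_eqToIso, eqToIso.inv, PrelaxFunctor.map₂_comp,
      StrictPseudofunctor.map₂_eqToHom]
    exact eqToHom_comp_heq _ _
  · refine (MonadData.map_μ_heq G (M.map F)).symm.trans (HEq.trans ?_ (MonadData.map_μ_heq _ M))
    simp only [MonadData.map, F.mapComp_eq_eqToIso, eqToIso.inv, PrelaxFunctor.map₂_comp,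
      StrictPseudofunctor.map₂_eqToHom]
    exact eqToHom_comp_heq _ _

namespace CategoryTheory.Bicategory

theorem chain_comp_heq {B : Type u} [Bicategory.{w, v} B] {a b : B}
    {f₀ f₁ f₂ f₃ f₄ f₅ f₆ g₀ g₁ g₂ g₃ g₄ g₅ g₆ : a ⟶ b}
    (p : f₀ = f₁) {η : f₁ ⟶ f₂} (q : f₂ = f₃) {θ : f₃ ⟶ f₄} (r : f₄ = f₅) {ι : f₅ ⟶ f₆}
    (p' : g₀ = g₁) {η' : g₁ ⟶ g₂} (q' : g₂ = g₃) {θ' : g₃ ⟶ g₄} (r' : g₄ = g₅) {ι' : g₅ ⟶ g₆}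
    (h₁ : f₁ = g₁) (h₂ : f₂ = g₂) (h₄ : f₄ = g₄) (h₆ : f₆ = g₆) (hη : η ≍ η') (hθ : θ ≍ θ')
    (hι : ι ≍ ι') :
    eqToHom p ≫ η ≫ eqToHom q ≫ θ ≫ eqToHom r ≫ ι ≍
      (eqToHom p' ≫ η' ≫ eqToHom q' ≫ θ' ≫ eqToHom r') ≫ ι' := by
  subst p q r p' q' r' h₁ h₂ h₄ h₆
  cases hη
  cases hθ
  cases hι
  simp

end CategoryTheory.Bicategory

namespace Mnd

variable {B : Type u} [Bicategory.{w, v} B]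

theorem Hom.ext_of_heq {S T : Mnd B} {F G : Hom S T} (hf : F.f = G.f) (hσ : F.σ ≍ G.σ) :
    F = G := by
  obtain ⟨f, σ, _, _⟩ := F
  obtain ⟨g, τ, _, _⟩ := G
  dsimp only at hf
  subst hf
  cases hσ
  rfl

end Mnd

namespace GrayTensor

section

variable {B : Type u₁} [Bicategory.{w₁, v₁} B] {C : Type u₂} [Bicategory.{w₂, v₂} C]

theorem swap_id_left (b : B) {c c' : C} (g : c ⟶ c') :
    swap (𝟙 b) g = eqToHom (by rw [left_id, left_id, one_comp_id, one_id_comp]) := by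
  rw [← cell_eq]
  exact cell_sound (TwoRel.swap_id_left b g)

theorem swap_id_right {b b' : B} (f : b ⟶ b') (c : C) :
    swap f (𝟙 c) = eqToHom (by rw [right_id, right_id, one_comp_id, one_id_comp]) := by
  rw [← cell_eq]
  exact cell_sound (TwoRel.swap_id_right f c)

theorem swap_comp_left {b b' b'' : B} {c c' : C} (f : b ⟶ b') (f' : b' ⟶ b'') (g : c ⟶ c') :
    swap (f ≫ f') g = eqToHom (by rw [left_comp, one_assoc]) ≫ swap f g ▷ left f' c' ≫
      eqToHom (one_assoc _ _ _) ≫ left f c ◁ swap f' g ≫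
        eqToHom (by rw [left_comp, one_assoc]) := by
  simp only [← cell_eq]
  exact cell_sound (TwoRel.swap_comp_left f f' g)

theorem swap_comp_right {b b' : B} {c c' c'' : C} (f : b ⟶ b') (g : c ⟶ c') (g' : c' ⟶ c'') :
    swap f (g ≫ g') = eqToHom (by rw [right_comp, one_assoc]) ≫ right b g ◁ swap f g' ≫
      eqToHom (one_assoc _ _ _).symm ≫ swap f g ▷ right b' g' ≫
        eqToHom (by rw [right_comp, one_assoc]) := by
  simp only [← cell_eq]
  exact cell_sound (TwoRel.swap_comp_right f g g')

theorem cell_left_id {b b' : B} (f : b ⟶ b') (c : C) : cell (.left (𝟙 f) c) = 𝟙 (left f c) :=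
  cell_sound (TwoRel.left_id f c)

theorem cell_right_id (b : B) {c c' : C} (g : c ⟶ c') : cell (.right b (𝟙 g)) = 𝟙 (right b g) :=
  cell_sound (TwoRel.right_id b g)

theorem swap_naturality {b b' : B} {c c' : C} {f f' : b ⟶ b'} (φ : f ⟶ f') {g g' : c ⟶ c'}
    (ψ : g ⟶ g') :
    (cell (.right b ψ) ▷ left f c' ≫ right b g' ◁ cell (.left φ c')) ≫ swap f' g' =
      swap f g ≫ cell (.left φ c) ▷ right b' g ≫ left f' c ◁ cell (.right b' ψ) :=
  cell_sound (TwoRel.swap_naturality φ ψ)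

theorem swap_naturality_left {b b' : B} {c c' : C} {f f' : b ⟶ b'} (φ : f ⟶ f') (g : c ⟶ c') :
    right b g ◁ cell (.left φ c') ≫ swap f' g = swap f g ≫ cell (.left φ c) ▷ right b' g := by
  simpa only [cell_right_id, id_whiskerRight, whiskerLeft_id, Category.id_comp,
    Category.comp_id] using swap_naturality φ (𝟙 g)

theorem swap_naturality_right {b b' : B} {c c' : C} (f : b ⟶ b') {g g' : c ⟶ c'} (ψ : g ⟶ g') :
    cell (.right b ψ) ▷ left f c' ≫ swap f g' = swap f g ≫ left f c ◁ cell (.right b' ψ) := by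
  simpa only [cell_left_id, id_whiskerRight, whiskerLeft_id, Category.id_comp,
    Category.comp_id] using swap_naturality (𝟙 f) ψ

end

variable {X : Type u₁} [Bicategory.{w₁, v₁} X] {B : Type u} [Bicategory.{w, v} B]
  (D : StrictPseudofunctor (GrayTensor X BDelta) B)

theorem map_comp_heq {x y z : GrayTensor X BDelta} {f : x ⟶ y} {g : y ⟶ z} :
    D.map f ≫ D.map g ≍ D.map (f ≫ g) :=
  heq_of_eq (D.map_comp f g).symm

variable [Bicategory.Strict B]

/-- The values on 0-cells of the strict 2-functor from `X` to the 2-category of monads in `B`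
that corresponds to `D`. -/
def mndObj (x : X) : Mnd B where
  a := D.obj (pt x BDelta.pt)
  M := (BDelta.univ.map (inr x)).map D
  isMonad := (BDelta.isMonad_univ.map (inr x)).map D

theorem mndObj_η_heq (x : X) : (mndObj D x).M.η ≍ D.map₂ (cell (.right x BDelta.unit)) := by
  change ((BDelta.univ.map (inr x)).map D).η ≍ _
  rw [MonadData.map_map]
  exact (MonadData.map_η_heq ((inr x).comp D) BDelta.univ).symm

theorem mndObj_μ_heq (x : X) : (mndObj D x).M.μ ≍ D.map₂ (cell (.right x BDelta.mult)) := by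
  change ((BDelta.univ.map (inr x)).map D).μ ≍ _
  rw [MonadData.map_map]
  exact (MonadData.map_μ_heq ((inr x).comp D) BDelta.univ).symm

/-- The image of the 1-cell `(f, Id)`. -/
def mndLeft {x y : X} (f : x ⟶ y) : (mndObj D x).a ⟶ (mndObj D y).a :=
  D.map (left f BDelta.pt)

/-- The image of the interchange cell `γ_{f, [0]}`. -/
def mndSwap {x y : X} (f : x ⟶ y) :
    (mndObj D x).M.t ≫ mndLeft D f ⟶ mndLeft D f ≫ (mndObj D y).M.t :=
  (D.mapComp (right x BDelta.t) (left f BDelta.pt)).inv ≫ D.map₂ (swap f BDelta.t) ≫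
    (D.mapComp (left f BDelta.pt) (right y BDelta.t)).hom

theorem mndSwap_heq {x y : X} (f : x ⟶ y) : mndSwap D f ≍ D.map₂ (swap f BDelta.t) := by
  simp only [mndSwap, D.mapComp_eq_eqToIso, eqToIso.inv, eqToIso.hom]
  exact conj_heq _ _ _

theorem map_right_id_heq (x : X) : 𝟙 (mndObj D x).a ≍ D.map (right x (𝟙 BDelta.pt)) :=
  heq_of_eq (((inr x).comp D).map_id BDelta.pt).symm

theorem map_right_comp_heq (x : X) :
    (mndObj D x).M.t ≫ (mndObj D x).M.t ≍ D.map (right x (BDelta.t ≫ BDelta.t)) :=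
  heq_of_eq (((inr x).comp D).map_comp BDelta.t BDelta.t).symm

/-- Naturality of `γ` at `η : Id → [0]`, where `γ_{f,Id}` is an identity. -/
theorem mndSwap_unit {x y : X} (f : x ⟶ y) :
    (mndObj D x).M.η ▷ mndLeft D f ≫ mndSwap D f =
      (λ_ (mndLeft D f)).hom ≫ (ρ_ (mndLeft D f)).inv ≫
        mndLeft D f ◁ (mndObj D y).M.η := by
  have h := congrArg D.map₂ (swap_naturality_right f BDelta.unit)
  rw [PrelaxFunctor.map₂_comp, PrelaxFunctor.map₂_comp, swap_id_right,
    StrictPseudofunctor.map₂_eqToHom] at h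
  rw [← Category.assoc (λ_ (mndLeft D f)).hom, Bicategory.Strict.rightUnitor_eqToIso,
    Bicategory.Strict.leftUnitor_eqToIso, eqToIso.hom, eqToIso.inv, eqToHom_trans]
  have h₁ : 𝟙 (mndObj D x).a ≫ mndLeft D f ≍
      D.map (right x (𝟙 BDelta.pt) ≫ left f BDelta.pt) :=
    (one_comp_heq rfl rfl rfl (map_right_id_heq D x) HEq.rfl).trans (map_comp_heq D)
  have h₂ : mndLeft D f ≫ 𝟙 (mndObj D y).a ≍
      D.map (left f BDelta.pt ≫ right y (𝟙 BDelta.pt)) :=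
    (one_comp_heq rfl rfl rfl HEq.rfl (map_right_id_heq D y)).trans (map_comp_heq D)
  refine eq_of_heq (HEq.trans ?_ ((heq_of_eq h).trans (HEq.symm ?_)))
  · refine comp_heq rfl rfl h₁ (map_comp_heq D) (map_comp_heq D) ?_ (mndSwap_heq D f)
    exact (whiskerRight_heq rfl rfl rfl (map_right_id_heq D x) HEq.rfl HEq.rfl
      (mndObj_η_heq D x)).trans (D.map₂_whiskerRight_heq _ _).symm
  · refine comp_heq rfl rfl h₁ h₂ (map_comp_heq D) (eqToHom_heq_eqToHom rfl rfl h₁ _ _) ?_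
    exact (whiskerLeft_heq rfl rfl rfl HEq.rfl (map_right_id_heq D y) HEq.rfl
      (mndObj_η_heq D y)).trans (D.map₂_whiskerLeft_heq _ _).symm

/-- Naturality of `γ` at `μ : [0]·[0] → [0]`, where `γ_{f,[0]·[0]}` is expanded into two copies of
`γ_{f,[0]}`. -/
theorem mndSwap_mul {x y : X} (f : x ⟶ y) :
    (mndObj D x).M.μ ▷ mndLeft D f ≫ mndSwap D f =
      (α_ (mndObj D x).M.t (mndObj D x).M.t (mndLeft D f)).hom ≫
        (mndObj D x).M.t ◁ mndSwap D f ≫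
          (α_ (mndObj D x).M.t (mndLeft D f) (mndObj D y).M.t).inv ≫
            mndSwap D f ▷ (mndObj D y).M.t ≫
              (α_ (mndLeft D f) (mndObj D y).M.t (mndObj D y).M.t).hom ≫
                mndLeft D f ◁ (mndObj D y).M.μ := by
  have h := congrArg D.map₂ (swap_naturality_right f BDelta.mult)
  rw [PrelaxFunctor.map₂_comp, PrelaxFunctor.map₂_comp, swap_comp_right] at h
  simp only [PrelaxFunctor.map₂_comp, StrictPseudofunctor.map₂_eqToHom] at h
  have h₁ : ((mndObj D x).M.t ≫ (mndObj D x).M.t) ≫ mndLeft D f ≍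
      D.map (right x (BDelta.t ≫ BDelta.t) ≫ left f BDelta.pt) :=
    (one_comp_heq rfl rfl rfl (map_right_comp_heq D x) HEq.rfl).trans (map_comp_heq D)
  have h₂ : mndLeft D f ≫ (mndObj D y).M.t ≫ (mndObj D y).M.t ≍
      D.map (left f BDelta.pt ≫ right y (BDelta.t ≫ BDelta.t)) :=
    (one_comp_heq rfl rfl rfl HEq.rfl (map_right_comp_heq D y)).trans (map_comp_heq D)
  rw [Bicategory.Strict.associator_eqToIso, Bicategory.Strict.associator_eqToIso,
    Bicategory.Strict.associator_eqToIso, eqToIso.hom, eqToIso.inv, eqToIso.hom]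
  refine eq_of_heq (HEq.trans ?_ ((heq_of_eq h).trans (HEq.symm
    (chain_comp_heq _ _ _ _ _ _ ?_ ?_ ?_ ?_ ?_ ?_ ?_))))
  · refine comp_heq rfl rfl h₁ (map_comp_heq D) (map_comp_heq D) ?_ (mndSwap_heq D f)
    exact (whiskerRight_heq rfl rfl rfl (map_right_comp_heq D x) HEq.rfl HEq.rfl
      (mndObj_μ_heq D x)).trans (D.map₂_whiskerRight_heq _ _).symm
  · simp only [StrictPseudofunctor.map_comp]
    rfl
  · simp only [StrictPseudofunctor.map_comp]
    rfl
  · simp only [StrictPseudofunctor.map_comp]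
    rfl
  · exact D.map_comp _ _ |>.symm
  · exact (whiskerLeft_heq rfl rfl rfl HEq.rfl (map_comp_heq D) (map_comp_heq D)
      (mndSwap_heq D f)).trans (D.map₂_whiskerLeft_heq _ _).symm
  · exact (whiskerRight_heq rfl rfl rfl (map_comp_heq D) (map_comp_heq D) HEq.rfl
      (mndSwap_heq D f)).trans (D.map₂_whiskerRight_heq _ _).symm
  · exact (whiskerLeft_heq rfl rfl rfl HEq.rfl (map_right_comp_heq D y) HEq.rfl
      (mndObj_μ_heq D y)).trans (D.map₂_whiskerLeft_heq _ _).symm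

/-- The values on 1-cells. -/
def mndMap {x y : X} (f : x ⟶ y) : Mnd.Hom (mndObj D x) (mndObj D y) where
  f := mndLeft D f
  σ := mndSwap D f
  unit := mndSwap_unit D f
  mul := mndSwap_mul D f

/-- The values on 2-cells. -/
def mndMap₂ {x y : X} {f g : x ⟶ y} (φ : f ⟶ g) : Mnd.Hom₂ (mndMap D f) (mndMap D g) where
  val := D.map₂ (cell (.left φ BDelta.pt))
  comm := by
    have h := congrArg D.map₂ (swap_naturality_left φ BDelta.t)
    rw [PrelaxFunctor.map₂_comp, PrelaxFunctor.map₂_comp] at h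
    refine eq_of_heq (HEq.trans ?_ ((heq_of_eq h.symm).trans (HEq.symm ?_)))
    · exact comp_heq rfl rfl (map_comp_heq D) (map_comp_heq D) (map_comp_heq D)
        (mndSwap_heq D f) (D.map₂_whiskerRight_heq _ _).symm
    · exact comp_heq rfl rfl (map_comp_heq D) (map_comp_heq D) (map_comp_heq D)
        (D.map₂_whiskerLeft_heq _ _).symm (mndSwap_heq D g)

variable [Bicategory.Strict X]

theorem mndMap_id (x : X) : mndMap D (𝟙 x) = Mnd.idHom (mndObj D x) := by
  refine Mnd.Hom.ext_of_heq (((inl BDelta.pt).comp D).map_id x) ((mndSwap_heq D (𝟙 x)).trans ?_)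
  dsimp only [Mnd.idHom]
  rw [Bicategory.Strict.rightUnitor_eqToIso, Bicategory.Strict.leftUnitor_eqToIso, eqToIso.hom,
    eqToIso.inv, eqToHom_trans, swap_id_left, StrictPseudofunctor.map₂_eqToHom]
  refine eqToHom_heq_eqToHom rfl rfl (heq_of_eq ?_) _ _
  rw [D.map_comp]
  exact congrArg (fun k => (mndObj D x).M.t ≫ k) (((inl BDelta.pt).comp D).map_id x)

theorem mndMap_comp {x y z : X} (f : x ⟶ y) (g : y ⟶ z) :
    mndMap D (f ≫ g) = Mnd.compHom (mndMap D f) (mndMap D g) := by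
  have hc := ((inl BDelta.pt).comp D).map_comp f g
  refine Mnd.Hom.ext_of_heq hc ((mndSwap_heq D (f ≫ g)).trans ?_)
  rw [swap_comp_left]
  simp only [PrelaxFunctor.map₂_comp, StrictPseudofunctor.map₂_eqToHom]
  dsimp only [Mnd.compHom]
  simp only [Bicategory.Strict.associator_eqToIso, eqToIso.hom, eqToIso.inv]
  refine chain_heq _ _ _ _ _ _ ?_ ?_ ?_ (HEq.symm ?_) (HEq.symm ?_)
  · simp only [StrictPseudofunctor.map_comp]
    rfl
  · simp only [StrictPseudofunctor.map_comp]
    rfl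
  · simp only [StrictPseudofunctor.map_comp]
    rfl
  · exact (whiskerRight_heq rfl rfl rfl (map_comp_heq D) (map_comp_heq D) HEq.rfl
      (mndSwap_heq D f)).trans (D.map₂_whiskerRight_heq _ _).symm
  · exact (whiskerLeft_heq rfl rfl rfl HEq.rfl (map_comp_heq D) (map_comp_heq D)
      (mndSwap_heq D g)).trans (D.map₂_whiskerLeft_heq _ _).symm

/-- The strict 2-functor from `X` to the 2-category of monads in `B` that corresponds to `D`. -/
def toMnd : StrictPseudofunctor X (Mnd B) :=
  StrictPseudofunctor.mk''
    { obj := fun x => mndObj D x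
      map := fun f => mndMap D f
      map₂ := fun φ => mndMap₂ D φ
      map₂_id := fun f => Mnd.hom₂_ext (((inl BDelta.pt).comp D).map₂_id f)
      map₂_comp := fun φ ψ => Mnd.hom₂_ext (((inl BDelta.pt).comp D).map₂_comp φ ψ)
      map_id := fun x => mndMap_id D x
      map_comp := fun f g => mndMap_comp D f g
      map₂_whisker_left := fun f _ _ φ => Mnd.hom₂_ext <| by
        refine (((inl BDelta.pt).comp D).map₂_whiskerLeft f φ).trans ?_
        rw [Mnd.comp_val, Mnd.comp_val, Mnd.eqToHom_val, Mnd.eqToHom_val]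
        rfl
      map₂_whisker_right := fun φ h => Mnd.hom₂_ext <| by
        refine (((inl BDelta.pt).comp D).map₂_whiskerRight φ h).trans ?_
        rw [Mnd.comp_val, Mnd.comp_val, Mnd.eqToHom_val, Mnd.eqToHom_val]
        rfl }

end GrayTensor

/-! ### The two passages are mutually inverse -/

namespace Mnd

variable {B : Type u} [Bicategory.{w, v} B]

theorem mk_eq_mk {a : B} {M M' : MonadData a} (h : M = M') (hM : M.IsMonad) (hM' : M'.IsMonad) :
    (⟨a, M, hM⟩ : Mnd B) = ⟨a, M', hM'⟩ := by
  subst h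
  rfl

theorem Hom.heq {S T S' T' : Mnd B} (hS : S = S') (hT : T = T') {F : Hom S T} {F' : Hom S' T'}
    (hf : F.f ≍ F'.f) (hσ : F.σ ≍ F'.σ) : F ≍ F' := by
  subst hS hT
  exact heq_of_eq (Hom.ext_of_heq (eq_of_heq hf) hσ)

theorem Hom₂.heq {S T S' T' : Mnd B} (hS : S = S') (hT : T = T') {F G : Hom S T}
    {F' G' : Hom S' T'} (hF : F ≍ F') (hG : G ≍ G') {φ : Hom₂ F G} {φ' : Hom₂ F' G'}
    (h : φ.val ≍ φ'.val) : φ ≍ φ' := by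
  subst hS hT
  cases hF
  cases hG
  exact heq_of_eq (Hom₂.ext (eq_of_heq h))

theorem powSwap_one_heq [Bicategory.Strict B] {S T : Mnd B} (F : Hom S T) :
    powSwap F 1 ≍ F.σ := by
  simp only [powSwap, Bicategory.Strict.associator_eqToIso, Bicategory.Strict.leftUnitor_eqToIso,
    Bicategory.Strict.rightUnitor_eqToIso, eqToIso.hom, eqToIso.inv, eqToHom_trans,
    eqToHom_whiskerRight, id_whiskerLeft, Category.assoc, eqToHom_trans_assoc]
  exact conj_heq _ _ _

end Mnd

namespace CategoryTheory.StrictPseudofunctor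

variable {B : Type u₁} [Bicategory.{w₁, v₁} B] {C : Type u₂} [Bicategory.{w₂, v₂} C]
  {F G : StrictPseudofunctor B C}

theorem map_heq_of_eq (h : F = G) {x y : B} (f : x ⟶ y) : F.map f ≍ G.map f := by
  rw [h]

theorem map₂_heq_of_eq (h : F = G) {x y : B} {f g : x ⟶ y} (η : f ⟶ g) :
    F.map₂ η ≍ G.map₂ η := by
  rw [h]

theorem _root_.MonadData.map_heq_of_eq (h : F = G) {a : B} (M : MonadData a) :
    M.map F ≍ M.map G := by
  rw [h]

end CategoryTheory.StrictPseudofunctor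

namespace GrayTensor

open AugmentedSimplexCategory

variable {X : Type u₁} [Bicategory.{w₁, v₁} X]
  {B : Type u} [Bicategory.{w, v} B] [Bicategory.Strict B]

section

variable (E : StrictPseudofunctor X (Mnd B))

theorem inr_comp_ofMnd (x : X) : (inr x).comp (ofMnd E) = BDelta.lift (E.obj x) :=
  StrictPseudofunctor.ext_of_heq (fun _ => rfl) (fun g => heq_of_eq (descMap_right E x g))
    (fun ψ => descExpr_right_heq E x ψ)

theorem mndObj_ofMnd (x : X) : mndObj (ofMnd E) x = E.obj x :=
  Mnd.mk_eq_mk ((MonadData.map_map (inr x) (ofMnd E) BDelta.univ).trans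
      ((eq_of_heq (MonadData.map_heq_of_eq (inr_comp_ofMnd E x) BDelta.univ)).trans
        (BDelta.map_univ_lift (E.obj x))))
    (mndObj (ofMnd E) x).isMonad (E.obj x).isMonad

theorem mndMap_ofMnd {x y : X} (f : x ⟶ y) : mndMap (ofMnd E) f ≍ E.map f :=
  Mnd.Hom.heq (mndObj_ofMnd E x) (mndObj_ofMnd E y) (heq_of_eq (descMap_left E f BDelta.pt))
    ((mndSwap_heq _ f).trans ((descExpr_swap_heq E f BDelta.t).trans (Mnd.powSwap_one_heq _)))

variable [Bicategory.Strict X]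

theorem toMnd_ofMnd : toMnd (ofMnd E) = E :=
  StrictPseudofunctor.ext_of_heq (mndObj_ofMnd E) (mndMap_ofMnd E) (fun {x y f g} φ =>
    Mnd.Hom₂.heq (mndObj_ofMnd E x) (mndObj_ofMnd E y) (mndMap_ofMnd E f) (mndMap_ofMnd E g)
      (descExpr_left_heq E φ BDelta.pt))

end

section

variable (D : StrictPseudofunctor (GrayTensor X BDelta) B)

theorem lift_mndObj (x : X) : BDelta.lift (mndObj D x) = (inr x).comp D := by
  have h : mndObj D x = BDelta.toMnd ((inr x).comp D) :=
    Mnd.mk_eq_mk (MonadData.map_map (inr x) D BDelta.univ) (mndObj D x).isMonad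
      (BDelta.toMnd ((inr x).comp D)).isMonad
  rw [h]
  exact BDelta.lift_toMnd _

theorem mndObj_pow (x : X) {c c' : BDelta} (g : c ⟶ c') :
    (mndObj D x).M.pow (card g) = D.map (right x g) :=
  eq_of_heq (StrictPseudofunctor.map_heq_of_eq (lift_mndObj D x) g)

/-- The relation for `γ_{f,g'·g}` leaves no freedom beyond `γ_{f,[0]}`: peel copies of `[0]` off the
ordinal, starting from `γ_{f,Id}`, which is an identity. -/
theorem powSwap_toMnd {x y : X} (f : x ⟶ y) (g : BDelta.pt ⟶ BDelta.pt) :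
    Mnd.powSwap (mndMap D f) (card g) ≍ D.map₂ (swap f g) := by
  induction g using BDelta.induction_one with
  | h₀ =>
    rw [swap_id_right, StrictPseudofunctor.map₂_eqToHom]
    change (λ_ (mndLeft D f)).hom ≫ (ρ_ (mndLeft D f)).inv ≍ _
    rw [Bicategory.Strict.rightUnitor_eqToIso, Bicategory.Strict.leftUnitor_eqToIso, eqToIso.hom,
      eqToIso.inv, eqToHom_trans]
    exact eqToHom_heq_eqToHom rfl rfl
      ((one_comp_heq rfl rfl rfl (map_right_id_heq D x) HEq.rfl).trans (map_comp_heq D)) _ _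
  | h₁ g ih =>
    rw [swap_comp_right]
    simp only [PrelaxFunctor.map₂_comp, StrictPseudofunctor.map₂_eqToHom]
    have hg (x : X) := heq_of_eq (mndObj_pow D x g)
    refine (Mnd.powSwap_heq rfl (BDelta.card_comp g BDelta.t)).trans ?_
    change Mnd.powSwap (mndMap D f) (card g + 1) ≍ _
    simp only [Mnd.powSwap, Bicategory.Strict.associator_eqToIso, eqToIso.hom, eqToIso.inv]
    refine chain_heq _ _ _ _ _ _ ?_ ?_ ?_ ?_ ?_
    · simp only [StrictPseudofunctor.map_comp, mndObj_pow]
      rfl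
    · simp only [StrictPseudofunctor.map_comp, mndObj_pow]
      rfl
    · simp only [StrictPseudofunctor.map_comp, mndObj_pow]
      rfl
    · exact (whiskerLeft_heq rfl rfl rfl (hg x) (map_comp_heq D) (map_comp_heq D)
        (mndSwap_heq D f)).trans (D.map₂_whiskerLeft_heq _ _).symm
    · exact (whiskerRight_heq rfl rfl rfl
        ((one_comp_heq rfl rfl rfl (hg x) HEq.rfl).trans (map_comp_heq D))
        ((one_comp_heq rfl rfl rfl HEq.rfl (hg y)).trans (map_comp_heq D)) HEq.rfl
        ih).trans (D.map₂_whiskerRight_heq _ _).symm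

variable [Bicategory.Strict X]

theorem descMap_toMnd_single {p q : Pair X BDelta} (e : Gen X BDelta p q) :
    descMap (toMnd D) ((CategoryTheory.Quotient.functor (OneRel X BDelta)).map
        (single X BDelta e)) =
      D.map ((CategoryTheory.Quotient.functor (OneRel X BDelta)).map (single X BDelta e)) := by
  cases e with
  | left f c => exact descMap_left (toMnd D) f c
  | right x g => exact (descMap_right (toMnd D) x g).trans (mndObj_pow D x g)

theorem descMap_toMnd_path {p q : Pair X BDelta} (s : Quiver.Path p q) :
    descMap (toMnd D) ((CategoryTheory.Quotient.functor (OneRel X BDelta)).map s) =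
      D.map ((CategoryTheory.Quotient.functor (OneRel X BDelta)).map s) := by
  induction s with
  | nil => exact (descMap_id (toMnd D) _).trans (D.map_id _).symm
  | cons s e ih =>
    refine (descMap_comp (toMnd D) ((CategoryTheory.Quotient.functor (OneRel X BDelta)).map s)
      ((CategoryTheory.Quotient.functor (OneRel X BDelta)).map (single X BDelta e))).trans
      (Eq.trans ?_ (D.map_comp ((CategoryTheory.Quotient.functor (OneRel X BDelta)).map s)
      ((CategoryTheory.Quotient.functor (OneRel X BDelta)).map (single X BDelta e))).symm)
    exact congrArg₂ (fun a b => a ≫ b) ih (descMap_toMnd_single D e)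

theorem descMap_toMnd {x y : GrayTensor X BDelta} (f : x ⟶ y) :
    descMap (toMnd D) f = D.map f := by
  obtain ⟨p⟩ := f
  exact descMap_toMnd_path D p

/-- Both sides respect the operations that form expressions, so they need comparing only on the
three generating families. -/
theorem descExpr_toMnd {x y : GrayTensor X BDelta} {f g : x ⟶ y} (η : Expr f g) :
    descExpr (toMnd D) η ≍ D.map₂ (cell η) := by
  have hm {x y : GrayTensor X BDelta} {f : x ⟶ y} := heq_of_eq (descMap_toMnd D f)
  induction η with
  | eq h =>
    rw [cell_eq, StrictPseudofunctor.map₂_eqToHom]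
    exact eqToHom_heq_eqToHom rfl rfl hm _ _
  | vcomp η θ ih ih' =>
    rw [cell_vcomp, PrelaxFunctor.map₂_comp]
    exact comp_heq rfl rfl hm hm hm ih ih'
  | whiskerLeft f η ih =>
    exact (descExpr_whiskerLeft_heq _ _ _).trans
      ((whiskerLeft_heq rfl rfl rfl hm hm hm ih).trans (D.map₂_whiskerLeft_heq _ _).symm)
  | whiskerRight η h ih =>
    exact (descExpr_whiskerRight_heq _ _ _).trans
      ((whiskerRight_heq rfl rfl rfl hm hm hm ih).trans (D.map₂_whiskerRight_heq _ _).symm)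
  | left φ c => exact descExpr_left_heq _ φ c
  | right x ψ =>
    exact (descExpr_right_heq _ x ψ).trans
      (StrictPseudofunctor.map₂_heq_of_eq (lift_mndObj D x) ψ)
  | swap f g => exact (descExpr_swap_heq _ f g).trans (powSwap_toMnd D f g)

theorem ofMnd_toMnd : ofMnd (toMnd D) = D :=
  StrictPseudofunctor.ext_of_heq (fun _ => rfl) (fun f => heq_of_eq (descMap_toMnd D f)) (by
    rintro _ _ _ _ ⟨η⟩
    exact descExpr_toMnd D η)

end

end GrayTensor

/-! ### Iterated distributive laws in `B` and in `Mnd B` -/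

namespace Mnd

variable {B : Type u} [Bicategory.{w, v} B] {S T U : Mnd B}

theorem compHom_σ_comp (F : Hom S T) (G : Hom T U) {f : S.a ⟶ U.a}
    (x : (F.f ≫ G.f) ≫ U.M.t ⟶ f) :
    (compHom F G).σ ≫ x = (α_ S.M.t F.f G.f).inv ≫ F.σ ▷ G.f ≫ (α_ F.f T.M.t G.f).hom ≫
      F.f ◁ G.σ ≫ (α_ F.f G.f U.M.t).inv ≫ x := by
  simp only [compHom, Category.assoc]

/-- The structure cell of a composite morphism is made of both structure cells, so compatibility of
`φ` with the composites in the two orders is the Yang–Baxter hexagon up to outer associators. -/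
theorem yangBaxter_iff (F G : Hom S S) (φ : G.f ≫ F.f ⟶ F.f ≫ G.f) :
    YangBaxter φ F.σ G.σ ↔
      (compHom G F).σ ≫ φ ▷ S.M.t = S.M.t ◁ φ ≫ (compHom F G).σ := by
  dsimp only [compHom, YangBaxter]
  rw [← cancel_epi (α_ S.M.t G.f F.f).hom, ← cancel_mono (α_ F.f G.f S.M.t).hom (g := _ ≫ _)]
  simp only [Category.assoc, Iso.hom_inv_id_assoc, Iso.inv_hom_id,
    Category.comp_id]

end Mnd

/-- The data of an `n`-fold distributive law, with the 1-cells numbered in the opposite order. -/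
structure RevLaw (B : Type u) [Bicategory.{w, v} B] (n : ℕ) where
  a : B
  T : Fin n → MonadData a
  σ : ∀ i j : Fin n, i < j → ((T i).t ≫ (T j).t ⟶ (T j).t ≫ (T i).t)

namespace RevLaw

/-- The axioms of an `n`-fold distributive law. -/
structure IsIterated {B : Type u} [Bicategory.{w, v} B] {n : ℕ} (R : RevLaw B n) : Prop where
  monad : ∀ i, (R.T i).IsMonad
  distributive : ∀ (i j : Fin n) (h : i < j), IsDistributiveLaw (R.T j) (R.T i) (R.σ i j h)
  yangBaxter : ∀ (i j k : Fin n) (hij : i < j) (hjk : j < k),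
    YangBaxter (R.σ j k hjk) (R.σ i k (hij.trans hjk)) (R.σ i j hij)

section Reverse

variable {B : Type u} [Bicategory.{w, v} B] {n : ℕ}

/-- The same data, numbered in the order of `LawData`. -/
def toLaw (R : RevLaw B n) : LawData B n where
  a := R.a
  T := fun i => R.T i.rev
  σ := fun i j h => R.σ j.rev i.rev (Fin.rev_lt_rev.mpr h)

/-- The data of an `n`-fold distributive law, numbered in the opposite order. -/
def ofLaw (L : LawData B n) : RevLaw B n where
  a := L.a
  T := fun i => L.T i.rev
  σ := fun i j h => L.σ j.rev i.rev (Fin.rev_lt_rev.mpr h)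

theorem toLaw_ofLaw (L : LawData B n) : (ofLaw L).toLaw = L := by
  -- Double reversal is replaced by a variable map equal to `id`, so that substitution also handles
  -- the dependent types of the 2-cells.
  have key (e : Fin n → Fin n) (he : id = e) (hlt : ∀ i j, i < j → e i < e j) :
      (⟨L.a, fun i => L.T (e i), fun i j h => L.σ (e i) (e j) (hlt i j h)⟩ : LawData B n) = L := by
    subst he
    rfl
  exact key (fun i => i.rev.rev) (funext fun i => (Fin.rev_rev i).symm)
    (fun i j h => Fin.rev_lt_rev.mpr (Fin.rev_lt_rev.mpr h))

theorem ofLaw_toLaw (R : RevLaw B n) : ofLaw R.toLaw = R := by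
  have key (e : Fin n → Fin n) (he : id = e) (hlt : ∀ i j, i < j → e i < e j) :
      (⟨R.a, fun i => R.T (e i), fun i j h => R.σ (e i) (e j) (hlt i j h)⟩ : RevLaw B n) = R := by
    subst he
    rfl
  exact key (fun i => i.rev.rev) (funext fun i => (Fin.rev_rev i).symm)
    (fun i j h => Fin.rev_lt_rev.mpr (Fin.rev_lt_rev.mpr h))

theorem IsIterated.toLaw {R : RevLaw B n} (h : R.IsIterated) :
    R.toLaw.IsIteratedDistributiveLaw where
  monad i := h.monad i.rev
  distributive i j hij := h.distributive j.rev i.rev (Fin.rev_lt_rev.mpr hij)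
  yangBaxter i j k hij hjk :=
    h.yangBaxter k.rev j.rev i.rev (Fin.rev_lt_rev.mpr hjk) (Fin.rev_lt_rev.mpr hij)

theorem IsIterated.ofLaw {L : LawData B n} (h : L.IsIteratedDistributiveLaw) :
    (ofLaw L).IsIterated where
  monad i := h.monad i.rev
  distributive i j hij := h.distributive j.rev i.rev (Fin.rev_lt_rev.mpr hij)
  yangBaxter i j k hij hjk :=
    h.yangBaxter k.rev j.rev i.rev (Fin.rev_lt_rev.mpr hjk) (Fin.rev_lt_rev.mpr hij)

theorem ext_of_heq {a : B} {T T' : Fin n → MonadData a}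
    {σ : ∀ i j : Fin n, i < j → ((T i).t ≫ (T j).t ⟶ (T j).t ≫ (T i).t)}
    {σ' : ∀ i j : Fin n, i < j → ((T' i).t ≫ (T' j).t ⟶ (T' j).t ≫ (T' i).t)}
    (hT : ∀ i, T i = T' i) (hσ : ∀ i j h, σ i j h ≍ σ' i j h) :
    (⟨a, T, σ⟩ : RevLaw B n) = ⟨a, T', σ'⟩ := by
  obtain rfl : T = T' := funext hT
  obtain rfl : σ = σ' := funext fun i => funext fun j => funext fun h => eq_of_heq (hσ i j h)
  rfl

/-- The monads of `push`. -/
def pushT (L : RevLaw (Mnd B) n) : Fin (n + 1) → MonadData L.a.a :=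
  Fin.cases L.a.M (fun i =>
    { t := Mnd.Hom.f (L.T i).t
      η := Mnd.Hom₂.val (L.T i).η
      μ := Mnd.Hom₂.val (L.T i).μ })

/-- The distributive laws of `push`. -/
def pushσ (L : RevLaw (Mnd B) n) : ∀ i j : Fin (n + 1), i < j →
    ((L.pushT i).t ≫ (L.pushT j).t ⟶ (L.pushT j).t ≫ (L.pushT i).t) :=
  Fin.cases
    (Fin.cases (fun h => absurd h (lt_irrefl 0)) (fun j _ => Mnd.Hom.σ (L.T j).t))
    (fun i => Fin.cases (fun h => absurd h (Fin.not_lt_zero _))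
      (fun j h => Mnd.Hom₂.val (L.σ i j (Fin.succ_lt_succ_iff.mp h))))

/-- An `n`-fold distributive law on a monad, in the 2-category of monads, as an `(n + 1)`-fold
distributive law. -/
def push (L : RevLaw (Mnd B) n) : RevLaw B (n + 1) where
  a := L.a.a
  T := L.pushT
  σ := L.pushσ

end Reverse

section

variable {B : Type u} [Bicategory.{w, v} B] {n : ℕ}

theorem isIterated_push {L : RevLaw (Mnd B) n} (h : L.IsIterated) : L.push.IsIterated where
  monad := by
    refine Fin.cases L.a.isMonad (fun i => ?_)
    exact
      { left_unit := congrArg Mnd.Hom₂.val (h.monad i).left_unit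
        right_unit := congrArg Mnd.Hom₂.val (h.monad i).right_unit
        assoc := congrArg Mnd.Hom₂.val (h.monad i).assoc }
  distributive := by
    refine Fin.cases (Fin.cases (fun h => absurd h (lt_irrefl 0)) (fun j _ => ?_))
      (fun i => Fin.cases (fun h => absurd h (Fin.not_lt_zero _)) (fun j hij => ?_))
    -- For pairs involving the base monad, the axioms for the unit and multiplication of the upper
    -- monad are its 2-cell conditions in `Mnd B`; those for the base monad are the laws of a monad
    -- morphism.
    · exact
        { unit_left := (Mnd.Hom₂.comm (L.T j).η).symm.trans (Category.assoc _ _ _)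
          unit_right := Mnd.Hom.unit (L.T j).t
          mul_left := (Mnd.Hom₂.comm (L.T j).μ).symm.trans
            (Mnd.compHom_σ_comp (L.T j).t (L.T j).t _)
          mul_right := Mnd.Hom.mul (L.T j).t }
    · have hd := h.distributive i j (Fin.succ_lt_succ_iff.mp hij)
      exact
        { unit_left := congrArg Mnd.Hom₂.val hd.unit_left
          unit_right := congrArg Mnd.Hom₂.val hd.unit_right
          mul_left := congrArg Mnd.Hom₂.val hd.mul_left
          mul_right := congrArg Mnd.Hom₂.val hd.mul_right }
  yangBaxter := by
    refine Fin.cases (Fin.cases (fun _ h => absurd h (lt_irrefl 0)) (fun j => Fin.cases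
        (fun _ h => absurd h (Fin.not_lt_zero _)) (fun k _ hjk => ?_)))
      (fun i => Fin.cases (fun _ h => absurd h (Fin.not_lt_zero _)) (fun j => Fin.cases
        (fun _ h => absurd h (Fin.not_lt_zero _)) (fun k hij hjk => ?_)))
    -- Triples involving the base monad: the law between the other two monads is a 2-cell of `Mnd
    -- B`.
    · exact (Mnd.yangBaxter_iff (L.T k).t (L.T j).t _).mpr
        (Mnd.Hom₂.comm (L.σ j k (Fin.succ_lt_succ_iff.mp hjk)))
    · exact congrArg Mnd.Hom₂.val
        (h.yangBaxter i j k (Fin.succ_lt_succ_iff.mp hij) (Fin.succ_lt_succ_iff.mp hjk))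

/-- The monad morphism that corresponds to the distributive law between the monads number `0` and
number `j + 1`. -/
def pullHom (R : RevLaw B (n + 1)) (h : R.IsIterated) (j : Fin n) :
    Mnd.Hom ⟨R.a, R.T 0, h.monad 0⟩ ⟨R.a, R.T 0, h.monad 0⟩ where
  f := (R.T j.succ).t
  σ := R.σ 0 j.succ j.succ_pos
  unit := (h.distributive 0 j.succ j.succ_pos).unit_right
  mul := (h.distributive 0 j.succ j.succ_pos).mul_right

/-- An `(n + 1)`-fold distributive law as an `n`-fold distributive law in the 2-category of
monads. -/
def pull (R : RevLaw B (n + 1)) (h : R.IsIterated) : RevLaw (Mnd B) n where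
  a := ⟨R.a, R.T 0, h.monad 0⟩
  T j :=
    { t := pullHom R h j
      η := ⟨(R.T j.succ).η, (Category.assoc _ _ _).trans
        (h.distributive 0 j.succ j.succ_pos).unit_left.symm⟩
      μ := ⟨(R.T j.succ).μ, (Mnd.compHom_σ_comp _ _ _).trans
        (h.distributive 0 j.succ j.succ_pos).mul_left.symm⟩ }
  σ i j hij := ⟨R.σ i.succ j.succ (Fin.succ_lt_succ_iff.mpr hij),
    (Mnd.yangBaxter_iff (pullHom R h j) (pullHom R h i) _).mp
      (h.yangBaxter 0 i.succ j.succ i.succ_pos (Fin.succ_lt_succ_iff.mpr hij))⟩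

theorem isIterated_pull (R : RevLaw B (n + 1)) (h : R.IsIterated) : (R.pull h).IsIterated where
  monad i :=
    { left_unit := Mnd.hom₂_ext (h.monad i.succ).left_unit
      right_unit := Mnd.hom₂_ext (h.monad i.succ).right_unit
      assoc := Mnd.hom₂_ext (h.monad i.succ).assoc }
  distributive i j hij := by
    have hd := h.distributive i.succ j.succ (Fin.succ_lt_succ_iff.mpr hij)
    exact
      { unit_left := Mnd.hom₂_ext hd.unit_left
        unit_right := Mnd.hom₂_ext hd.unit_right
        mul_left := Mnd.hom₂_ext hd.mul_left
        mul_right := Mnd.hom₂_ext hd.mul_right }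
  yangBaxter i j k hij hjk := Mnd.hom₂_ext
    (h.yangBaxter i.succ j.succ k.succ (Fin.succ_lt_succ_iff.mpr hij)
      (Fin.succ_lt_succ_iff.mpr hjk))

theorem push_pull (R : RevLaw B (n + 1)) (h : R.IsIterated) : (R.pull h).push = R :=
  ext_of_heq (Fin.cases rfl (fun _ => rfl))
    (Fin.cases (Fin.cases (fun h => absurd h (lt_irrefl 0)) (fun _ _ => HEq.rfl))
      (fun _ => Fin.cases (fun h => absurd h (Fin.not_lt_zero _)) (fun _ _ => HEq.rfl)))

end

end RevLaw

/-! ### The universal property by induction on the number of factors -/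

theorem swapMap_heq {B : Type u₁} [Bicategory.{w₁, v₁} B] {C : Type u₂} [Bicategory.{w₂, v₂} C]
    [Bicategory.Strict B] [Bicategory.Strict C]
    (F : StrictPseudofunctor B C) {a : B} {f g : a ⟶ a} (σ : f ≫ g ⟶ g ≫ f) :
    swapMap F σ ≍ F.map₂ σ := by
  simp only [swapMap, F.mapComp_eq_eqToIso, eqToIso.inv, eqToIso.hom]
  exact conj_heq _ _ _

theorem swapMap_comp {B : Type u₁} [Bicategory.{w₁, v₁} B] {C : Type u₂} [Bicategory.{w₂, v₂} C]
    {E : Type u} [Bicategory.{w, v} E] [Bicategory.Strict B] [Bicategory.Strict C]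
    [Bicategory.Strict E] (F : StrictPseudofunctor B C) (G : StrictPseudofunctor C E) {a : B}
    {f g : a ⟶ a} (σ : f ≫ g ⟶ g ≫ f) : swapMap G (swapMap F σ) = swapMap (F.comp G) σ := by
  refine eq_of_heq ((swapMap_heq G _).trans (HEq.trans ?_ (swapMap_heq (F.comp G) σ).symm))
  simp only [swapMap, F.mapComp_eq_eqToIso, eqToIso.inv, eqToIso.hom, PrelaxFunctor.map₂_comp,
    StrictPseudofunctor.map₂_eqToHom]
  exact conj_heq _ _ _

theorem swapMap_heq_of_eq {B : Type u₁} [Bicategory.{w₁, v₁} B] {C : Type u₂}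
    [Bicategory.{w₂, v₂} C] {F G : StrictPseudofunctor B C} (h : F = G) {a : B} {f g : a ⟶ a}
    (σ : f ≫ g ⟶ g ≫ f) : swapMap F σ ≍ swapMap G σ := by
  rw [h]

theorem GrayTensor.toMnd_comp_forget {X : Type u₁} [Bicategory.{w₁, v₁} X] [Bicategory.Strict X]
    {B : Type u} [Bicategory.{w, v} B] [Bicategory.Strict B]
    (D : StrictPseudofunctor (GrayTensor X BDelta) B) :
    (toMnd D).comp (Mnd.forget B) = (inl BDelta.pt).comp D :=
  StrictPseudofunctor.ext_of_heq (fun _ => rfl) (fun _ => HEq.rfl) (fun _ => HEq.rfl)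

namespace RevLawData

variable {X : StrictTwoCat} {n : ℕ}

/-- The images of the given cells under a strict 2-functor, in the numbering of the given cells. -/
def revImage {B : Type u} [Bicategory.{w, v} B] (U : RevLawData X n)
    (D : StrictPseudofunctor X.carrier B) : RevLaw B n where
  a := D.obj U.a
  T := fun i => (U.T i).map D
  σ := fun i j h => swapMap D (U.σ i j h)

/-- Strict 2-functors to a 2-category correspond to the `n`-fold distributive laws in it. -/
def IsUniversal (U : RevLawData X n) : Prop :=
  ∀ (B : Type u) [Bicategory.{w, v} B] [Bicategory.Strict B],
    (∀ D : StrictPseudofunctor X.carrier B, (U.revImage D).IsIterated) ∧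
      ∀ R : RevLaw B n, R.IsIterated →
        ∃! D : StrictPseudofunctor X.carrier B, U.revImage D = R

theorem IsUniversal.image {U : RevLawData X n} (hU : IsUniversal.{w, v, u} U) (B : Type u)
    [Bicategory.{w, v} B] [Bicategory.Strict B] :
    (∀ D : StrictPseudofunctor X.carrier B, (U.image D).IsIteratedDistributiveLaw) ∧
      ∀ L : LawData B n, L.IsIteratedDistributiveLaw →
        ∃! D : StrictPseudofunctor X.carrier B, U.image D = L := by
  refine ⟨fun D => ((hU B).1 D).toLaw, fun L hL => ?_⟩
  obtain ⟨D, hD, hu⟩ := (hU B).2 (RevLaw.ofLaw L) (.ofLaw hL)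
  refine ⟨D, (congrArg RevLaw.toLaw hD).trans (RevLaw.toLaw_ofLaw L), fun D' hD' => hu D' ?_⟩
  exact (RevLaw.ofLaw_toLaw _).symm.trans (congrArg RevLaw.ofLaw hD')

section Cons

variable {B : Type u} [Bicategory.{w, v} B] [Bicategory.Strict B] (U : RevLawData X n)

theorem pushT_revImage (E : StrictPseudofunctor X.carrier (Mnd B)) (i : Fin n) :
    (U.revImage E).pushT i.succ = (U.T i).map (E.comp (Mnd.forget B)) := by
  rw [← MonadData.map_map]
  exact MonadData.ext_of_heq rfl (heq_of_eq (Category.id_comp _).symm)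
    (heq_of_eq (Category.id_comp _).symm)

theorem pushσ_revImage (E : StrictPseudofunctor X.carrier (Mnd B)) (i j : Fin n) (h : i < j) :
    (U.revImage E).pushσ i.succ j.succ (Fin.succ_lt_succ_iff.mpr h) ≍
      swapMap (E.comp (Mnd.forget B)) (U.σ i j h) := by
  rw [← swapMap_comp]
  exact heq_of_eq ((Category.id_comp _).trans (Category.comp_id _)).symm

/-- Cells of the new factor and its interchange cells are by construction the base monad and
structure cells of `toMnd D`. The old cells agree because forgetting the monads turns `toMnd D` into
the restriction of `D` along `inl`. -/
theorem revImage_cons (D : StrictPseudofunctor (GrayTensor X.carrier BDelta) B) :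
    (cons U).revImage D = (U.revImage (GrayTensor.toMnd D)).push := by
  have hD := GrayTensor.toMnd_comp_forget D
  refine RevLaw.ext_of_heq (Fin.cases rfl fun i => ?_)
    (Fin.cases (Fin.cases (fun h => absurd h (lt_irrefl 0)) fun j h => HEq.rfl)
      fun i => Fin.cases (fun h => absurd h (Fin.not_lt_zero _)) fun j h => ?_)
  · exact (MonadData.map_map (GrayTensor.inl BDelta.pt) D (U.T i)).trans
      ((eq_of_heq (MonadData.map_heq_of_eq hD (U.T i))).symm.trans (pushT_revImage U _ i).symm)
  · have h' := Fin.succ_lt_succ_iff.mp h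
    exact (heq_of_eq (swapMap_comp (GrayTensor.inl BDelta.pt) D (U.σ i j h'))).trans
      ((swapMap_heq_of_eq hD (U.σ i j h')).symm.trans (pushσ_revImage U _ i j h').symm)

end Cons

/-- The induction step: the hypothesis is applied with target `Mnd B`, and `push`, `pull` translate
the laws found there. -/
theorem IsUniversal.cons {U : RevLawData X n}
    (hU : IsUniversal.{w, max v w, max u v w} U) : IsUniversal.{w, v, u} U.cons := by
  intro B _ _
  constructor
  · intro D
    exact (congrArg RevLaw.IsIterated (revImage_cons U D)).mpr
      (RevLaw.isIterated_push ((hU (Mnd B)).1 (GrayTensor.toMnd D)))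
  · intro R hR
    obtain ⟨E, hE, hu⟩ := (hU (Mnd B)).2 (R.pull hR) (R.isIterated_pull hR)
    refine ⟨GrayTensor.ofMnd E, ?_, fun D hD => ?_⟩
    · refine (revImage_cons U _).trans ?_
      rw [GrayTensor.toMnd_ofMnd]
      exact (congrArg RevLaw.push hE).trans (R.push_pull hR)
    · refine (GrayTensor.ofMnd_toMnd D).symm.trans (congrArg _ (hu _ ?_))
      -- After substitution, `pull` undoes `push` definitionally.
      have h := (revImage_cons U D).symm.trans hD
      subst h
      rfl

theorem isUniversal_nil : IsUniversal.{w, v, u} (nil (X := StrictTwoCat.one) ⟨⟨PUnit.unit⟩⟩) := by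
  intro B _ _
  refine ⟨fun D => ⟨fun i => i.elim0, fun i => i.elim0, fun i => i.elim0⟩, fun R _ => ?_⟩
  refine ⟨StrictPseudofunctor.mk''
    { obj := fun _ => R.a
      map := fun _ => 𝟙 R.a
      map₂ := fun _ => 𝟙 (𝟙 R.a)
      map₂_id := fun _ => rfl
      map₂_comp := fun _ _ => (Category.comp_id _).symm
      map_id := fun _ => rfl
      map_comp := fun _ _ => (Bicategory.Strict.id_comp _).symm
      map₂_whisker_left := fun _ _ _ _ => by simp
      map₂_whisker_right := fun _ _ => by simp }, ?_, fun D hD => ?_⟩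
  · exact RevLaw.ext_of_heq (fun i => i.elim0) (fun i => i.elim0)
  · subst hD
    have h (x : LocallyDiscrete (Discrete PUnit)) : D.map (𝟙 x) = 𝟙 (D.obj x) := D.map_id x
    have h' (x : LocallyDiscrete (Discrete PUnit)) : D.map₂ (𝟙 (𝟙 x)) ≍ 𝟙 (𝟙 (D.obj x)) :=
      (heq_of_eq (D.map₂_id (𝟙 x))).trans (eqToHom_heq_eqToHom rfl rfl (heq_of_eq (h x)) rfl rfl)
    refine StrictPseudofunctor.ext_of_heq (fun _ => rfl) (fun {x y} f => ?_)
      (fun {x y f g} η => ?_)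
    · obtain ⟨⟨⟨⟩⟩⟩ : LocallyDiscrete (Discrete PUnit) := x
      obtain ⟨⟨⟨⟩⟩⟩ : LocallyDiscrete (Discrete PUnit) := y
      obtain ⟨⟨⟨_⟩⟩⟩ : Discrete (Discrete.mk PUnit.unit ⟶ Discrete.mk PUnit.unit) := f
      exact heq_of_eq (h _)
    · obtain ⟨⟨⟨⟩⟩⟩ : LocallyDiscrete (Discrete PUnit) := x
      obtain ⟨⟨⟨⟩⟩⟩ : LocallyDiscrete (Discrete PUnit) := y
      obtain ⟨⟨⟨_⟩⟩⟩ : Discrete (Discrete.mk PUnit.unit ⟶ Discrete.mk PUnit.unit) := f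
      obtain ⟨⟨⟨_⟩⟩⟩ : Discrete (Discrete.mk PUnit.unit ⟶ Discrete.mk PUnit.unit) := g
      obtain ⟨⟨_⟩⟩ := η
      exact h' _

theorem isUniversal_bDelta : IsUniversal.{w, v, u} bDelta := by
  intro B _ _
  refine ⟨fun D => ?_, fun R hR => ?_⟩
  · exact
      { monad := fun _ => BDelta.isMonad_univ.map D
        distributive := fun i j h => absurd h (by rw [Subsingleton.elim i j]; exact lt_irrefl j)
        yangBaxter := fun i j _ h => absurd h (by rw [Subsingleton.elim i j]; exact lt_irrefl j) }
  · refine ⟨BDelta.lift ⟨R.a, R.T 0, hR.monad 0⟩, ?_, fun D hD => ?_⟩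
    · refine RevLaw.ext_of_heq (fun i => ?_)
        (fun i j h => absurd h (by rw [Subsingleton.elim i j]; exact lt_irrefl j))
      rw [Subsingleton.elim i 0]
      exact BDelta.map_univ_lift ⟨R.a, R.T 0, hR.monad 0⟩
    · subst hD
      exact (BDelta.lift_toMnd D).symm

/-- Passing from `B` to `Mnd B` raises universe levels, but a second passage does not raise them
further. The induction runs at these stable levels; one last step descends to arbitrary ones. -/
theorem isUniversal_mndIter_stable : ∀ n : ℕ,
    IsUniversal.{w, max v w, max u v w} (RevLawData.mndIter n)
  | 0 => isUniversal_nil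
  | n + 1 => IsUniversal.cons (isUniversal_mndIter_stable n)

theorem isUniversal_mndIter : ∀ n : ℕ, IsUniversal.{w, v, u} (RevLawData.mndIter n)
  | 0 => isUniversal_nil
  | n + 1 => IsUniversal.cons (isUniversal_mndIter_stable.{w, v, u} n)

theorem isUniversal_bDeltaPow_stable : ∀ n : ℕ,
    IsUniversal.{w, max v w, max u v w} (RevLawData.bDeltaPow n)
  | 0 => isUniversal_nil
  | 1 => isUniversal_bDelta
  | n + 2 => IsUniversal.cons (isUniversal_bDeltaPow_stable (n + 1))

theorem isUniversal_bDeltaPow : ∀ n : ℕ, IsUniversal.{w, v, u} (RevLawData.bDeltaPow n)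
  | 0 => isUniversal_nil
  | 1 => isUniversal_bDelta
  | n + 2 => IsUniversal.cons (isUniversal_bDeltaPow_stable.{w, v, u} (n + 1))

end RevLawData

theorem mainTheorem5 {B : Type u} [Bicategory.{w, v} B] [Bicategory.Strict B] (n : ℕ) :
    ((∀ D : StrictPseudofunctor (StrictTwoCat.one.mndIter n).carrier B,
        ((RevLawData.mndIter n).image D).IsIteratedDistributiveLaw) ∧
      ∀ L : LawData B n, L.IsIteratedDistributiveLaw →
        ∃! D : StrictPseudofunctor (StrictTwoCat.one.mndIter n).carrier B,
          (RevLawData.mndIter n).image D = L) ∧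
    ((∀ D : StrictPseudofunctor (StrictTwoCat.bDeltaPow n).carrier B,
        ((RevLawData.bDeltaPow n).image D).IsIteratedDistributiveLaw) ∧
      ∀ L : LawData B n, L.IsIteratedDistributiveLaw →
        ∃! D : StrictPseudofunctor (StrictTwoCat.bDeltaPow n).carrier B,
          (RevLawData.bDeltaPow n).image D = L) :=
  ⟨(RevLawData.isUniversal_mndIter n).image B, (RevLawData.isUniversal_bDeltaPow n).image B⟩
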